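/- **Setting.** Consider the free massless scalar field $\phi_0$ on Minkowski space $\mathbb R^4$ with signature $(+,-,-,-)$, Lorentz product $xp$, and open forward light cone $V_+$. Put $\partial^\nu=\eta^{\nu\nu}\partial_\nu$ (no sum), $\partial^{\boldsymbol\mu}=\partial^{\mu_1}\cdots\partial^{\mu_m}$ and $\square=\partial_\nu\partial^\nu$. Let $\mathcal A$ be the unital polynomial $*$-algebra generated by the smeared fields $\phi_0(f)$, $f\in C_c^\infty(\mathbb R^4;\mathbb C)$, which are linear in $f$ and satisfy $\phi_0(f)^*=\phi_0(\overline f)$, $\phi_0(\square f)=0$ and $$[\phi_0(x_1),\phi_0(x_2)]=(2\pi)^{-3}\int dp\,e^{-i(x_1-x_2)p}\,\varepsilon(p_0)\,\delta(p^2)\cdot 1 .$$ States are positive normalized linear functionals on $\mathcal A$, invariant under $\phi_0\mapsto-\phi_0$. For $\beta\in V_+$ let $\omega_\beta$ be the quasifree state with two-point function $$\omega_\beta(\phi_0(x_1)\phi_0(x_2))=(2\pi)^{-3}\int dp\,e^{-i(x_1-x_2)p}\,\varepsilon(p_0)\,\delta(p^2)\,\frac1{1-e^{-\beta p}},$$ and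 let $\omega_\infty$ be the vacuum (the limit $\beta\to\infty$). For compact $B\subset V_+$ let $\mathcal C_B$ be the set of mixtures $\int d\rho(\beta)\,\omega_\beta$ with $\rho$ a probability measure supported in $B$. **Local observables.** Let $\mathcal S_x$ be spanned by $1$, $\phi_0(x)$ and, for all multi-indices $\boldsymbol\mu$ with entries in $\{0,1,2,3\}$, $$\theta^{\boldsymbol\mu}(x)=\lim_{\zeta\to0}\partial_\zeta^{\boldsymbol\mu}\big(\phi_0(x+\zeta)\phi_0(x-\zeta)-\omega_\infty(\phi_0(x+\zeta)\phi_0(x-\zeta))\,1\big),\qquad \zeta\ \text{space-like}.$$ A state $\omega$ is in the domain of these forms on an open set $\mathcal O\subset\mathbb R^4$ if the following holds. The distribution $f\mapsto\omega(\phi_0(f))$ is given on $\mathcal O$ by a continuous function $x\mapsto\omega(\phi_0(x))$. At space-like separated points of a neighbourhood of $\{(x,x):x\in\mathcal O\}$ the normal ordered two-point function $\omega(\phi_0(x_1)\phi_0(x_2))-\omega_\infty(\phi_0(x_1)\phi_0(x_2))$ is a smooth function. For every $\boldsymbol\mu$ the above limit, taken in the state $\omega$, exists at each $x\in\mathcal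 O$, is locally integrable in $x\in\mathcal O$, and is also attained in the sense of distributions in $x\in\mathcal O$. Call $\omega$ *$\mathcal S_{\mathcal O}$-thermal* if it is in the domain of these forms on $\mathcal O$ and there are reference states $\omega_{B_x}\in\mathcal C_{B_x}$, $x\in\mathcal O$, with the following properties. First, $\omega(\psi(x))=\omega_{B_x}(\psi(x))$ for all $\psi(x)\in\mathcal S_x$ and $x\in\mathcal O$. Secondly, $x\mapsto\omega_{B_x}(A)$ is locally integrable on $\mathcal O$ for every $A\in\mathcal A$. Thirdly, for every compact $C\subset\mathcal O$ there is a compact set $B\subset V_+$ with $\omega_{B_x}\in\mathcal C_B$ for all $x\in C$. **Macro-observables.** The macro-observable $\Psi$ of a local observable $\psi(x)$ is identified with its thermal function $\Psi(\beta)=\omega_\beta(\psi(0))$, $\beta\in V_+$. An *admissible* macro-observable is a smooth function $\Xi:V_+\to\mathbb C$ with $\square_\beta\Xi=0$ on $V_+$. The lift of an $\mathcal S_{\mathcal O}$-thermal state $\omega$ at $x\in\mathcal O$ is $\omega(\Psi)(x)=\omega(\psi(x))$ for $\psi(x)\in\mathcal S_x$, extended to admissible $\Xi$ by continuity with respect to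 the seminorms $\|\Xi\|_B=\sup_{\beta\in B}|\Xi(\beta)|$, $B\subset V_+$ compact. That is, $\omega(\Xi)(x)$ is the limit of the values $\omega(\Psi)(x)$ as the thermal functions $\Psi$ of elements of $\mathcal S_x$ approximate $\Xi$ in these seminorms. **Lemma 4.1.** Let $\mathcal O\subset\mathbb R^4$ be open, let $\omega$ be an $\mathcal S_{\mathcal O}$-thermal state and let $\Xi$ be an admissible macro-observable. Then the lifted expectation values $\omega(\Xi)(x)$ and $\omega(\partial^\nu\Xi)(x)$, $\nu=0,1,2,3$, exist for all $x\in\mathcal O$ (in particular, $\Xi$ and $\partial^\nu\Xi$ can be approximated by thermal functions as just described) and are locally integrable in $x\in\mathcal O$. In the sense of distributions, $$\partial_\nu\,\omega(\partial^\nu\Xi)(x)=0,\qquad \square\,\omega(\Xi)(x)=0\qquad\text{on }\mathcal O,$$ where $\partial^\nu\Xi$ is the macro-observable with thermal function $\beta\mapsto\partial^\nu\Xi(\beta)$ and $\nu$ is summed over in the first equation. -/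

import Mathlib

open MeasureTheory Filter TopologicalSpace
open scoped Distributions LineDeriv Topology

namespace LocalEq

noncomputable section

/-! ### Minkowski space -/

/-- The space `ℝ⁴`, with coordinates `x 0` (time), `x 1`, `x 2`, `x 3`. Only its topology, its
linear structure and its Lebesgue measure are used; the geometry is that of `mink`. -/
abbrev Mink : Type := EuclideanSpace ℝ (Fin 4)

/-- The signature `(+, -, -, -)`. -/
def eta (ν : Fin 4) : ℝ := if ν = 0 then 1 else -1

/-- The Lorentz product `x y`. -/
def mink (x y : Mink) : ℝ := ∑ ν, eta ν * (x ν * y ν)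

/-- The open forward light cone `V₊`. -/
def forwardCone : Set Mink := {β | 0 < mink β β ∧ 0 < β 0}

/-- The open forward light cone as a type: the set of temperature vectors. -/
abbrev Cone : Type := {β : Mink // β ∈ forwardCone}

/-- The coordinate unit vectors. -/
def e (ν : Fin 4) : Mink := EuclideanSpace.single ν 1

/-- Space-like vectors. -/
def spacelike : Set Mink := {ζ | mink ζ ζ < 0}

/-- Pairs of space-like separated points. -/
def spacelikePairs : Set (Mink × Mink) := {z | z.1 - z.2 ∈ spacelike}

/-- `∂_ν F`. -/
def dLow (ν : Fin 4) (F : Mink → ℂ) : Mink → ℂ := fun x => fderiv ℝ F x (e ν)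

/-- `∂^ν F`. -/
def dUp (ν : Fin 4) (F : Mink → ℂ) : Mink → ℂ := fun x => (eta ν : ℂ) * dLow ν F x

/-- `∂^{μ₁} ⋯ ∂^{μₘ} F` for a multi-index `(μ₁, …, μₘ)`. -/
def dUpList : List (Fin 4) → (Mink → ℂ) → (Mink → ℂ)
  | [], F => F
  | ν :: μ, F => dUp ν (dUpList μ F)

/-- The wave operator `□ = ∂_ν ∂^ν`. -/
def box (F : Mink → ℂ) : Mink → ℂ := fun x => ∑ ν, dLow ν (dUp ν F) x

/-! ### Test functions -/

/-- Complex test functions of compact support on `ℝ⁴`. -/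
abbrev Test : Type := 𝓓((⊤ : Opens Mink), ℂ)

/-- The wave operator on test functions. -/
def boxTest {O : Opens Mink} (f : 𝓓(O, ℂ)) : 𝓓(O, ℂ) :=
  ∑ ν, (eta ν : ℂ) • ∂_{e ν} (∂_{e ν} f)

/-- The complex conjugate of a test function. -/
def conjTest (f : Test) : Test :=
  TestFunction.postcompCLM (𝕜 := ℝ) (Complex.conjCLE : ℂ →L[ℝ] ℂ) f

/-- `f̃(p) = ∫ dx f(x) e^{-ixp}` with the Lorentz product in the exponent. -/
def lorentzFourier (f : Test) (p : Mink) : ℂ :=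
  ∫ x : Mink, Complex.exp (-(Complex.I * (mink x p : ℂ))) * f x

/-! ### Distributions of the massless free field -/

/-- The four-momentum `(s, 𝐩)`. -/
def fourMom (s : ℝ) (p : EuclideanSpace ℝ (Fin 3)) : Mink := !₂[s, p 0, p 1, p 2]

/-- `(2π)⁻³ ∫ dp ε(p₀) δ(p²) G(p)`: as `δ(p²)` is the sum of the measures `d³𝐩 / (2|𝐩|)` on the
sheets `p₀ = |𝐩|` and `p₀ = -|𝐩|` of the light cone, this is
`(2π)⁻³ ∫ d³𝐩 (2|𝐩|)⁻¹ (G(|𝐩|, 𝐩) - G(-|𝐩|, 𝐩))`. -/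
def lightConeIntegral (G : Mink → ℂ) : ℂ :=
  ((2 * Real.pi : ℝ) : ℂ)⁻¹ ^ 3 *
    ∫ p : EuclideanSpace ℝ (Fin 3),
      (G (fourMom ‖p‖ p) - G (fourMom (-‖p‖) p)) / ((2 * ‖p‖ : ℝ) : ℂ)

/-- The factor `∫ dx₁ dx₂ f(x₁) g(x₂) e^{-i(x₁-x₂)p} = f̃(p) g̃(-p)`. -/
def smear (f g : Test) (p : Mink) : ℂ := lorentzFourier f p * lorentzFourier g (-p)

/-- The commutator function, smeared with `f` and `g`. -/
def commutatorForm (f g : Test) : ℂ := lightConeIntegral (smear f g)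

/-- The two-point function of the equilibrium state with temperature vector `β`. -/
def kmsForm (β : Cone) (f g : Test) : ℂ :=
  lightConeIntegral fun p => smear f g p * ((1 - Real.exp (-mink β.1 p) : ℝ) : ℂ)⁻¹

/-- The two-point function of the vacuum: the limit of `kmsForm` for `β` tending to infinity, in
which `1 / (1 - e^{-βp})` becomes `1` for `p₀ > 0` and `0` for `p₀ < 0`. -/
def vacuumForm (f g : Test) : ℂ :=
  lightConeIntegral fun p => if 0 < p 0 then smear f g p else 0

/-! ### The polynomial algebra of the field and its states -/

/-- The relations of the algebra: `φ₀(f)` is linear in `f`, satisfies the wave equation, and has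
the commutator of the massless free field. -/
inductive FieldRel : FreeAlgebra ℂ Test → FreeAlgebra ℂ Test → Prop
  | add (f g : Test) :
      FieldRel (FreeAlgebra.ι ℂ (f + g)) (FreeAlgebra.ι ℂ f + FreeAlgebra.ι ℂ g)
  | smul (c : ℂ) (f : Test) : FieldRel (FreeAlgebra.ι ℂ (c • f)) (c • FreeAlgebra.ι ℂ f)
  | wave (f : Test) : FieldRel (FreeAlgebra.ι ℂ (boxTest f)) 0
  | comm (f g : Test) :
      FieldRel (FreeAlgebra.ι ℂ f * FreeAlgebra.ι ℂ g - FreeAlgebra.ι ℂ g * FreeAlgebra.ι ℂ f)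
        (algebraMap ℂ (FreeAlgebra ℂ Test) (commutatorForm f g))

/-- The algebra `𝒜` of polynomials in the massless free field. -/
abbrev FieldAlgebra : Type := RingQuot FieldRel

/-- The smeared field `φ₀(f)`. -/
def field (f : Test) : FieldAlgebra := RingQuot.mkAlgHom ℂ FieldRel (FreeAlgebra.ι ℂ f)

/-- The monomial `φ₀(f₁) ⋯ φ₀(fₙ)`. -/
def monomial (l : List Test) : FieldAlgebra := (l.map field).prod

/-- The element `A = ∑ c φ₀(f₁) ⋯ φ₀(fₙ)`; every element of the algebra is of this form. -/
def poly (P : List Test →₀ ℂ) : FieldAlgebra := P.sum fun l c => c • monomial l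

/-- The element `A* = ∑ c̄ φ₀(f̄ₙ) ⋯ φ₀(f̄₁)` for `A = ∑ c φ₀(f₁) ⋯ φ₀(fₙ)`. -/
def polyStar (P : List Test →₀ ℂ) : FieldAlgebra :=
  P.sum fun l c => (starRingEnd ℂ c) • monomial ((l.map conjTest).reverse)

/-- States: normalized functionals with `ω(A* A) ≥ 0`, here required to be invariant under the
gauge transformation `φ₀ ↦ -φ₀`. -/
structure IsState (ω : FieldAlgebra →ₗ[ℂ] ℂ) : Prop where
  normalized : ω 1 = 1
  positive : ∀ P : List Test →₀ ℂ,
    0 ≤ (ω (polyStar P * poly P)).re ∧ (ω (polyStar P * poly P)).im = 0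
  gauge : ∀ l : List Test, ω (monomial (l.map fun f => -f)) = ω (monomial l)

/-- A hierarchy of `n`-point functions `ω(φ₀(f₁) ⋯ φ₀(fₙ))`, by which a functional on the algebra
is determined. -/
abbrev NPoint : Type := List Test → ℂ

/-- The `n`-point functions of a functional. -/
def nPoint (ω : FieldAlgebra →ₗ[ℂ] ℂ) : NPoint := fun l => ω (monomial l)

/-- The `n`-point functions of the quasifree state with two-point function `W`: the sum over all
pairings of the product of the two-point functions (the first factor is paired with the factor
number `i` of the rest, and so on; there is no pairing if `n` is odd). -/
def wick (W : Test → Test → ℂ) : NPoint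
  | [] => 1
  | f :: l => ∑ i : Fin l.length, W f (l.get i) * wick W (l.eraseIdx i)
  termination_by l => l.length
  decreasing_by
    have h := List.length_eraseIdx_add_one i.isLt
    simp only [List.length_cons]
    omega

/-- The equilibrium state `ω_β`. -/
def kms (β : Cone) : NPoint := wick (kmsForm β)

/-- The set `𝒞_B` of thermal reference states: the mixtures `∫ dρ(β) ω_β` with a normalized
measure `ρ` supported in `B`. -/
def referenceStates (B : Set Cone) : Set NPoint :=
  {w | ∃ ρ : Measure Cone, IsProbabilityMeasure ρ ∧ ρ Bᶜ = 0 ∧ ∀ l, w l = ∫ β, kms β l ∂ρ}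

/-! ### Local observables at a point -/

/-- The generators of the space `𝒮_x`: the unit operator, the field `φ₀(x)`, and the balanced
derivatives `θ^μ(x)` of its normal ordered square for all multi-indices `μ`. -/
inductive LocalField : Type
  | one
  | field
  | theta (μ : List (Fin 4))

/-- On the pairs of space-like separated points in `N`, the normal ordered two-point function
`ω(φ₀(x₁) φ₀(x₂)) - ω_∞(φ₀(x₁) φ₀(x₂))` is the smooth function `K`. -/
structure IsNormalOrdered (w : NPoint) (N : Set (Mink × Mink)) (K : Mink × Mink → ℂ) : Prop where
  smooth : ContDiffOn ℝ (⊤ : ℕ∞) K (N ∩ spacelikePairs)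
  represents : ∀ f g : Test, tsupport f ×ˢ tsupport g ⊆ N ∩ spacelikePairs →
    w [f, g] - vacuumForm f g = ∫ z : Mink × Mink, f z.1 * g z.2 * K z

/-- `∂_ζ^μ K(x + ζ, x - ζ)`. -/
def balanced (K : Mink × Mink → ℂ) (μ : List (Fin 4)) (x ζ : Mink) : ℂ :=
  dUpList μ (fun ζ' => K (x + ζ', x - ζ')) ζ

/-- The state with `n`-point functions `w` is in the domain of the forms `1`, `φ₀(x)`, `θ^μ(x)` for
`x` in `O`, and `E` lists its expectation values. The expectation value of `θ^μ(x)` is the limit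
of `∂_ζ^μ (ω(φ₀(x+ζ) φ₀(x-ζ)) - ω_∞(φ₀(x+ζ) φ₀(x-ζ)))` for space-like `ζ` tending to `0`; the
limit has to exist at every point `x` of `O` and in the sense of distributions in `x`. -/
structure HasLocalExpectations (w : NPoint) (O : Opens Mink) (E : LocalField → Mink → ℂ) :
    Prop where
  one : ∀ x ∈ O, E .one x = w []
  field_continuous : ContinuousOn (E .field) O
  field_represents : ∀ f : Test, tsupport f ⊆ O → w [f] = ∫ x, E .field x * f x
  theta_integrable : ∀ μ, LocallyIntegrableOn (E (.theta μ)) O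
  theta_limit : ∃ (N : Set (Mink × Mink)) (K : Mink × Mink → ℂ),
    IsOpen N ∧ (∀ x ∈ O, (x, x) ∈ N) ∧ IsNormalOrdered w N K ∧
    ∀ μ,
      (∀ x ∈ O, Tendsto (fun ζ => balanced K μ x ζ) (𝓝[spacelike] 0) (𝓝 (E (.theta μ) x))) ∧
      ∀ h : 𝓓(O, ℂ), Tendsto (fun ζ => ∫ x, h x * balanced K μ x ζ) (𝓝[spacelike] 0)
        (𝓝 (∫ x, h x * E (.theta μ) x))

open Classical in
/-- The expectation value of a local observable at `x`, for states in the domain of the forms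
(the values on `O` do not depend on the choice; `0` if the state is not in the domain). -/
def localExp (w : NPoint) (O : Opens Mink) (ψ : LocalField) (x : Mink) : ℂ :=
  if h : ∃ E, HasLocalExpectations w O E then h.choose ψ x else 0

/-- `𝒮_O`-thermal states: the state is in the domain of the local observables in `O`, and for each
`x` in `O` it agrees on `𝒮_x` with some thermal reference state. The reference states can be
chosen weakly integrable in `x` and, for `x` in a given compact subset of `O`, with temperature
support in a common compact set. (Agreement on the generators of `𝒮_x` is agreement on `𝒮_x`.) -/
structure IsThermal (w : NPoint) (O : Opens Mink) : Prop where
  domain : ∃ E, HasLocalExpectations w O E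
  reference : ∃ r : Mink → NPoint,
    (∀ C : Set Mink, IsCompact C → C ⊆ O →
      ∃ B : Set Cone, IsCompact B ∧ ∀ x ∈ C, r x ∈ referenceStates B) ∧
    (∀ l, LocallyIntegrableOn (fun x => r x l) O) ∧
    ∀ x ∈ O, ∀ ψ, localExp w O ψ x = localExp (r x) ⊤ ψ x

/-! ### Macro-observables -/

/-- The thermal function `β ↦ ω_β(ψ(0))` of the macro-observable given by `ψ(x)`. -/
def thermalFn (ψ : LocalField) (β : Cone) : ℂ := localExp (kms β) ⊤ ψ 0

/-- Admissible macro-observables, identified with their thermal functions: the smooth solutions of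
the wave equation on `V₊`. -/
structure IsAdmissible (Ξ : Mink → ℂ) : Prop where
  smooth : ContDiffOn ℝ (⊤ : ℕ∞) Ξ forwardCone
  wave : ∀ β ∈ forwardCone, box Ξ β = 0

/-- `v` is the lifted expectation value `ω(Ξ)(x)`. On the macro-observables given by the local
observables the lift is `∑ c_ψ Ψ ↦ ∑ c_ψ ω(ψ(x))`; it is extended by continuity with regard to
the seminorms `sup_B |·|` with compact `B ⊂ V₊`: the observable `Ξ` can be approximated by such
linear combinations, and `∑ c_ψ ω(ψ(x))` tends to `v` whenever `∑ c_ψ Ψ` tends to `Ξ`. -/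
structure IsLiftedExpectation (w : NPoint) (O : Opens Mink) (x : Mink) (Ξ : Mink → ℂ) (v : ℂ) :
    Prop where
  approximable : ∀ B : Set Cone, IsCompact B → ∀ ε : ℝ, 0 < ε → ∃ c : LocalField →₀ ℂ,
    ∀ β ∈ B, ‖Ξ β.1 - c.sum fun ψ a => a * thermalFn ψ β‖ < ε
  limit : ∀ ε : ℝ, 0 < ε → ∃ B : Set Cone, IsCompact B ∧ ∃ δ : ℝ, 0 < δ ∧ ∀ c : LocalField →₀ ℂ,
    (∀ β ∈ B, ‖Ξ β.1 - c.sum fun ψ a => a * thermalFn ψ β‖ < δ) →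
      ‖v - c.sum fun ψ a => a * localExp w O ψ x‖ < ε

end

end LocalEq

open LocalEq

/-! Everything reduces to the observables `θ^μ`. In `ω_β` the normal ordered two-point function is
the Fourier transform of the Bose density on the light cone, and polar coordinates turn the thermal
function of `θ^μ`, with `μ` of order `m`, into a constant times `coneFn μ β = ∫ n^μ (βn)^(-m-2) dω`,
where `n = (1, ω)` and `ω` runs over the unit sphere. The constant is zero for odd `m` and non-zero
for even `m` (`thermCoef_ne_zero`, `boseIntegral_pos`).

Approximation. Near a compact subset of the cone, every solution `Ξ` is a superposition `∫ Φ(ω, βn)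
dω` of plane waves in null directions (`exists_plane_wave_representation`). For this `Ξ` is cut off,
Kirchhoff's formula recovers it from the resulting source on past light cones, and the source is
split so that only the part seen in the past remains; the difference of the advanced and the
retarded potential of that part is a superposition of plane waves. Since `βn` stays in a compact
interval of positive numbers, Stone–Weierstrass approximates `Φ` by the functions `n^μ z^(-m-2)`
with `m` even, hence `Ξ` by thermal functions (`exists_coneFn_approx`). For the gradient, `∂^ν Ξ = ∫
n^ν Φ'(ω, βn) dω`; approximating `Φ'` once gives the same coefficients for all four `ν`
(`exists_coneFn_gradient_approx`).

Field equations. At space-like separated points the normal ordered kernel solves the wave equation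
in each argument. With `x₁ = x + ζ` and `x₂ = x - ζ` one has `∂_x = ∂₁ + ∂₂` and `∂_ζ = ∂₁ - ∂₂`, so
`∂_x · ∂_ζ = □₁ - □₂` and `□_x + □_ζ = 2 (□₁ + □₂)`. As `ζ` tends to `0`, the first identity gives
conservation, `∂_ν θ^{ν l} = 0`, and the second says that `□ θ^l` is minus the trace of `θ^{ν ν l}`.
The trace vanishes in thermal states because the momenta of the massless field are light-like.

Lift. The value at `x` is `∫ Ξ dρ_x` for any mixture `ρ_x` that represents the state at `x`. An
approximation of `Ξ` on a common compact temperature support is an equally good approximation of the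
lift, uniformly on a compact set of points, so integrability and both equations pass to the limit.
-/

namespace LocalEq

noncomputable section

/-! ### The unit sphere of `ℝ³` -/

/-- The Euclidean space of three-momenta. -/
abbrev E3 : Type := EuclideanSpace ℝ (Fin 3)

/-- The unit sphere of directions. -/
abbrev Sph : Type := Metric.sphere (0 : E3) 1

/-- The surface measure of the unit sphere. -/
def sphMeas : Measure Sph := (volume : Measure E3).toSphere

instance : IsFiniteMeasure sphMeas := by unfold sphMeas; infer_instance

lemma sphMeas_real_univ_pos : 0 < sphMeas.real Set.univ := by
  unfold sphMeas
  rw [Measure.toSphere_real_apply_univ]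
  have h : 0 < (volume : Measure E3).real (Metric.ball 0 1) :=
    ENNReal.toReal_pos (Metric.isOpen_ball.measure_ne_zero _ (by simp)) measure_ball_lt_top.ne
  have : 0 < Module.finrank ℝ E3 := Module.finrank_pos
  positivity

lemma integrable_sphere_of_continuous {F : Type*} [NormedAddCommGroup F] {f : Sph → F}
    (hf : Continuous f) : Integrable f sphMeas :=
  hf.integrable_of_hasCompactSupport (HasCompactSupport.of_compactSpace f)

/-- Polar coordinates in `ℝ³`. -/
lemma integral_polar {F : E3 → ℂ} (hF : Integrable F) :
    ∫ p, F p =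
      ∫ ω : Sph, (∫ r in Set.Ioi (0 : ℝ), ((r ^ 2 : ℝ) : ℂ) * F (r • (ω : E3))) ∂sphMeas := by
  have hemb := (Homeomorph.measurableEmbedding (homeomorphUnitSphereProd E3))
  have hmp := (volume : Measure E3).measurePreserving_homeomorphUnitSphereProd
  have h1 : ∫ p, F p = ∫ z, F (((homeomorphUnitSphereProd E3).symm z : ({0}ᶜ : Set E3)) : E3)
      ∂((volume : Measure E3).toSphere.prod (Measure.volumeIoiPow (Module.finrank ℝ E3 - 1))) := by
    rw [← hmp.integral_comp hemb]
    simp only [Homeomorph.symm_apply_apply]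
    rw [integral_subtype_comap (measurableSet_singleton _).compl F, restrict_compl_singleton]
  have h2 : Integrable (fun z => F (((homeomorphUnitSphereProd E3).symm z : ({0}ᶜ : Set E3)) : E3))
      ((volume : Measure E3).toSphere.prod
        (Measure.volumeIoiPow (Module.finrank ℝ E3 - 1))) := by
    rw [← hmp.integrable_comp_emb hemb]
    simp only [Function.comp_def, Homeomorph.symm_apply_apply]
    rw [← Function.comp_def F, ← integrableOn_iff_comap_subtypeVal (measurableSet_singleton _).compl,
      IntegrableOn, restrict_compl_singleton]
    exact hF
  rw [h1, integral_prod _ h2]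
  refine integral_congr_ae (Eventually.of_forall fun ω => ?_)
  simp only [Measure.volumeIoiPow, ENNReal.ofReal]
  rw [integral_withDensity_eq_integral_smul (by fun_prop),
    ← integral_subtype_comap measurableSet_Ioi fun r : ℝ => ((r ^ 2 : ℝ) : ℂ) * F (r • (ω : E3))]
  refine integral_congr_ae (Eventually.of_forall fun r => ?_)
  have : Module.finrank ℝ E3 - 1 = 2 := by simp
  simp only [this, NNReal.smul_def, Real.coe_toNNReal _ (sq_nonneg (r : ℝ)),
    homeomorphUnitSphereProd_symm_apply_coe, Complex.real_smul]

/-- Differentiation under the integral sign for integrands that are continuous, with continuous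
derivative, and supported in a fixed compact set. -/
lemma hasDerivAt_integral_of_compact {X : Type*} [TopologicalSpace X] [MeasurableSpace X]
    [BorelSpace X] [T2Space X] {μ : Measure X} [IsFiniteMeasureOnCompacts μ] {k : Set X}
    (hk : IsCompact k) {F F' : ℝ → X → ℂ} (hF : ∀ t, Continuous (F t))
    (hF' : Continuous (Function.uncurry F')) (hd : ∀ t x, HasDerivAt (fun s => F s x) (F' t x) t)
    (h0 : ∀ t, ∀ x ∉ k, F t x = 0) (t : ℝ) :
    HasDerivAt (fun s => ∫ x, F s x ∂μ) (∫ x, F' t x ∂μ) t := by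
  have hF't : ∀ t, Continuous (F' t) := fun t => hF'.comp (by fun_prop : Continuous fun x => (t, x))
  have h0' : ∀ t, ∀ x ∉ k, F' t x = 0 := fun t x hx => by
    have h1 := hd t x
    have h2 : (fun s => F s x) = fun _ => 0 := funext fun s => h0 s x hx
    rw [h2] at h1
    exact h1.unique (hasDerivAt_const t 0)
  obtain ⟨C, hC⟩ := ((isCompact_closedBall t 1).prod hk).exists_bound_of_continuousOn
    hF'.continuousOn
  have hcs : ∀ G : X → ℂ, Continuous G → (∀ x ∉ k, G x = 0) → HasCompactSupport G :=
    fun G _ h => HasCompactSupport.intro hk h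
  refine (hasDerivAt_integral_of_dominated_loc_of_deriv_le (F' := F')
    (bound := k.indicator fun _ => C) (Metric.closedBall_mem_nhds t one_pos)
    (Eventually.of_forall fun s => ?_) ?_ ?_ ?_ ?_ ?_).2
  · exact ((hF s).integrable_of_hasCompactSupport (hcs _ (hF s) (h0 s))).aestronglyMeasurable
  · exact (hF t).integrable_of_hasCompactSupport (hcs _ (hF t) (h0 t))
  · exact ((hF't t).integrable_of_hasCompactSupport
      (hcs _ (hF't t) (h0' t))).aestronglyMeasurable
  · refine Eventually.of_forall fun x s hs => ?_
    by_cases hx : x ∈ k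
    · simpa [hx] using hC (s, x) ⟨hs, hx⟩
    · simp [hx, h0' s x hx]
  · exact (integrable_indicator_iff hk.measurableSet).2
      (integrableOn_const hk.measure_lt_top.ne)
  · exact Eventually.of_forall fun x s _ => hd s x

/-- The surface measure of a set is a multiple of the Lebesgue measure of the cone over it. A linear
isometry maps cones to cones and preserves Lebesgue measure, hence it preserves the surface measure.
-/
lemma integral_sphere_isometry (A : E3 ≃ₗᵢ[ℝ] E3) (f : E3 → ℂ) :
    ∫ ω : Sph, f (A ω) ∂sphMeas = ∫ ω : Sph, f ω ∂sphMeas := by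
  let T : Sph ≃ₜ Sph :=
    { toFun := fun ω => ⟨A ω, by simp⟩
      invFun := fun ω => ⟨A.symm ω, by simp⟩
      left_inv := fun ω => by simp
      right_inv := fun ω => by simp
      continuous_toFun := by fun_prop
      continuous_invFun := by fun_prop }
  have hT : MeasurePreserving T sphMeas sphMeas := by
    refine ⟨T.continuous.measurable, ?_⟩
    ext s hs
    rw [Measure.map_apply T.continuous.measurable hs]
    unfold sphMeas
    rw [Measure.toSphere_apply' _ hs, Measure.toSphere_apply' _ (T.continuous.measurable hs)]
    congr 1
    conv_rhs => rw [← A.measurePreserving.measure_preimage_equiv (f := A.toHomeomorph.toMeasurableEquiv)]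
    congr 1
    ext x
    change _ ↔ A x ∈ (_ : Set E3)
    simp only [Set.mem_smul, Set.mem_image, Set.mem_preimage]
    constructor
    · rintro ⟨c, hc, y, ⟨ω, hω, rfl⟩, rfl⟩
      exact ⟨c, hc, A ω, ⟨T ω, hω, rfl⟩, by simp⟩
    · rintro ⟨c, hc, y, ⟨ω, hω, rfl⟩, h⟩
      refine ⟨c, hc, A.symm ω, ⟨T.symm ω, by simpa using hω, rfl⟩, ?_⟩
      apply A.injective
      simpa using h
  exact hT.integral_comp T.measurableEmbedding (fun ω : Sph => f ω)

/-- The generator of the rotations in the `i j` plane. -/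
def rotGen (i j : Fin 3) (x : E3) : E3 :=
  x i • EuclideanSpace.single j 1 - x j • EuclideanSpace.single i 1

/-- The rotation by the angle `t` in the `i j` plane. -/
def rot (i j : Fin 3) (t : ℝ) (x : E3) : E3 :=
  x + (Real.cos t - 1) • (x i • EuclideanSpace.single i 1 + x j • EuclideanSpace.single j 1)
    + Real.sin t • rotGen i j x

/-- A rotation as a linear isometry. -/
def rotIso {i j : Fin 3} (hij : i ≠ j) (t : ℝ) : E3 ≃ₗᵢ[ℝ] E3 :=
  LinearIsometry.toLinearIsometryEquiv
    { toFun := rot i j t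
      map_add' := fun x y => by
        ext k; simp [rot, rotGen]; split_ifs <;> ring
      map_smul' := fun c x => by
        ext k; simp [rot, rotGen]; split_ifs <;> ring
      norm_map' := fun x => by
        have h := Real.sin_sq_add_cos_sq t
        have : ‖rot i j t x‖ ^ 2 = ‖x‖ ^ 2 := by
          rw [EuclideanSpace.real_norm_sq_eq, EuclideanSpace.real_norm_sq_eq]
          simp only [Fin.sum_univ_three]
          fin_cases i <;> fin_cases j <;> first | exact absurd rfl hij |
            (simp [rot, rotGen]
             linear_combination (x 0 ^ 2 + x 1 ^2) * h) |
            (simp [rot, rotGen]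
             linear_combination (x 0 ^ 2 + x 2 ^2) * h) |
            (simp [rot, rotGen]
             linear_combination (x 1 ^ 2 + x 2 ^2) * h) 
        exact (sq_eq_sq₀ (norm_nonneg _) (norm_nonneg _)).1 this } rfl

lemma continuous_rotGen (i j : Fin 3) : Continuous (rotGen i j) := by
  unfold rotGen; fun_prop

lemma continuous_rot (i j : Fin 3) : Continuous fun z : ℝ × E3 => rot i j z.1 z.2 := by
  have := continuous_rotGen i j
  unfold rot; fun_prop

/-- Rotations generate no net flux: the derivative of a function along the generator of a rotation
integrates to zero over the sphere. -/
lemma integral_fderiv_rotGen {i j : Fin 3} (hij : i ≠ j) {f : E3 → ℂ} (hf : ContDiff ℝ 1 f) :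
    ∫ ω : Sph, fderiv ℝ f ω (rotGen i j ω) ∂sphMeas = 0 := by
  have hfd : Continuous (fderiv ℝ f) := hf.continuous_fderiv one_ne_zero
  have hrot := continuous_rot i j
  have hgen := continuous_rotGen i j
  let R' : ℝ → E3 → E3 := fun t x =>
    (-Real.sin t) • (x i • EuclideanSpace.single i 1 + x j • EuclideanSpace.single j 1)
      + Real.cos t • rotGen i j x
  have hd : ∀ (t : ℝ) (x : E3), HasDerivAt (fun s => rot i j s x) (R' t x) t := fun t x => by
    unfold rot
    have h1 := (((Real.hasDerivAt_cos t).sub_const 1).smul_const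
      (x i • EuclideanSpace.single i (1:ℝ) + x j • EuclideanSpace.single j (1:ℝ) : E3))
    have h2 := (Real.hasDerivAt_sin t).smul_const (rotGen i j x)
    exact (h1.const_add x).add h2
  have hR' : Continuous fun z : ℝ × Sph => R' z.1 z.2 := by
    simp only [R']; fun_prop
  have key := hasDerivAt_integral_of_compact (μ := sphMeas) isCompact_univ
    (F := fun t (ω : Sph) => f (rot i j t ω))
    (F' := fun t (ω : Sph) => fderiv ℝ f (rot i j t ω) (R' t ω))
    (fun t => hf.continuous.comp (hrot.comp (by fun_prop : Continuous fun ω : Sph => (t, (ω : E3)))))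
    ((hfd.comp (hrot.comp (by fun_prop : Continuous fun z : ℝ × Sph => (z.1, (z.2 : E3))))).clm_apply
      hR')
    (fun t ω => ((hf.differentiable one_ne_zero _).hasFDerivAt.comp_hasDerivAt t (hd t ω)))
    (fun t x hx => absurd (Set.mem_univ x) hx) 0
  -- By rotation invariance the integral does not depend on `t`, so its derivative at `t = 0`, which
  -- is the integral in question, vanishes.
  have hconst : (fun t => ∫ ω : Sph, f (rot i j t ω) ∂sphMeas) =
      fun _ => ∫ ω : Sph, f ω ∂sphMeas :=
    funext fun t => integral_sphere_isometry (rotIso hij t) f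
  rw [hconst] at key
  have := key.unique (hasDerivAt_const _ _)
  simpa [R', rot] using this

/-- The Laplace operator of the sphere integrates to zero. -/
lemma integral_sphere_laplacian {f : E3 → ℂ} (hf : ContDiff ℝ 2 f) :
    ∫ ω : Sph, (∑ i, fderiv ℝ (fderiv ℝ f) ω (EuclideanSpace.single i 1) (EuclideanSpace.single i 1)
      - fderiv ℝ (fderiv ℝ f) ω ω ω - 2 * fderiv ℝ f ω ω) ∂sphMeas = 0 := by
  have hf1 : ContDiff ℝ 1 (fderiv ℝ f) := hf.fderiv_right (by norm_num)
  let J : Fin 3 → Fin 3 → E3 →L[ℝ] E3 := fun i j =>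
    (EuclideanSpace.proj i : E3 →L[ℝ] ℝ).smulRight (EuclideanSpace.single j 1) -
      (EuclideanSpace.proj j : E3 →L[ℝ] ℝ).smulRight (EuclideanSpace.single i 1)
  have hJ : ∀ i j x, J i j x = rotGen i j x := fun i j x => by simp [J, rotGen]
  -- The previous lemma is applied to `L f` in place of `f`, with `L` the derivative along the
  -- generator. Expanding `L (L f)` gives a second derivative and a first-order term from
  -- differentiating the generator.
  have h : ∀ i j, i ≠ j → ∫ ω : Sph, (fderiv ℝ (fderiv ℝ f) ω (rotGen i j ω) (rotGen i j ω) +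
      fderiv ℝ f ω (rotGen i j (rotGen i j ω))) ∂sphMeas = 0 := fun i j hij => by
    have hg : ContDiff ℝ 1 fun x => fderiv ℝ f x (J i j x) := hf1.clm_apply (J i j).contDiff
    rw [← integral_fderiv_rotGen hij hg]
    refine integral_congr_ae (Eventually.of_forall fun ω => ?_)
    have := ((hf1.differentiable one_ne_zero (ω : E3)).hasFDerivAt.clm_apply
      (J i j).hasFDerivAt).fderiv
    simp only [this]
    simp [hJ, add_comm]
  have hc2 : Continuous (fderiv ℝ (fderiv ℝ f)) := hf1.continuous_fderiv one_ne_zero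
  have hc1 : Continuous (fderiv ℝ f) := hf1.continuous
  have hi : ∀ i j, Integrable (fun ω : Sph => fderiv ℝ (fderiv ℝ f) ω (rotGen i j ω) (rotGen i j ω) +
      fderiv ℝ f ω (rotGen i j (rotGen i j ω))) sphMeas := fun i j => by
    have hgen := continuous_rotGen i j
    apply integrable_sphere_of_continuous
    fun_prop
  have h3 : ∫ ω : Sph, (∑ z ∈ ({(0, 1), (0, 2), (1, 2)} : Finset (Fin 3 × Fin 3)),
      (fderiv ℝ (fderiv ℝ f) ω (rotGen z.1 z.2 ω) (rotGen z.1 z.2 ω) +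
      fderiv ℝ f ω (rotGen z.1 z.2 (rotGen z.1 z.2 ω)))) ∂sphMeas = 0 := by
    rw [integral_finsetSum _ fun z _ => hi z.1 z.2]
    refine Finset.sum_eq_zero fun z hz => h z.1 z.2 ?_
    revert z; decide
  rw [← h3]
  -- The sum of the three squared generators is `|x|² Δ - D²(x, x) - 2 D(x)`, since the squares of
  -- the generators, as linear maps, add up to `-2`. The relation `|x| = 1` is used only for the
  -- coefficient of `Δ`.
  refine integral_congr_ae (Eventually.of_forall fun ω => ?_)
  beta_reduce
  have hω : (ω : E3) 0 ^ 2 + (ω : E3) 1 ^ 2 + (ω : E3) 2 ^ 2 = 1 := by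
    have : ‖(ω : E3)‖ = 1 := by simp
    have h2 := EuclideanSpace.real_norm_sq_eq (ω : E3)
    rw [this] at h2
    simpa [Fin.sum_univ_three] using h2.symm
  have hωe : (ω : E3) = (ω : E3) 0 • EuclideanSpace.single 0 1 + (ω : E3) 1 • EuclideanSpace.single 1 1
      + (ω : E3) 2 • EuclideanSpace.single 2 1 := by
    ext k; fin_cases k <;> simp
  have hsym : ∀ u v, fderiv ℝ (fderiv ℝ f) ω u v = fderiv ℝ (fderiv ℝ f) ω v u := fun u v =>
    (hf.contDiffAt.isSymmSndFDerivAt (by simp)).eq u v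
  generalize fderiv ℝ (fderiv ℝ f) (ω : E3) = D2 at *
  generalize fderiv ℝ f (ω : E3) = D1 at *
  generalize (ω : E3) = x at *
  have e10 := hsym (EuclideanSpace.single 1 1) (EuclideanSpace.single 0 1)
  have e20 := hsym (EuclideanSpace.single 2 1) (EuclideanSpace.single 0 1)
  have e21 := hsym (EuclideanSpace.single 2 1) (EuclideanSpace.single 1 1)
  have hωC : (x 0 : ℂ) ^ 2 + (x 1 : ℂ) ^ 2 + (x 2 : ℂ) ^ 2 = 1 := by
    have := congrArg Complex.ofReal hω
    push_cast at this
    exact this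
  have hx1 : D2 x x = D2 (x 0 • EuclideanSpace.single 0 1 + x 1 • EuclideanSpace.single 1 1
      + x 2 • EuclideanSpace.single 2 1) (x 0 • EuclideanSpace.single 0 1 + x 1 • EuclideanSpace.single 1 1
      + x 2 • EuclideanSpace.single 2 1) := by rw [← hωe]
  have hx2 : D1 x = D1 (x 0 • EuclideanSpace.single 0 1 + x 1 • EuclideanSpace.single 1 1
      + x 2 • EuclideanSpace.single 2 1) := by rw [← hωe]
  rw [Finset.sum_insert (by decide), Finset.sum_insert (by decide), Finset.sum_singleton]
  simp only [hx1, hx2, rotGen, Fin.sum_univ_three, map_add, map_sub, map_smul,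
    add_apply, sub_apply, smul_apply,
    Complex.real_smul, e10, e20, e21]
  simp
  generalize D2 (EuclideanSpace.single 0 1) (EuclideanSpace.single 0 1) = d00
  generalize D2 (EuclideanSpace.single 1 1) (EuclideanSpace.single 1 1) = d11
  generalize D2 (EuclideanSpace.single 2 1) (EuclideanSpace.single 2 1) = d22
  linear_combination (-(d00 + d11 + d22)) * hωC

/-! ### Space, time and null vectors -/

/-- The embedding of `ℝ³` as the space of purely spatial vectors. -/
def spEmb : E3 →L[ℝ] Mink :=
  LinearMap.toContinuousLinearMap
    { toFun := fun p => !₂[0, p 0, p 1, p 2]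
      map_add' := fun p q => by ext k; fin_cases k <;> simp
      map_smul' := fun c p => by ext k; fin_cases k <;> simp }

/-- The spatial part of a vector. -/
def spPart : Mink →L[ℝ] E3 :=
  LinearMap.toContinuousLinearMap
    { toFun := fun x => !₂[x 1, x 2, x 3]
      map_add' := fun p q => by ext k; fin_cases k <;> simp
      map_smul' := fun c p => by ext k; fin_cases k <;> simp }

lemma spEmb_apply (p : E3) : spEmb p = !₂[0, p 0, p 1, p 2] := rfl

lemma spPart_apply (x : Mink) : spPart x = !₂[x 1, x 2, x 3] := rfl

@[simp] lemma spEmb_apply_zero (p : E3) : spEmb p 0 = 0 := rfl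
@[simp] lemma spEmb_apply_one (p : E3) : spEmb p 1 = p 0 := rfl
@[simp] lemma spEmb_apply_two (p : E3) : spEmb p 2 = p 1 := rfl
@[simp] lemma spEmb_apply_three (p : E3) : spEmb p 3 = p 2 := rfl

@[simp] lemma e_apply (μ ν : Fin 4) : e μ ν = if ν = μ then 1 else 0 := by
  simp [e]

@[simp] lemma spPart_spEmb (p : E3) : spPart (spEmb p) = p := by
  ext k; fin_cases k <;> simp [spPart_apply]

@[simp] lemma spPart_e_zero : spPart (e 0) = 0 := by
  ext k; fin_cases k <;> simp [spPart_apply]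

lemma eq_time_add_space (x : Mink) : x = x 0 • e 0 + spEmb (spPart x) := by
  ext k; fin_cases k <;> simp [spPart_apply]

lemma fourMom_eq (s : ℝ) (p : E3) : fourMom s p = s • e 0 + spEmb p := by
  ext k; fin_cases k <;> simp [fourMom]

lemma spEmb_single (i : Fin 3) : spEmb (EuclideanSpace.single i 1) = e i.succ := by
  ext k; fin_cases i <;> fin_cases k <;> simp [spEmb_apply]

/-- The null vector `(1, ω)`. -/
def nullVec (ω : E3) : Mink := e 0 + spEmb ω

@[fun_prop]
lemma continuous_nullVec : Continuous nullVec := by unfold nullVec; fun_prop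

@[simp] lemma nullVec_zero (ω : E3) : nullVec ω 0 = 1 := by simp [nullVec]

lemma mink_eq (x y : Mink) : mink x y = x 0 * y 0 - inner ℝ (spPart x) (spPart y) := by
  simp only [mink, Fin.sum_univ_four, eta, spPart_apply, PiLp.inner_apply, Fin.sum_univ_three]
  simp
  ring

lemma mink_nullVec (x : Mink) (ω : E3) : mink x (nullVec ω) = x 0 - inner ℝ (spPart x) ω := by
  rw [mink_eq]; simp [nullVec]

lemma mem_forwardCone_iff (β : Mink) : β ∈ forwardCone ↔ ‖spPart β‖ < β 0 := by
  simp only [forwardCone, Set.mem_ofPred_eq, mink_eq, real_inner_self_eq_norm_sq]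
  constructor
  · rintro ⟨h1, h2⟩
    nlinarith [norm_nonneg (spPart β)]
  · intro h
    have := norm_nonneg (spPart β)
    constructor <;> nlinarith

lemma isOpen_forwardCone : IsOpen forwardCone := by
  have : forwardCone = {β : Mink | ‖spPart β‖ < β 0} := Set.ext mem_forwardCone_iff
  rw [this]
  exact isOpen_lt (by fun_prop) (by fun_prop)

/-! ### The wave operator and null directions -/

lemma box_eq {F : Mink → ℂ} {x : Mink} (hF : ContDiffAt ℝ 2 F x) :
    box F x = ∑ ν, (eta ν : ℂ) * fderiv ℝ (fderiv ℝ F) x (e ν) (e ν) := by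
  have h1 : DifferentiableAt ℝ (fderiv ℝ F) x :=
    (hF.fderiv_right (m := 1) (by norm_num)).differentiableAt one_ne_zero
  refine Finset.sum_congr rfl fun ν _ => ?_
  unfold dUp dLow
  have h2 := (h1.hasFDerivAt.clm_apply (hasFDerivAt_const (e ν) x)).const_mul (eta ν : ℂ)
  rw [h2.fderiv]
  simp

/-- Kirchhoff's formula: the solution of the inhomogeneous wave equation in terms of the source on
the past light cone. -/
lemma integral_past_cone_box {v : Mink → ℂ} (hv : ContDiff ℝ 2 v) (hs : HasCompactSupport v)
    (β : Mink) :
    ∫ ω : Sph, (∫ r in Set.Ioi (0 : ℝ), (r : ℂ) * box v (β - r • nullVec ω)) ∂sphMeas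
      = sphMeas.real Set.univ * v β := by
  have hv1 : ContDiff ℝ 1 (fderiv ℝ v) := hv.fderiv_right (by norm_num)
  have hc0 := hv.continuous
  have hc1 : Continuous (fderiv ℝ v) := hv1.continuous
  have hc2 : Continuous (fderiv ℝ (fderiv ℝ v)) := hv1.continuous_fderiv one_ne_zero
  let γ : Sph → ℝ → Mink := fun ω r => β - r • nullVec ω
  have hγ : Continuous fun z : Sph × ℝ => γ z.1 z.2 := by simp only [γ]; fun_prop
  -- The time component of `γ ω r` is `β 0 - r`, so the null rays through `β` leave the support of
  -- `v` after a bounded parameter, uniformly in the direction.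
  obtain ⟨R, hR⟩ : ∃ R : ℝ, ∀ ω r, R < |r| → γ ω r ∉ tsupport v := by
    obtain ⟨R, hR⟩ := hs.isCompact.isBounded.subset_closedBall 0
    refine ⟨R + |β 0|, fun ω r hr hmem => ?_⟩
    have h1 := hR hmem
    rw [mem_closedBall_zero_iff] at h1
    have h2 : |γ ω r 0| ≤ ‖γ ω r‖ := by
      simpa using PiLp.norm_apply_le (γ ω r) 0
    have h3 : γ ω r 0 = β 0 - r := by simp [γ]
    rw [h3] at h2
    have := abs_sub_abs_le_abs_sub r (β 0)
    rw [abs_sub_comm] at this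
    linarith
  have hz0 : ∀ x ∉ tsupport v, v x = 0 := fun x hx => image_eq_zero_of_notMem_tsupport hx
  have hz1 : ∀ x ∉ tsupport v, fderiv ℝ v x = 0 := fun x hx =>
    image_eq_zero_of_notMem_tsupport fun h => hx (tsupport_fderiv_subset ℝ h)
  have hz2 : ∀ x ∉ tsupport v, fderiv ℝ (fderiv ℝ v) x = 0 := fun x hx =>
    image_eq_zero_of_notMem_tsupport fun h =>
      hx (tsupport_fderiv_subset ℝ (tsupport_fderiv_subset ℝ h))
  let D2 : Sph → ℝ → Mink →L[ℝ] Mink →L[ℝ] ℂ := fun ω r => fderiv ℝ (fderiv ℝ v) (γ ω r)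
  let D1 : Sph → ℝ → Mink →L[ℝ] ℂ := fun ω r => fderiv ℝ v (γ ω r)
  -- On the sphere of parameter `r`, the weighted source `G = r □v` equals the derivative `A'` up to
  -- `-1/r` times a spherical Laplacian, which integrates to zero. The integral of `A'` along a ray
  -- is read off at the end points: `A` is `-v β` at `0` and vanishes for large `r`.
  let A : Sph → ℝ → ℂ := fun ω r =>
    -(v (γ ω r) + r * (D1 ω r (e 0) - D1 ω r (spEmb ω)))
  let A' : Sph → ℝ → ℂ := fun ω r =>
    2 * D1 ω r (spEmb ω) - r * (D2 ω r (spEmb ω) (spEmb ω) - D2 ω r (e 0) (e 0))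
  let G : Sph → ℝ → ℂ := fun ω r => r * ∑ ν, (eta ν : ℂ) * D2 ω r (e ν) (e ν)
  have hγd : ∀ ω r, HasDerivAt (γ ω) (-nullVec ω) r := fun ω r => by
    have := ((hasDerivAt_id r).smul_const (nullVec ω)).const_sub β
    simpa using this
  have hA : ∀ ω r, HasDerivAt (A ω) (A' ω r) r := fun ω r => by
    have h1 : HasDerivAt (fun r => v (γ ω r)) (D1 ω r (-nullVec ω)) r :=
      (hv.differentiable two_ne_zero _).hasFDerivAt.comp_hasDerivAt r (hγd ω r)
    have h2 : HasDerivAt (fun r => D1 ω r) (D2 ω r (-nullVec ω)) r :=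
      (hv1.differentiable one_ne_zero _).hasFDerivAt.comp_hasDerivAt r (hγd ω r)
    have h3 := (h2.clm_apply (hasDerivAt_const r (e 0))).sub
      (h2.clm_apply (hasDerivAt_const r (spEmb ω)))
    have h4 := (h1.add (((hasDerivAt_id r).ofReal_comp).mul h3)).neg
    refine h4.congr_deriv ?_
    have hsym := (hv.contDiffAt (x := γ ω r)).isSymmSndFDerivAt (by simp) |>.eq (e 0) (spEmb ω)
    change D2 ω r _ _ = D2 ω r _ _ at hsym
    simp only [nullVec, A', map_neg, map_add, neg_apply, add_apply, map_zero, add_zero, hsym]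
    simp only [id, Pi.sub_apply, Complex.ofReal_one]
    ring
  have hGA : ∀ r : ℝ, 0 < r → ∫ ω, G ω r ∂sphMeas = ∫ ω, A' ω r ∂sphMeas := fun r hr => by
    let f : E3 → ℂ := fun x => v (β - r • nullVec x)
    have hf : ContDiff ℝ 2 f := by
      refine hv.comp ?_
      unfold nullVec
      fun_prop
    have hin : ∀ x, HasFDerivAt (fun x : E3 => β - r • nullVec x) (-(r • spEmb)) x := fun x => by
      unfold nullVec
      exact ((spEmb.hasFDerivAt.const_add _).const_smul r).const_sub β
    have hf1 : fderiv ℝ f = fun x => (fderiv ℝ v (β - r • nullVec x)).comp (-(r • spEmb)) :=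
      funext fun x => ((hv.differentiable two_ne_zero _).hasFDerivAt.comp x (hin x)).fderiv
    have hf2 : ∀ x u w, fderiv ℝ (fderiv ℝ f) x u w =
        (r : ℂ) ^ 2 * fderiv ℝ (fderiv ℝ v) (β - r • nullVec x) (spEmb u) (spEmb w) := by
      intro x u w
      have h5 := ((hv1.differentiable one_ne_zero _).hasFDerivAt.comp x (hin x)).clm_comp
        (hasFDerivAt_const (-(r • spEmb) : E3 →L[ℝ] Mink) x)
      rw [hf1]
      erw [h5.fderiv]
      simp
      ring
    have h6 := integral_sphere_laplacian hf
    have h7 : ∀ ω : Sph, G ω r - A' ω r = -(r : ℂ)⁻¹ *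
        (∑ i, fderiv ℝ (fderiv ℝ f) ω (EuclideanSpace.single i 1) (EuclideanSpace.single i 1)
        - fderiv ℝ (fderiv ℝ f) ω ω ω - 2 * fderiv ℝ f ω ω) := fun ω => by
      have hr' : (r : ℂ) ≠ 0 := by exact_mod_cast hr.ne'
      simp only [hf2]
      simp only [hf1, spEmb_single, G, A', D2, D1, γ]
      rw [Fin.sum_univ_succ]
      simp [eta, Fin.sum_univ_three]
      field_simp
      ring
    have hGi : Integrable (fun ω => G ω r) sphMeas := by
      apply integrable_sphere_of_continuous
      simp only [G, D2, γ]
      fun_prop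
    have hAi : Integrable (fun ω => A' ω r) sphMeas := by
      apply integrable_sphere_of_continuous
      simp only [A', D1, D2, γ]
      fun_prop
    rw [← sub_eq_zero, ← integral_sub hGi hAi]
    simp only [h7]
    rw [integral_const_mul, h6, mul_zero]
  have hcomp : ∀ H : Sph → ℝ → ℂ, (∀ ω r, γ ω r ∉ tsupport v → H ω r = 0) →
      HasCompactSupport (Function.uncurry H) := fun H hH => by
    refine HasCompactSupport.intro (isCompact_univ.prod (isCompact_closedBall (0 : ℝ) R)) ?_
    rintro ⟨ω, r⟩ h
    refine hH ω r (hR ω r ?_)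
    simpa using h
  have hGc : Integrable (Function.uncurry G) (sphMeas.prod (volume.restrict (Set.Ioi 0))) := by
    refine Continuous.integrable_of_hasCompactSupport ?_ (hcomp G fun ω r h => ?_)
    · simp only [G, D2, γ, Function.uncurry_def]; fun_prop
    · simp [G, D2, hz2 _ h]
  have hAc : Integrable (Function.uncurry A') (sphMeas.prod (volume.restrict (Set.Ioi 0))) := by
    refine Continuous.integrable_of_hasCompactSupport ?_ (hcomp A' fun ω r h => ?_)
    · simp only [A', D1, D2, γ, Function.uncurry_def]; fun_prop
    · simp [A', D1, D2, hz1 _ h, hz2 _ h]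
  have hfin : ∀ ω, ∫ r in Set.Ioi (0 : ℝ), A' ω r = v β := fun ω => by
    have h0 : A ω 0 = - v β := by simp [A, γ]
    have hlim : Tendsto (A ω) atTop (𝓝 0) := by
      refine tendsto_const_nhds.congr' ?_
      filter_upwards [eventually_gt_atTop R] with r hr
      have h := hR ω r (hr.trans_le (le_abs_self r))
      simp [A, D1, hz0 _ h, hz1 _ h]
    have hAi : IntegrableOn (A' ω) (Set.Ioi 0) := by
      refine (Continuous.integrable_of_hasCompactSupport ?_ ?_).integrableOn
      · simp only [A', D1, D2, γ]; fun_prop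
      · refine HasCompactSupport.intro (isCompact_closedBall (0 : ℝ) R) fun r hr => ?_
        have h := hR ω r (by simpa using hr)
        simp [A', D1, D2, hz1 _ h, hz2 _ h]
    rw [integral_Ioi_of_hasDerivAt_of_tendsto' (fun r _ => hA ω r) hAi hlim, h0]
    simp
  calc _ = ∫ ω, (∫ r in Set.Ioi (0 : ℝ), G ω r) ∂sphMeas := by
        simp only [G, D2, γ, box_eq hv.contDiffAt]
    _ = ∫ r in Set.Ioi (0 : ℝ), ∫ ω, G ω r ∂sphMeas := integral_integral_swap hGc
    _ = ∫ r in Set.Ioi (0 : ℝ), ∫ ω, A' ω r ∂sphMeas :=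
        setIntegral_congr_fun measurableSet_Ioi fun r hr => hGA r hr
    _ = ∫ ω, (∫ r in Set.Ioi (0 : ℝ), A' ω r) ∂sphMeas := (integral_integral_swap hAc).symm
    _ = _ := by simp [hfin]

lemma fderiv_fderiv_apply {E F : Type*} [NormedAddCommGroup E] [NormedSpace ℝ E]
    [NormedAddCommGroup F] [NormedSpace ℝ F] {f : E → F} {x : E} (hf : ContDiffAt ℝ 2 f x)
    (u w : E) : fderiv ℝ (fderiv ℝ f) x u w = fderiv ℝ (fun y => fderiv ℝ f y w) x u := by
  have h1 : DifferentiableAt ℝ (fderiv ℝ f) x :=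
    (hf.fderiv_right (m := 1) (by norm_num)).differentiableAt one_ne_zero
  rw [(h1.hasFDerivAt.clm_apply (hasFDerivAt_const w x)).fderiv]
  simp

/-- Spherical averages of plane waves, in terms of the profile at the end point. -/
lemma integral_sphere_plane_aux {g : ℝ → ℂ} (hg : ContDiff ℝ 2 g) (c s : ℝ) {ε : E3}
    (hε : ‖ε‖ = 1) :
    ∫ ω : Sph, (g (c - s + s * inner ℝ ε (ω : E3)) + (s * (1 + inner ℝ ε (ω : E3)) : ℝ) *
      deriv g (c - s + s * inner ℝ ε (ω : E3))) ∂sphMeas = sphMeas.real Set.univ * g c := by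
  have hg1 : ContDiff ℝ 1 (deriv g) := hg.deriv' 
  have hcg := hg.continuous
  have hcg1 := hg1.continuous
  have hcg2 : Continuous (deriv (deriv g)) := hg1.continuous_deriv le_rfl
  have hd0 : ∀ t, HasDerivAt g (deriv g t) t := fun t =>
    (hg.differentiable two_ne_zero t).hasDerivAt
  have hd1 : ∀ t, HasDerivAt (deriv g) (deriv (deriv g) t) t := fun t =>
    (hg1.differentiable one_ne_zero t).hasDerivAt
  let a : ℝ → E3 → ℝ := fun s x => c - s + s * inner ℝ ε x
  let F : ℝ → Sph → ℂ := fun s ω => g (a s ω) + (s * (1 + inner ℝ ε (ω : E3)) : ℝ) *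
    deriv g (a s ω)
  let F' : ℝ → Sph → ℂ := fun s ω => 2 * (inner ℝ ε (ω : E3) : ℝ) * deriv g (a s ω) -
    (s * (1 - inner ℝ ε (ω : E3) ^ 2) : ℝ) * deriv (deriv g) (a s ω)
  have hFd : ∀ s ω, HasDerivAt (fun s => F s ω) (F' s ω) s := fun s ω => by
    have h1 : HasDerivAt (fun s => a s ω) (-1 + inner ℝ ε (ω : E3)) s := by
      exact (((hasDerivAt_id s).const_sub c).add
        ((hasDerivAt_id s).mul_const (inner ℝ ε (ω : E3)))).congr_deriv (by simp)
    have h2 := (hd0 (a s ω)).scomp s h1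
    have h3 := (hd1 (a s ω)).scomp s h1
    have h4 : HasDerivAt (fun s : ℝ => ((s * (1 + inner ℝ ε (ω : E3)) : ℝ) : ℂ))
        ((1 + inner ℝ ε (ω : E3) : ℝ) : ℂ) s := by
      simpa using ((hasDerivAt_id s).mul_const (1 + inner ℝ ε (ω : E3))).ofReal_comp
    refine (h2.add (h4.mul h3)).congr_deriv ?_
    simp only [F', Function.comp, Complex.real_smul]
    push_cast
    ring
  -- For `s ≠ 0`, `F' s` is `-1/s` times the spherical Laplacian of the plane wave `g ∘ a s`; hence
  -- `∫ F s` is constant in `s` and equals its value at `s = 0`.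
  have hzero : ∀ s, ∫ ω, F' s ω ∂sphMeas = 0 := fun s => by
    -- At `s = 0` one cannot divide by `s`. There the integrand is a multiple of the linear function
    -- `ω ↦ (ε, ω)`, which has mean zero as an eigenfunction of the spherical Laplacian with
    -- eigenvalue `-2`.
    rcases eq_or_ne s 0 with rfl | hs
    · let L : E3 →L[ℝ] ℂ := Complex.ofRealCLM.comp (innerSL ℝ ε)
      have h1 := integral_sphere_laplacian (f := L) L.contDiff
      have h2 : fderiv ℝ (L : E3 → ℂ) = fun _ => L := funext fun x => L.fderiv
      rw [h2] at h1
      simp only [fderiv_fun_const, Pi.zero_apply, zero_apply, Finset.sum_const_zero,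
        sub_zero, zero_sub] at h1
      have h3 : ∀ ω, F' 0 ω = -(deriv g c) * (-(2 * L ω)) := fun ω => by
        simp [F', a, L]; ring
      simp only [h3]
      rw [integral_const_mul, h1, mul_zero]
    · have had : ∀ x, HasFDerivAt (a s) (s • innerSL ℝ ε) x := fun x => by
        have := ((innerSL ℝ ε).hasFDerivAt (x := x)).const_smul s |>.const_add (c - s)
        exact this
      have hac : ContDiff ℝ 2 (a s) := 
        contDiff_const.add (contDiff_const.mul (contDiff_const.inner ℝ contDiff_id))
      have hf : ContDiff ℝ 2 (g ∘ a s) := hg.comp hac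
      have hf1 : ∀ x w, fderiv ℝ (g ∘ a s) x w = (s * inner ℝ ε w : ℝ) * deriv g (a s x) := by
        intro x w
        rw [((hd0 (a s x)).hasFDerivAt.comp x (had x)).fderiv]
        simp
        ring
      have hf2 : ∀ x u w, fderiv ℝ (fderiv ℝ (g ∘ a s)) x u w =
          (s ^ 2 * inner ℝ ε u * inner ℝ ε w : ℝ) * deriv (deriv g) (a s x) := by
        intro x u w
        rw [fderiv_fderiv_apply hf.contDiffAt]
        simp only [hf1]
        erw [(((hd1 (a s x)).hasFDerivAt.comp x (had x)).const_mul _).fderiv]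
        simp
        ring
      have h1 := integral_sphere_laplacian hf
      have hε2 : ε 0 ^ 2 + ε 1 ^ 2 + ε 2 ^ 2 = 1 := by
        have h2 := EuclideanSpace.real_norm_sq_eq ε
        rw [hε] at h2
        simpa [Fin.sum_univ_three] using h2.symm
      have hεC : (ε 0 : ℂ) ^ 2 + (ε 1 : ℂ) ^ 2 + (ε 2 : ℂ) ^ 2 = 1 := by
        have := congrArg Complex.ofReal hε2
        push_cast at this
        exact this
      have h3 : ∀ ω : Sph, F' s ω = -(s : ℂ)⁻¹ *
        (∑ i, fderiv ℝ (fderiv ℝ (g ∘ a s)) ω (EuclideanSpace.single i 1)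
            (EuclideanSpace.single i 1)
        - fderiv ℝ (fderiv ℝ (g ∘ a s)) ω ω ω - 2 * fderiv ℝ (g ∘ a s) ω ω) := fun ω => by
        have hs' : (s : ℂ) ≠ 0 := by exact_mod_cast hs
        simp only [hf2, hf1, F', Fin.sum_univ_three, EuclideanSpace.inner_single_right]
        push_cast
        field_simp
        simp
        linear_combination (-(s : ℂ) * deriv (deriv g) (a s ω)) * hεC
      simp only [h3]
      rw [integral_const_mul, h1, mul_zero]
  have hQ : ∀ s, HasDerivAt (fun s => ∫ ω, F s ω ∂sphMeas) 0 s := fun s => by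
    have := hasDerivAt_integral_of_compact (μ := sphMeas) isCompact_univ (F := F) (F' := F')
      (fun t => by simp only [F, a]; fun_prop)
      (by simp only [F', a, Function.uncurry_def]; fun_prop) hFd
      (fun t x hx => absurd (Set.mem_univ x) hx) s
    rwa [hzero] at this
  have hconst := is_const_of_deriv_eq_zero (fun s => (hQ s).differentiableAt)
    (fun s => (hQ s).deriv) s 0
  have h0 : ∫ ω, F 0 ω ∂sphMeas = sphMeas.real Set.univ * g c := by simp [F, a]
  rw [← h0, ← hconst]

/-- Spherical averages of plane waves, in terms of the profile at the two end points. -/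
lemma integral_sphere_plane {g : ℝ → ℂ} (hg : ContDiff ℝ 2 g) (t s : ℝ) {ε : E3}
    (hε : ‖ε‖ = 1) :
    2 * s * ∫ ω : Sph, deriv g (t + s * inner ℝ ε (ω : E3)) ∂sphMeas =
      sphMeas.real Set.univ * (g (t + s) - g (t - s)) := by
  have hcg := hg.continuous
  have hcg1 : Continuous (deriv g) := hg.continuous_deriv (by norm_num)
  have h1 := integral_sphere_plane_aux hg (t + s) s hε
  -- Reflecting the profile and `ε` gives the formula at the other end point `t - s`. In the
  -- difference the terms with `g` cancel, and the weights `s (1 + (ε, ω))` and `s (1 - (ε, ω))` of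
  -- `g'` add up to `2 s`.
  have h2 := integral_sphere_plane_aux (g := fun z => g (-z)) (hg.comp contDiff_neg) (-(t - s)) s
    (ε := -ε) (by simpa using hε)
  simp only [deriv_comp_neg, inner_neg_left, neg_neg] at h2
  rw [mul_sub, ← h1, ← h2, ← integral_sub, ← integral_const_mul]
  · refine integral_congr_ae (Eventually.of_forall fun ω => ?_)
    beta_reduce
    have e1 : t + s - s + s * inner ℝ ε (ω : E3) = t + s * inner ℝ ε (ω : E3) := by ring
    have e2 : -(-(t - s) - s + s * -inner ℝ ε (ω : E3)) = t + s * inner ℝ ε (ω : E3) := by ring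
    rw [e1, e2]
    push_cast
    ring
  · apply integrable_sphere_of_continuous; fun_prop
  · apply integrable_sphere_of_continuous; fun_prop

/-- The superposition of the plane waves whose profiles are the derivatives of the integrals of `ρ`
over null hyperplanes is the difference of the advanced and the retarded potential of `ρ`. -/
lemma integral_null_radon {ρ : Mink → ℂ} (hρ : ContDiff ℝ 2 ρ) (hs : HasCompactSupport ρ)
    (β : Mink) :
    ∫ ω : Sph, (∫ y : E3, fderiv ℝ ρ ((mink β (nullVec ω) + inner ℝ (ω : E3) y) • e 0 + spEmb y)
        (e 0)) ∂sphMeas =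
      sphMeas.real Set.univ / 2 *
        ((∫ ω : Sph, (∫ r in Set.Ioi (0 : ℝ), (r : ℂ) * ρ (β + r • nullVec ω)) ∂sphMeas) -
        ∫ ω : Sph, (∫ r in Set.Ioi (0 : ℝ), (r : ℂ) * ρ (β - r • nullVec ω)) ∂sphMeas) := by
  have hc0 := hρ.continuous
  have hc1 : Continuous (fderiv ℝ ρ) := hρ.continuous_fderiv two_ne_zero
  have hz0 : ∀ x ∉ tsupport ρ, ρ x = 0 := fun x hx => image_eq_zero_of_notMem_tsupport hx
  have hz1 : ∀ x ∉ tsupport ρ, fderiv ℝ ρ x = 0 := fun x hx =>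
    image_eq_zero_of_notMem_tsupport fun h => hx (tsupport_fderiv_subset ℝ h)
  let k : Set E3 := (fun x => x - spPart β) '' (spPart '' tsupport ρ)
  have hk : IsCompact k := (hs.isCompact.image spPart.continuous).image (by fun_prop)
  -- The integration variable is shifted by the spatial part of `β`, so that the argument of `ρ` is
  -- `β` itself for `y = 0` and `r` becomes the distance from `β` in space.
  let G : Sph → E3 → ℂ := fun ω y =>
    fderiv ℝ ρ ((β 0 + inner ℝ (ω : E3) y) • e 0 + spEmb (spPart β + y)) (e 0)
  have hGc : Integrable (Function.uncurry G) (sphMeas.prod volume) := by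
    refine Continuous.integrable_of_hasCompactSupport ?_ ?_
    · simp only [G, Function.uncurry_def]; fun_prop
    · refine HasCompactSupport.intro (isCompact_univ.prod hk) ?_
      rintro ⟨ω, y⟩ h
      simp only [Set.mem_prod, Set.mem_univ, true_and] at h
      simp only [Function.uncurry_apply_pair, G]
      rw [hz1, zero_apply]
      intro hmem
      exact h ⟨spPart β + y, ⟨_, hmem, by simp⟩, by simp⟩
  have h1 : ∀ ω : Sph, (∫ y : E3, fderiv ℝ ρ
      ((mink β (nullVec ω) + inner ℝ (ω : E3) y) • e 0 + spEmb y) (e 0)) = ∫ y, G ω y := fun ω => by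
    rw [← integral_add_left_eq_self _ (spPart β)]
    refine integral_congr_ae (Eventually.of_forall fun y => ?_)
    simp only [G, mink_nullVec, inner_add_right, real_inner_comm (spPart β) (ω : E3)]
    congr 4
    ring
  simp only [h1]
  have hGi : Integrable fun y => ∫ ω, G ω y ∂sphMeas := hGc.integral_prod_right
  -- With `y = r ω` fixed, the average is over the directions `ω'` of the plane waves. As a function
  -- of time at that spatial point, `ρ` is sampled at the two end points `β 0 ± r`, that is, on the
  -- future and on the past light cone of `β`.
  have hG : ∀ (ω : Sph) (r : ℝ), 0 < r → 2 * r * ∫ ω', G ω' (r • (ω : E3)) ∂sphMeas =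
      sphMeas.real Set.univ * (ρ (β + r • nullVec ω) - ρ (β - r • nullVec (-(ω : E3)))) := by
    intro ω r hr
    let g : ℝ → ℂ := fun z => ρ (z • e 0 + spEmb (spPart β + r • (ω : E3)))
    have hg : ContDiff ℝ 2 g := hρ.comp (by fun_prop)
    have hgd : ∀ z, deriv g z = fderiv ℝ ρ (z • e 0 + spEmb (spPart β + r • (ω : E3))) (e 0) := by
      intro z
      have h2 : HasDerivAt (fun z : ℝ => z • e 0 + spEmb (spPart β + r • (ω : E3))) (e 0) z := by
        simpa using ((hasDerivAt_id z).smul_const (e 0)).add_const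
          (spEmb (spPart β + r • (ω : E3)))
      exact ((hρ.differentiable two_ne_zero _).hasFDerivAt.comp_hasDerivAt z h2).deriv
    have h3 := integral_sphere_plane hg (β 0) r (ε := (ω : E3)) (by simp)
    simp only [hgd] at h3
    have h4 : ∀ ω' : Sph, G ω' (r • (ω : E3)) = fderiv ℝ ρ ((β 0 + r * inner ℝ (ω : E3) (ω' : E3)) •
        e 0 + spEmb (spPart β + r • (ω : E3))) (e 0) := fun ω' => by
      simp only [G, inner_smul_right, real_inner_comm (ω : E3) (ω' : E3)]
    simp only [h4, h3, g]
    have e1 : (β 0 + r) • e 0 + spEmb (spPart β + r • (ω : E3)) = β + r • nullVec ω := by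
      conv_rhs => rw [eq_time_add_space β]
      simp only [nullVec, map_add, map_smul, smul_add, add_smul]; abel
    have e2 : (β 0 - r) • e 0 + spEmb (spPart β + r • (ω : E3)) =
        β - r • nullVec (-(ω : E3)) := by
      conv_rhs => rw [eq_time_add_space β]
      simp only [nullVec, map_add, map_smul, smul_add, sub_smul, map_neg, smul_neg]; abel
    rw [e1, e2]
  have hint : ∀ s : ℝ, s = 1 ∨ s = -1 →
      Integrable (fun z : Sph × ℝ => (z.2 : ℂ) * ρ (β + (s * z.2) • nullVec (s • (z.1 : E3))))
        (sphMeas.prod (volume.restrict (Set.Ioi 0))) := by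
    intro s hs'
    obtain ⟨R, hR⟩ := hs.isCompact.isBounded.subset_closedBall 0
    refine Continuous.integrable_of_hasCompactSupport (by fun_prop) ?_
    refine HasCompactSupport.intro (isCompact_univ.prod (isCompact_closedBall (0 : ℝ) (R + |β 0|))) ?_
    rintro ⟨ω, r⟩ h
    simp only [Set.mem_prod, Set.mem_univ, true_and, mem_closedBall_zero_iff, not_le,
      Real.norm_eq_abs] at h
    rw [hz0, mul_zero]
    intro hmem
    have h1 := hR hmem
    rw [mem_closedBall_zero_iff] at h1
    have h2 := PiLp.norm_apply_le (β + (s * r) • nullVec (s • (ω : E3))) 0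
    simp only [PiLp.add_apply, PiLp.smul_apply, nullVec_zero, smul_eq_mul, mul_one,
      Real.norm_eq_abs] at h2
    have h5 : |s * r| = |r| := by
      rcases hs' with rfl | rfl <;> simp
    have h6 := abs_sub_abs_le_abs_sub (s * r) (-β 0)
    rw [sub_neg_eq_add, add_comm (s * r), h5, abs_neg] at h6
    linarith
  have hp := hint 1 (Or.inl rfl)
  have hm := hint (-1) (Or.inr rfl)
  simp only [one_mul, one_smul] at hp
  simp only [neg_smul, neg_mul, one_mul, one_smul, ← sub_eq_add_neg] at hm
  -- The past end point appears with direction `-ω`; the antipodal map brings the retarded potential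
  -- into the same form.
  have hflip := integral_sphere_isometry (LinearIsometryEquiv.neg ℝ) fun x =>
    ∫ r in Set.Ioi (0 : ℝ), (r : ℂ) * ρ (β - r • nullVec x)
  simp only [LinearIsometryEquiv.coe_neg] at hflip
  rw [integral_integral_swap hGc, integral_polar hGi, ← hflip,
    ← integral_sub hp.integral_prod_left hm.integral_prod_left, ← integral_const_mul]
  have hae := hp.prod_right_ae.and hm.prod_right_ae
  refine integral_congr_ae (hae.mono fun ω hω => ?_)
  beta_reduce
  rw [← integral_sub hω.1 hω.2, ← integral_const_mul]
  refine setIntegral_congr_fun measurableSet_Ioi fun r hr => ?_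
  have := hG ω r hr
  push_cast
  -- The polar volume element has the factor `r ^ 2` and `hG` the factor `2 * r`, which leaves the
  -- weight `r / 2`.
  linear_combination (r : ℂ) / 2 * this

/-! ### Plane wave representation of solutions of the wave equation -/

lemma two_le_top : (2 : WithTop ℕ∞) ≤ ((⊤ : ℕ∞) : WithTop ℕ∞) := by
  have : ((2 : ℕ∞) : WithTop ℕ∞) ≤ ((⊤ : ℕ∞) : WithTop ℕ∞) := WithTop.coe_le_coe.2 le_top
  exact this

open scoped ContDiff Manifold in
lemma exists_smooth_cutoff {K V : Set Mink} (hK : IsCompact K) (hV : IsOpen V) (hKV : K ⊆ V) :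
    ∃ χ : Mink → ℂ, ContDiff ℝ ∞ χ ∧ HasCompactSupport χ ∧ tsupport χ ⊆ V ∧
      ∃ W, IsOpen W ∧ K ⊆ W ∧ ∀ x ∈ W, χ x = 1 := by
  obtain ⟨L, hL, hKL, hLV⟩ := exists_compact_between hK hV hKV
  obtain ⟨f, hf1, hf0, -⟩ := exists_contMDiffMap_one_nhds_of_subset_interior (n := (⊤ : ℕ∞)) 𝓘(ℝ, Mink)
    hK.isClosed hKL
  have hsupp : tsupport (fun x => (f x : ℂ)) ⊆ L := by
    refine closure_minimal (fun x hx => ?_) hL.isClosed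
    by_contra h
    exact hx (by simp [hf0 x h])
  obtain ⟨W, hWo, hKW, hW⟩ := eventually_nhdsSet_iff_exists.1 hf1
  refine ⟨fun x => (f x : ℂ), ?_, hL.of_isClosed_subset (isClosed_tsupport _) hsupp,
    hsupp.trans hLV, W, hWo, hKW, fun x hx => by simp [hW x hx]⟩
  exact Complex.ofRealCLM.contDiff.comp (contMDiff_iff_contDiff.1 f.contMDiff)

open scoped ContDiff Manifold in
lemma exists_smooth_separation {S T : Set Mink} (hS : IsClosed S) (hT : IsClosed T)
    (h : Disjoint S T) :
    ∃ χ : Mink → ℂ, ContDiff ℝ ∞ χ ∧ (∀ x ∈ S, χ x = 0) ∧ ∀ x ∈ T, χ x = 1 := by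
  obtain ⟨f, h0, h1, -⟩ := exists_contMDiffMap_zero_one_of_isClosed (n := (⊤ : ℕ∞)) 𝓘(ℝ, Mink) hS hT h
  exact ⟨fun x => (f x : ℂ), Complex.ofRealCLM.contDiff.comp (contMDiff_iff_contDiff.1 f.contMDiff),
    fun x hx => by simp [h0 hx], fun x hx => by simp [h1 hx]⟩

open scoped ContDiff in
lemma contDiff_box {v : Mink → ℂ} (hv : ContDiff ℝ ∞ v) : ContDiff ℝ ∞ (box v) := by
  have h1 : box v = fun x => ∑ ν, (eta ν : ℂ) * fderiv ℝ (fderiv ℝ v) x (e ν) (e ν) :=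
    funext fun x => box_eq (hv.of_le two_le_top).contDiffAt
  rw [h1]
  have h2 : ContDiff ℝ ∞ (fderiv ℝ (fderiv ℝ v)) :=
    (hv.fderiv_right (m := ∞) (by simp)).fderiv_right (by simp)
  fun_prop

lemma tsupport_box_subset (v : Mink → ℂ) : tsupport (box v) ⊆ tsupport v := by
  refine closure_minimal (fun x hx => ?_) (isClosed_tsupport v)
  by_contra h
  apply hx
  refine Finset.sum_eq_zero fun ν _ => ?_
  have h1 : dUp ν v =ᶠ[𝓝 x] fun _ => 0 := by
    filter_upwards [(isClosed_tsupport v).isOpen_compl.mem_nhds h] with y hy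
    have : fderiv ℝ v y = 0 :=
      image_eq_zero_of_notMem_tsupport fun h' => hy (tsupport_fderiv_subset ℝ h')
    simp [dUp, dLow, this]
  simp [dLow, h1.fderiv_eq]

/-- A solution of the wave equation on the forward cone is, near a compact set, a superposition of
plane waves moving in the null directions. -/
theorem exists_plane_wave_representation {Ξ : Mink → ℂ} (hΞ : IsAdmissible Ξ) {B : Set Mink}
    (hB : IsCompact B) (hBV : B ⊆ forwardCone) :
    ∃ (U : Set Mink) (Φ Φ' : Sph → ℝ → ℂ), IsOpen U ∧ B ⊆ U ∧
      Continuous (Function.uncurry Φ) ∧ Continuous (Function.uncurry Φ') ∧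
      (∀ ω z, HasDerivAt (Φ ω) (Φ' ω z) z) ∧
      ∀ β ∈ U, Ξ β = ∫ ω : Sph, Φ ω (mink β (nullVec ω)) ∂sphMeas := by
  obtain ⟨a', ha', haB⟩ := hB.exists_forall_le' (f := fun β : Mink => β 0 - ‖spPart β‖) (a := 0)
    (by fun_prop) fun β hβ => by
      have := (mem_forwardCone_iff β).1 (hBV hβ); linarith
  obtain ⟨b, hbB⟩ := hB.exists_bound_of_continuousOn (f := fun β : Mink => β 0 + ‖spPart β‖)
    (by fun_prop)
  obtain ⟨a, ha, haa⟩ := exists_between ha'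
  -- `D` is a double cone around `B`: the intersection of the closed future cone of `(a, 0)` with
  -- the closed past cone of `(b + 1, 0)`. As `a > 0`, it is a compact subset of the forward cone.
  let D : Set Mink := {β | a ≤ β 0 - ‖spPart β‖ ∧ β 0 + ‖spPart β‖ ≤ b + 1}
  let U : Set Mink := {β | a < β 0 - ‖spPart β‖ ∧ β 0 + ‖spPart β‖ < b + 1}
  have hUo : IsOpen U := IsOpen.inter
    (s := {β : Mink | a < β 0 - ‖spPart β‖}) (t := {β : Mink | β 0 + ‖spPart β‖ < b + 1})
    (isOpen_lt (by fun_prop) (by fun_prop)) (isOpen_lt (by fun_prop) (by fun_prop))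
  have hBU : B ⊆ U := fun β hβ => by
    refine ⟨haa.trans_le (haB β hβ), ?_⟩
    have := (le_abs_self _).trans (hbB β hβ)
    linarith
  have hUD : U ⊆ D := fun β hβ => ⟨hβ.1.le, hβ.2.le⟩
  have hFm : IsClosed {β : Mink | β 0 + ‖spPart β‖ ≤ b + 1} :=
    isClosed_le (by fun_prop) (by fun_prop)
  have hFp : IsClosed {β : Mink | a ≤ β 0 - ‖spPart β‖} := isClosed_le (by fun_prop) (by fun_prop)
  have hDV : D ⊆ forwardCone := fun β hβ => by
    rw [mem_forwardCone_iff]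
    have := hβ.1
    linarith
  have hDc : IsCompact D := by
    have hsub : D ⊆ (fun z : ℝ × E3 => z.1 • e 0 + spEmb z.2) ''
        (Set.Icc 0 (b + 1) ×ˢ Metric.closedBall 0 (b + 1)) := fun β hβ => by
      have h0 := norm_nonneg (spPart β)
      refine ⟨(β 0, spPart β), ⟨⟨?_, ?_⟩, ?_⟩, (eq_time_add_space β).symm⟩
      · have := hβ.1; linarith
      · have := hβ.2; linarith
      · rw [mem_closedBall_zero_iff]
        have := hβ.1; have := hβ.2
        dsimp only
        linarith
    exact ((isCompact_Icc.prod (isCompact_closedBall _ _)).image (by fun_prop)).of_isClosed_subset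
      (hFp.inter hFm) hsub
  obtain ⟨χ, hχ, hχc, hχV, W, hWo, hDW, hW1⟩ := exists_smooth_cutoff hDc isOpen_forwardCone hDV
  let v : Mink → ℂ := fun x => χ x * Ξ x
  have hvs : tsupport v ⊆ tsupport χ := tsupport_mul_subset_left
  have hvc : HasCompactSupport v := hχc.mul_right
  have hv : ContDiff ℝ (⊤ : ℕ∞) v := by
    refine contDiff_iff_contDiffAt.2 fun x => ?_
    by_cases hx : x ∈ tsupport χ
    · exact hχ.contDiffAt.mul (hΞ.smooth.contDiffAt (isOpen_forwardCone.mem_nhds (hχV hx)))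
    · refine (contDiffAt_const (c := (0 : ℂ))).congr_of_eventuallyEq ?_
      filter_upwards [(isClosed_tsupport χ).isOpen_compl.mem_nhds hx] with y hy
      simp [v, image_eq_zero_of_notMem_tsupport hy]
  have hv2 : ContDiff ℝ 2 v := hv.of_le two_le_top
  have hbox : ∀ x ∈ W ∩ forwardCone, box v x = 0 := fun x hx => by
    have h1 : v =ᶠ[𝓝 x] Ξ := by
      filter_upwards [hWo.mem_nhds hx.1] with y hy
      simp [v, hW1 y hy]
    have h2 : ContDiffAt ℝ 2 Ξ x := hv2.contDiffAt.congr_of_eventuallyEq h1.symm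
    rw [← hΞ.wave x hx.2, box_eq hv2.contDiffAt, box_eq h2, h1.fderiv.fderiv_eq]
  let S : Set Mink := tsupport (box v)
  have hSD : ∀ x ∈ S, x ∉ D := by
    have : S ⊆ (W ∩ forwardCone)ᶜ :=
      closure_minimal (fun x hx h => hx (hbox x h)) (hWo.inter isOpen_forwardCone).isClosed_compl
    exact fun x hx hD => this hx ⟨hDW hD, hDV hD⟩
  -- The source `box v` lives off `D`, so no point of its support lies in both bounding cones. Null
  -- rays into the past of a point of `U` stay in the past cone, where `θ` keeps the whole source;
  -- rays into the future stay in the future cone, where `θ` removes it. Thus the retarded potential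
  -- of `ρ` is that of `box v`, and the advanced one vanishes.
  obtain ⟨θ, hθ, hθ0, hθ1⟩ := exists_smooth_separation
    (S := S ∩ {β : Mink | a ≤ β 0 - ‖spPart β‖}) (T := S ∩ {β : Mink | β 0 + ‖spPart β‖ ≤ b + 1})
    ((isClosed_tsupport _).inter hFp) ((isClosed_tsupport _).inter hFm)
    (Set.disjoint_left.2 fun x hx hx' => hSD x hx.1 ⟨hx.2, hx'.2⟩)
  let ρ : Mink → ℂ := fun x => θ x * box v x
  have hρ : ContDiff ℝ (⊤ : ℕ∞) ρ := hθ.mul (contDiff_box hv)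
  have hρc : HasCompactSupport ρ := (hvc.mono' (subset_tsupport _ |>.trans
    (tsupport_box_subset v))).mul_left
  have hρ2 : ContDiff ℝ 2 ρ := hρ.of_le two_le_top
  have hret : ∀ β ∈ U, ∀ ω : Sph, ∀ r : ℝ, 0 < r →
      box v (β - r • nullVec ω) = ρ (β - r • nullVec ω) := fun β hβ ω r hr => by
    by_cases hS : β - r • nullVec ω ∈ S
    · have : θ (β - r • nullVec ω) = 1 := by
        refine hθ1 _ ⟨hS, ?_⟩
        have h1 : ‖spPart (β - r • nullVec (ω : E3))‖ ≤ ‖spPart β‖ + r := by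
          refine (map_sub spPart _ _ ▸ norm_sub_le _ _).trans ?_
          simp [nullVec, norm_smul, abs_of_pos hr]
        have h2 := hβ.2
        simp only [Set.mem_ofPred_eq, PiLp.sub_apply, PiLp.smul_apply, nullVec_zero]
        simp only [smul_eq_mul, mul_one]
        linarith
      simp [ρ, this]
    · simp [ρ, image_eq_zero_of_notMem_tsupport hS]
  have hadv : ∀ β ∈ U, ∀ ω : Sph, ∀ r : ℝ, 0 < r → ρ (β + r • nullVec ω) = 0 :=
      fun β hβ ω r hr => by
    by_cases hS : β + r • nullVec ω ∈ S
    · have : θ (β + r • nullVec ω) = 0 := by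
        refine hθ0 _ ⟨hS, ?_⟩
        have h1 : ‖spPart (β + r • nullVec (ω : E3))‖ ≤ ‖spPart β‖ + r := by
          refine (map_add spPart _ _ ▸ norm_add_le _ _).trans ?_
          simp [nullVec, norm_smul, abs_of_pos hr]
        have h2 := hβ.1
        simp only [Set.mem_ofPred_eq, PiLp.add_apply, PiLp.smul_apply, nullVec_zero]
        simp only [smul_eq_mul, mul_one]
        linarith
      simp [ρ, this]
    · simp [ρ, image_eq_zero_of_notMem_tsupport hS]
  have hρ1 : ContDiff ℝ 1 (fderiv ℝ ρ) := hρ2.fderiv_right (by norm_num)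
  have hc1 : Continuous (fderiv ℝ ρ) := hρ1.continuous
  have hc2 : Continuous (fderiv ℝ (fderiv ℝ ρ)) := hρ1.continuous_fderiv one_ne_zero
  have hz1 : ∀ x ∉ tsupport ρ, fderiv ℝ ρ x = 0 := fun x hx =>
    image_eq_zero_of_notMem_tsupport fun h => hx (tsupport_fderiv_subset ℝ h)
  have hz2 : ∀ x ∉ tsupport ρ, fderiv ℝ (fderiv ℝ ρ) x = 0 := fun x hx =>
    image_eq_zero_of_notMem_tsupport fun h =>
      hx (tsupport_fderiv_subset ℝ (tsupport_fderiv_subset ℝ h))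
  let k : Set E3 := spPart '' tsupport ρ
  have hk : IsCompact k := hρc.isCompact.image spPart.continuous
  let pt : Sph → ℝ → E3 → Mink := fun ω z y => (z + inner ℝ (ω : E3) y) • e 0 + spEmb y
  have hpt : ∀ ω z, ∀ y ∉ k, pt ω z y ∉ tsupport ρ := fun ω z y hy h => hy ⟨_, h, by simp [pt]⟩
  -- With `σ` the area of the sphere, `integral_null_radon` contributes `-σ / 2` and Kirchhoff's
  -- formula a further `σ`; `c` is the inverse of their product.
  let c : ℂ := -(2 / (sphMeas.real Set.univ : ℂ) ^ 2)
  let F : Sph → ℝ → E3 → ℂ := fun ω z y => fderiv ℝ ρ (pt ω z y) (e 0)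
  let F' : Sph → ℝ → E3 → ℂ := fun ω z y => fderiv ℝ (fderiv ℝ ρ) (pt ω z y) (e 0) (e 0)
  have hcont : ∀ H : Sph → ℝ → E3 → ℂ, Continuous (fun z : (Sph × ℝ) × E3 => H z.1.1 z.1.2 z.2) →
      (∀ ω z, ∀ y ∉ k, H ω z y = 0) →
      Continuous (Function.uncurry fun ω z => c * ∫ y, H ω z y) := fun H hH h0 => by
    have h1 := continuous_parametric_integral_of_continuous (μ := volume)
      (f := fun (z : Sph × ℝ) y => H z.1 z.2 y) hH hk
    refine continuous_const.mul (h1.congr fun z => ?_)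
    exact setIntegral_eq_integral_of_forall_compl_eq_zero fun y hy => h0 z.1 z.2 y hy
  refine ⟨U, fun ω z => c * ∫ y, F ω z y, fun ω z => c * ∫ y, F' ω z y, hUo, hBU,
    hcont F (by simp only [F, pt]; fun_prop) fun ω z y hy => by simp [F, hz1 _ (hpt ω z y hy)],
    hcont F' (by simp only [F', pt]; fun_prop) fun ω z y hy => by simp [F', hz2 _ (hpt ω z y hy)],
    fun ω z => ?_, fun β hβ => ?_⟩
  · refine (hasDerivAt_integral_of_compact hk (F := F ω) (F' := F' ω)
      (fun t => by simp only [F, pt]; fun_prop)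
      (by simp only [F', pt, Function.uncurry_def]; fun_prop) (fun t y => ?_)
      (fun t y hy => by simp [F, hz1 _ (hpt ω t y hy)]) z).const_mul c
    have h2 : HasDerivAt (fun s => pt ω s y) (e 0) t := by
      simpa [pt] using (((hasDerivAt_id t).add_const (inner ℝ (ω : E3) y)).smul_const
        (e 0)).add_const (spEmb y)
    have h3 := ((hρ1.differentiable one_ne_zero _).hasFDerivAt.comp_hasDerivAt t h2).clm_apply
      (hasDerivAt_const t (e 0))
    simpa [F, F'] using h3
  · have hσ : (sphMeas.real Set.univ : ℂ) ≠ 0 := by exact_mod_cast sphMeas_real_univ_pos.ne'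
    have h1 := integral_null_radon hρ2 hρc β
    have h2 := integral_past_cone_box hv2 hvc β
    have h3 : (∫ ω : Sph, (∫ r in Set.Ioi (0 : ℝ), (r : ℂ) * ρ (β + r • nullVec ω)) ∂sphMeas) = 0 := by
      have : ∀ ω : Sph, (∫ r in Set.Ioi (0 : ℝ), (r : ℂ) * ρ (β + r • nullVec ω)) = 0 :=
        fun ω => setIntegral_eq_zero_of_forall_eq_zero fun r hr => by
          rw [hadv β hβ ω r hr, mul_zero]
      simp [this]
    have h4 : (∫ ω : Sph, (∫ r in Set.Ioi (0 : ℝ), (r : ℂ) * box v (β - r • nullVec ω)) ∂sphMeas) =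
        ∫ ω : Sph, (∫ r in Set.Ioi (0 : ℝ), (r : ℂ) * ρ (β - r • nullVec ω)) ∂sphMeas := by
      refine integral_congr_ae (Eventually.of_forall fun ω =>
        setIntegral_congr_fun measurableSet_Ioi fun r hr => ?_)
      simp only [hret β hβ ω r hr]
    have h5 : v β = Ξ β := by simp [v, hW1 β (hDW (hUD hβ))]
    rw [integral_const_mul]
    simp only [F, pt]
    rw [h1, h3, ← h4, h2, h5]
    simp only [c]
    field_simp
    ring

/-! ### Approximation of solutions by derivatives of the fundamental solution -/

/-- Multi-indices of even order. -/
abbrev EvenList : Type := {l : List (Fin 4) // Even l.length}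

/-- The monomial `n^{μ₁} ⋯ n^{μₘ}` in the components of the null vector `n = (1, ω)`. -/
def nullMono (l : List (Fin 4)) (ω : E3) : ℝ := (l.map fun ν => nullVec ω ν).prod

@[simp] lemma nullMono_nil (ω : E3) : nullMono [] ω = 1 := rfl

@[simp] lemma nullMono_cons (ν : Fin 4) (l : List (Fin 4)) (ω : E3) :
    nullMono (ν :: l) ω = nullVec ω ν * nullMono l ω := rfl

lemma nullMono_append (l l' : List (Fin 4)) (ω : E3) :
    nullMono (l ++ l') ω = nullMono l ω * nullMono l' ω := by simp [nullMono]

@[fun_prop]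
lemma continuous_nullMono (l : List (Fin 4)) : Continuous (nullMono l) := by
  induction l with
  | nil => exact continuous_const
  | cons ν l ih =>
    change Continuous fun ω => nullVec ω ν * nullMono l ω
    fun_prop

/-- Up to constants, the derivative with multi-index `l` of `1 / β²`. -/
def coneFn (l : List (Fin 4)) (β : Mink) : ℂ :=
  ∫ ω : Sph, (nullMono l ω : ℂ) * ((mink β (nullVec ω) : ℂ)⁻¹) ^ (l.length + 2) ∂sphMeas

/-- Stone–Weierstrass on the sphere times `[c₁, c₂]`. Concatenation of multi-indices multiplies the
functions, which are real, so the even ones span a self-adjoint unital algebra. Order two already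
separates points: as `n^0 = 1`, the function for `[0, 0]` is `z⁻²` and determines `z > 0`, after
which `[0, ν]` determines `ω`. Only even orders are admitted because the thermal functions of odd
order vanish. -/
lemma exists_nullMono_approx {c₁ c₂ : ℝ} (hc₁ : 0 < c₁) {Φ : Sph → ℝ → ℂ}
    (hΦ : Continuous (Function.uncurry Φ)) {ε : ℝ} (hε : 0 < ε) :
    ∃ b : EvenList →₀ ℂ, ∀ (ω : Sph), ∀ z ∈ Set.Icc c₁ c₂,
      ‖Φ ω z - b.sum fun l a => a * ((nullMono l.1 ω : ℂ) * ((z : ℂ)⁻¹) ^ l.1.length)‖ < ε := by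
  have hz : ∀ x : Sph × Set.Icc c₁ c₂, ((x.2 : ℝ) : ℂ) ≠ 0 := fun x => by
    exact_mod_cast (hc₁.trans_le x.2.2.1).ne'
  let M : List (Fin 4) → C(Sph × Set.Icc c₁ c₂, ℂ) := fun l =>
    ⟨fun x => (nullMono l x.1 : ℂ) * (((x.2 : ℝ) : ℂ)⁻¹) ^ l.length, by
      refine Continuous.mul (by fun_prop) (Continuous.pow (Continuous.inv₀ (by fun_prop) hz) _)⟩
  let s : Set C(Sph × Set.Icc c₁ c₂, ℂ) := Set.range fun ν : Fin 4 => M [0, ν]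
  have hMmul : ∀ l l', M l * M l' = M (l ++ l') := fun l l' => by
    ext x
    simp only [M, ContinuousMap.mul_apply, ContinuousMap.coe_mk, nullMono_append,
      List.length_append]
    push_cast
    ring
  have hstar : ∀ l, star (M l) = M l := fun l => by
    ext x
    simp [M]
  let A : StarSubalgebra ℂ C(Sph × Set.Icc c₁ c₂, ℂ) := StarAlgebra.adjoin ℂ s
  have hAspan : ∀ f ∈ A, f ∈ Submodule.span ℂ (Set.range fun l : EvenList => M l.1) := by
    intro f hf
    have h1 : f ∈ (StarAlgebra.adjoin ℂ s).toSubalgebra := hf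
    rw [StarAlgebra.adjoin_toSubalgebra] at h1
    have h2 : f ∈ Subalgebra.toSubmodule (Algebra.adjoin ℂ (s ∪ star s)) := h1
    rw [Algebra.adjoin_eq_span] at h2
    refine Submodule.span_mono (fun g hg => ?_) h2
    induction hg using Submonoid.closure_induction with
    | mem g hg =>
      rcases hg with ⟨ν, rfl⟩ | ⟨ν, hν⟩
      · exact ⟨⟨[0, ν], by simp⟩, rfl⟩
      · refine ⟨⟨[0, ν], by simp⟩, ?_⟩
        change M [0, ν] = g
        rw [← star_star g, ← hν]
        exact (hstar _).symm
    | one => exact ⟨⟨[], by simp⟩, by ext x; simp [M]⟩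
    | mul g g' _ _ h h' =>
      obtain ⟨l, rfl⟩ := h
      obtain ⟨l', rfl⟩ := h'
      exact ⟨⟨l.1 ++ l'.1, by rw [List.length_append]; exact l.2.add l'.2⟩, (hMmul _ _).symm⟩
  have hsep : A.SeparatesPoints := by
    intro x y hxy
    by_contra hcon
    push Not at hcon
    have h1 : ∀ ν, M [0, ν] x = M [0, ν] y := fun ν =>
      hcon _ ⟨M [0, ν], StarAlgebra.subset_adjoin ℂ s ⟨ν, rfl⟩, rfl⟩
    have hM : ∀ ν (x : Sph × Set.Icc c₁ c₂), M [0, ν] x = ((nullVec (x.1 : E3) ν * ((x.2 : ℝ)⁻¹) ^ 2 : ℝ) : ℂ) :=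
      fun ν x => by simp [M]
    have h2 : ∀ ν, nullVec (x.1 : E3) ν * ((x.2 : ℝ)⁻¹) ^ 2 =
        nullVec (y.1 : E3) ν * ((y.2 : ℝ)⁻¹) ^ 2 := fun ν => by
      have := h1 ν
      rw [hM, hM] at this
      exact_mod_cast this
    have hx : 0 < (x.2 : ℝ) := hc₁.trans_le x.2.2.1
    have hy : 0 < (y.2 : ℝ) := hc₁.trans_le y.2.2.1
    have h3 : (x.2 : ℝ) = y.2 := by
      have := h2 0
      simp only [nullVec_zero, one_mul] at this
      have := (pow_left_inj₀ (by positivity) (by positivity) two_ne_zero).1 this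
      exact inv_injective this
    have h4 : ∀ ν, nullVec (x.1 : E3) ν = nullVec (y.1 : E3) ν := fun ν => by
      have := h2 ν
      rw [h3] at this
      exact mul_right_cancel₀ (by positivity) this
    apply hxy
    refine Prod.ext (Subtype.ext ?_) (Subtype.ext h3)
    ext i
    have := h4 i.succ
    fin_cases i <;> simpa [nullVec, spEmb_apply] using this
  have hdense := ContinuousMap.starSubalgebra_topologicalClosure_eq_top_of_separatesPoints A hsep
  let φ : C(Sph × Set.Icc c₁ c₂, ℂ) := ⟨fun x => Φ x.1 x.2, hΦ.comp (by fun_prop : Continuous fun x : Sph × Set.Icc c₁ c₂ =>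
    (x.1, (x.2 : ℝ)))⟩
  have hφ : φ ∈ closure (A : Set C(Sph × Set.Icc c₁ c₂, ℂ)) := by
    rw [← StarSubalgebra.topologicalClosure_coe, hdense]
    trivial
  obtain ⟨g, hgA, hg⟩ := Metric.mem_closure_iff.1 hφ ε hε
  obtain ⟨b, hb⟩ := Finsupp.mem_span_range_iff_exists_finsupp.1 (hAspan g hgA)
  refine ⟨b, fun ω z hz => ?_⟩
  have h1 := (ContinuousMap.dist_lt_iff hε).1 hg (ω, ⟨z, hz⟩)
  rw [dist_eq_norm] at h1
  refine lt_of_eq_of_lt ?_ h1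
  congr 2
  rw [← hb, Finsupp.sum, Finsupp.sum, ContinuousMap.sum_apply]
  rfl

/-- The extra power is obtained by approximating `z ^ k Φ` and dividing; since `z ≥ c₁`, the
tolerance `ε c₁ ^ k` suffices. -/
lemma exists_nullMono_approx_pow {c₁ c₂ : ℝ} (hc₁ : 0 < c₁) {Φ : Sph → ℝ → ℂ}
    (hΦ : Continuous (Function.uncurry Φ)) (k : ℕ) {ε : ℝ} (hε : 0 < ε) :
    ∃ b : EvenList →₀ ℂ, ∀ (ω : Sph), ∀ z ∈ Set.Icc c₁ c₂,
      ‖Φ ω z - b.sum fun l a => a * ((nullMono l.1 ω : ℂ) * ((z : ℂ)⁻¹) ^ (l.1.length + k))‖ < ε := by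
  have hΨ : Continuous (Function.uncurry fun (ω : Sph) (z : ℝ) => (z : ℂ) ^ k * Φ ω z) := by
    simp only [Function.uncurry_def]
    exact Continuous.mul (by fun_prop) hΦ
  obtain ⟨b, hb⟩ := exists_nullMono_approx (c₂ := c₂) hc₁ hΨ (ε := ε * c₁ ^ k) (by positivity)
  refine ⟨b, fun ω z hz => ?_⟩
  have hz0 : 0 < z := hc₁.trans_le hz.1
  have hzC : (z : ℂ) ≠ 0 := by exact_mod_cast hz0.ne'
  have h1 : Φ ω z - b.sum (fun l a => a * ((nullMono l.1 ω : ℂ) * ((z : ℂ)⁻¹) ^ (l.1.length + k))) =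
      ((z : ℂ)⁻¹) ^ k * ((z : ℂ) ^ k * Φ ω z -
        b.sum fun l a => a * ((nullMono l.1 ω : ℂ) * ((z : ℂ)⁻¹) ^ l.1.length)) := by
    rw [mul_sub, ← mul_assoc, ← mul_pow, inv_mul_cancel₀ hzC, one_pow, one_mul, Finsupp.mul_sum]
    congr 1
    refine Finsupp.sum_congr fun l _ => ?_
    ring
  rw [h1, norm_mul, norm_pow, norm_inv, Complex.norm_real, Real.norm_of_nonneg hz0.le, inv_pow,
    inv_mul_lt_iff₀ (by positivity)]
  refine (hb ω z hz).trans_le ?_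
  rw [mul_comm]
  exact mul_le_mul_of_nonneg_right (pow_le_pow_left₀ hc₁.le hz.1 k) hε.le

@[fun_prop]
lemma continuous_mink : Continuous fun z : Mink × Mink => mink z.1 z.2 := by
  unfold mink; fun_prop

lemma mink_nullVec_pos {β : Mink} (hβ : β ∈ forwardCone) (ω : Sph) : 0 < mink β (nullVec ω) := by
  rw [mink_nullVec]
  have h1 := (mem_forwardCone_iff β).1 hβ
  have h2 := real_inner_le_norm (spPart β) (ω : E3)
  simp at h2
  linarith

/-- On a compact set of temperature vectors the energy of null vectors is bounded from above and
below. -/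
lemma exists_mink_nullVec_bounds {B : Set Mink} (hB : IsCompact B) (hBV : B ⊆ forwardCone) :
    ∃ c₁ c₂ : ℝ, 0 < c₁ ∧ ∀ β ∈ B, ∀ ω : Sph, mink β (nullVec ω) ∈ Set.Icc c₁ c₂ := by
  have hc : Continuous fun z : Mink × Sph => mink z.1 (nullVec z.2) :=
    continuous_mink.comp (by fun_prop : Continuous fun z : Mink × Sph => (z.1, nullVec z.2))
  have hcomp : IsCompact (B ×ˢ (Set.univ : Set Sph)) := hB.prod isCompact_univ
  obtain ⟨c₁, h1, h1'⟩ := hcomp.exists_forall_le' hc.continuousOn (a := 0)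
    fun z hz => mink_nullVec_pos (hBV hz.1) z.2
  obtain ⟨c₂, h2⟩ := hcomp.exists_bound_of_continuousOn hc.continuousOn
  exact ⟨c₁, c₂, h1, fun β hβ ω => ⟨h1' (β, ω) ⟨hβ, trivial⟩,
    (le_abs_self _).trans (h2 (β, ω) ⟨hβ, trivial⟩)⟩⟩

lemma continuous_coneFn_integrand (l : List (Fin 4)) (k : ℕ) {β : Mink} (hβ : β ∈ forwardCone) :
    Continuous fun ω : Sph => (nullMono l ω : ℂ) * ((mink β (nullVec ω) : ℂ)⁻¹) ^ k := by
  refine Continuous.mul (by fun_prop) (Continuous.pow (Continuous.inv₀ ?_ fun ω => ?_) _)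
  · exact Complex.continuous_ofReal.comp
      (continuous_mink.comp (by fun_prop : Continuous fun ω : Sph => (β, nullVec ω)))
  · exact_mod_cast (mink_nullVec_pos hβ ω).ne'

lemma exists_pos_mul_sphMeas_lt {ε : ℝ} (hε : 0 < ε) :
    ∃ δ : ℝ, 0 < δ ∧ δ * sphMeas.real Set.univ < ε := by
  have h := sphMeas_real_univ_pos
  refine ⟨ε / 2 / sphMeas.real Set.univ, by positivity, ?_⟩
  rw [div_mul_cancel₀ _ h.ne']
  linarith

/-- Solutions of the wave equation are approximated by even derivatives of `1 / β²`. -/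
theorem exists_coneFn_approx {Ξ : Mink → ℂ} (hΞ : IsAdmissible Ξ) {B : Set Mink}
    (hB : IsCompact B) (hBV : B ⊆ forwardCone) {ε : ℝ} (hε : 0 < ε) :
    ∃ b : EvenList →₀ ℂ, ∀ β ∈ B, ‖Ξ β - b.sum fun l a => a * coneFn l.1 β‖ < ε := by
  obtain ⟨U, Φ, Φ', -, hBU, hΦ, -, -, hrep⟩ := exists_plane_wave_representation hΞ hB hBV
  obtain ⟨c₁, c₂, hc₁, hc⟩ := exists_mink_nullVec_bounds hB hBV
  obtain ⟨δ, hδ, hδε⟩ := exists_pos_mul_sphMeas_lt hε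
  -- The shift `2` is the excess of the exponent over the order in `coneFn`.
  obtain ⟨b, hb⟩ := exists_nullMono_approx_pow (c₂ := c₂) hc₁ hΦ 2 hδ
  refine ⟨b, fun β hβ => ?_⟩
  have hi1 : Integrable (fun ω : Sph => Φ ω (mink β (nullVec ω))) sphMeas := by
    refine integrable_sphere_of_continuous (hΦ.comp (g := Function.uncurry Φ)
      (f := fun ω : Sph => (ω, mink β (nullVec ω))) ?_)
    exact continuous_id.prodMk
      (continuous_mink.comp (by fun_prop : Continuous fun ω : Sph => (β, nullVec ω)))
  have hi2 : ∀ l : EvenList, Integrable (fun ω : Sph => b l * ((nullMono l.1 ω : ℂ) *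
      ((mink β (nullVec ω) : ℂ)⁻¹) ^ (l.1.length + 2))) sphMeas := fun l =>
    (integrable_sphere_of_continuous
      (continuous_coneFn_integrand l.1 (l.1.length + 2) (hBV hβ))).const_mul _
  simp only [coneFn, Finsupp.sum, ← integral_const_mul]
  rw [hrep β (hBU hβ), ← integral_finsetSum _ fun l _ => hi2 l,
    ← integral_sub hi1 (integrable_finsetSum _ fun l _ => hi2 l)]
  exact (norm_integral_le_of_norm_le_const
    (Eventually.of_forall fun ω => (hb ω _ (hc β hβ ω)).le)).trans_lt hδε

lemma eta_mul_eta (ν : Fin 4) : eta ν * eta ν = 1 := by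
  unfold eta; split_ifs <;> norm_num

lemma mink_e (ν : Fin 4) (x : Mink) : mink (e ν) x = eta ν * x ν := by
  simp [mink]

lemma mink_add_smul (x y z : Mink) (t : ℝ) : mink (x + t • y) z = mink x z + t * mink y z := by
  simp only [mink, Finset.mul_sum, ← Finset.sum_add_distrib]
  refine Finset.sum_congr rfl fun ν _ => ?_
  simp
  ring

lemma abs_nullVec_le (ω : Sph) (ν : Fin 4) : |nullVec (ω : E3) ν| ≤ 1 := by
  refine Fin.cases (by simp) (fun i => ?_) ν
  have h1 : nullVec (ω : E3) i.succ = (ω : E3) i := by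
    fin_cases i <;> simp [nullVec, spEmb_apply]
  have h2 := PiLp.norm_apply_le (ω : E3) i
  rw [h1]
  simpa using h2

/-- The gradients of solutions of the wave equation are approximated by gradients of odd derivatives
of `1 / β²`. -/
theorem exists_coneFn_gradient_approx {Ξ : Mink → ℂ} (hΞ : IsAdmissible Ξ) {B : Set Mink}
    (hB : IsCompact B) (hBV : B ⊆ forwardCone) {ε : ℝ} (hε : 0 < ε) :
    ∃ b : EvenList →₀ ℂ, ∀ ν, ∀ β ∈ B,
      ‖dUp ν Ξ β - b.sum fun l a => a * coneFn (ν :: 0 :: l.1) β‖ < ε := by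
  obtain ⟨U, Φ, Φ', hU, hBU, hΦ, hΦ', hΦd, hrep⟩ := exists_plane_wave_representation hΞ hB hBV
  obtain ⟨c₁, c₂, hc₁, hc⟩ := exists_mink_nullVec_bounds hB hBV
  obtain ⟨δ, hδ, hδε⟩ := exists_pos_mul_sphMeas_lt hε
  -- The index `ν` makes the order odd; the index `0`, which costs nothing since `n^0 = 1`, makes it
  -- even again. The order of `ν :: 0 :: l` exceeds that of `l` by two, whence the shift `4`.
  -- Approximating `Φ'` before multiplying by `n^ν` makes `b` independent of `ν`.
  obtain ⟨b, hb⟩ := exists_nullMono_approx_pow (c₂ := c₂) hc₁ hΦ' 4 hδ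
  refine ⟨b, fun ν β hβ => ?_⟩
  have hmc : Continuous fun ω : Sph => mink β (nullVec ω) :=
    continuous_mink.comp (by fun_prop : Continuous fun ω : Sph => (β, nullVec ω))
  -- Differentiation under the integral; `∂_ν (βn)` is `eta ν * n^ν`, and raising the index cancels
  -- the sign.
  have hgrad : dUp ν Ξ β =
      ∫ ω : Sph, (nullVec (ω : E3) ν : ℂ) * Φ' ω (mink β (nullVec ω)) ∂sphMeas := by
    let p : ℝ → Sph → ℝ := fun t ω => mink β (nullVec ω) + t * (eta ν * nullVec (ω : E3) ν)
    have h1 := hasDerivAt_integral_of_compact (μ := sphMeas) isCompact_univ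
      (F := fun t (ω : Sph) => Φ ω (p t ω))
      (F' := fun t (ω : Sph) => ((eta ν * nullVec (ω : E3) ν : ℝ) : ℂ) * Φ' ω (p t ω))
      (fun t => hΦ.comp (g := Function.uncurry Φ) (f := fun ω => (ω, p t ω))
        (by simp only [p]; fun_prop))
      (Continuous.mul (by fun_prop) (hΦ'.comp (g := Function.uncurry Φ')
        (f := fun z : ℝ × Sph => (z.2, p z.1 z.2)) (by simp only [p]; fun_prop)))
      (fun t ω => by
        have h2 : HasDerivAt (fun t => p t ω) (eta ν * nullVec (ω : E3) ν) t := by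
          simpa [p] using ((hasDerivAt_id t).mul_const (eta ν * nullVec (ω : E3) ν)).const_add
            (mink β (nullVec (ω : E3)))
        have h3 := (hΦd ω (p t ω)).scomp t h2
        exact h3.congr_deriv (by simp))
      (fun t x hx => absurd (Set.mem_univ x) hx) 0
    have h4 : HasDerivAt (fun t : ℝ => β + t • e ν) (e ν) 0 := by
      simpa using ((hasDerivAt_id (0 : ℝ)).smul_const (e ν)).const_add β
    have h5 : (fun t : ℝ => Ξ (β + t • e ν)) =ᶠ[𝓝 0]
        fun t => ∫ ω : Sph, Φ ω (p t ω) ∂sphMeas := by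
      have : ∀ᶠ t : ℝ in 𝓝 0, β + t • e ν ∈ U :=
        h4.continuousAt.eventually_mem (by simpa using hU.mem_nhds (hBU hβ))
      filter_upwards [this] with t ht
      rw [hrep _ ht]
      simp only [p, mink_add_smul, mink_e]
    have h6 : DifferentiableAt ℝ Ξ (β + (0 : ℝ) • e ν) := by
      simpa using (hΞ.smooth.contDiffAt (isOpen_forwardCone.mem_nhds (hBV hβ))).differentiableAt
        (by simp)
    have h7 := (h6.hasFDerivAt.comp_hasDerivAt (0 : ℝ) h4).unique (h1.congr_of_eventuallyEq h5)
    simp only [zero_smul, add_zero] at h7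
    rw [dUp, dLow, h7, ← integral_const_mul]
    refine integral_congr_ae (Eventually.of_forall fun ω => ?_)
    have h8 : (eta ν : ℂ) * eta ν = 1 := by exact_mod_cast eta_mul_eta ν
    simp only [p, zero_mul, add_zero]
    push_cast
    linear_combination (nullVec (ω : E3) ν * Φ' ω (mink β (nullVec ω))) * h8
  have hi1 : Integrable (fun ω : Sph => (nullVec (ω : E3) ν : ℂ) * Φ' ω (mink β (nullVec ω)))
      sphMeas := by
    refine integrable_sphere_of_continuous (Continuous.mul (by fun_prop)
      (hΦ'.comp (g := Function.uncurry Φ') (f := fun ω : Sph => (ω, mink β (nullVec ω))) ?_))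
    exact continuous_id.prodMk hmc
  have hi2 : ∀ l : EvenList, Integrable (fun ω : Sph => b l * ((nullMono (ν :: 0 :: l.1) ω : ℂ) *
      ((mink β (nullVec ω) : ℂ)⁻¹) ^ ((ν :: 0 :: l.1).length + 2))) sphMeas := fun l =>
    (integrable_sphere_of_continuous
      (continuous_coneFn_integrand _ _ (hBV hβ))).const_mul _
  simp only [coneFn, Finsupp.sum, ← integral_const_mul]
  rw [hgrad, ← integral_finsetSum _ fun l _ => hi2 l,
    ← integral_sub hi1 (integrable_finsetSum _ fun l _ => hi2 l)]
  refine (norm_integral_le_of_norm_le_const (Eventually.of_forall fun ω => ?_)).trans_lt hδε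
  have h1 : (nullVec (ω : E3) ν : ℂ) * Φ' ω (mink β (nullVec ω)) - ∑ l ∈ b.support, b l *
      ((nullMono (ν :: 0 :: l.1) ω : ℂ) * ((mink β (nullVec ω) : ℂ)⁻¹) ^ ((ν :: 0 :: l.1).length + 2))
      = (nullVec (ω : E3) ν : ℂ) * (Φ' ω (mink β (nullVec ω)) - b.sum fun l a => a *
        ((nullMono l.1 ω : ℂ) * ((mink β (nullVec ω) : ℂ)⁻¹) ^ (l.1.length + 4))) := by
    rw [mul_sub, Finsupp.sum, Finset.mul_sum]
    congr 1
    refine Finset.sum_congr rfl fun l _ => ?_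
    simp only [nullMono_cons, nullVec_zero, List.length_cons]
    push_cast
    ring
  rw [h1, norm_mul, Complex.norm_real, Real.norm_eq_abs]
  calc _ ≤ 1 * δ := mul_le_mul (abs_nullVec_le ω ν) (hb ω _ (hc β hβ ω)).le (norm_nonneg _)
        zero_le_one
    _ = δ := one_mul δ

/-! ### Oscillatory integrals over momentum space -/

/-- The monomial `q^{μ₁} ⋯ q^{μₘ}`. -/
def qMono (l : List (Fin 4)) (q : Mink) : ℝ := (l.map fun ν => q ν).prod

@[simp] lemma qMono_nil (q : Mink) : qMono [] q = 1 := rfl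

@[simp] lemma qMono_cons (ν : Fin 4) (l : List (Fin 4)) (q : Mink) :
    qMono (ν :: l) q = q ν * qMono l q := rfl

@[fun_prop]
lemma continuous_qMono (l : List (Fin 4)) : Continuous (qMono l) := by
  induction l with
  | nil => exact continuous_const
  | cons ν l ih =>
    change Continuous fun q => q ν * qMono l q
    fun_prop

lemma abs_qMono_le (l : List (Fin 4)) (q : Mink) : |qMono l q| ≤ ‖q‖ ^ l.length := by
  induction l with
  | nil => simp
  | cons ν l ih =>
    rw [qMono_cons, abs_mul, List.length_cons, pow_succ']
    have := PiLp.norm_apply_le q ν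
    exact mul_le_mul (by simpa using this) ih (abs_nonneg _) (norm_nonneg _)

lemma qMono_smul (l : List (Fin 4)) (r : ℝ) (q : Mink) :
    qMono l (r • q) = r ^ l.length * qMono l q := by
  induction l with
  | nil => simp
  | cons ν l ih =>
    rw [qMono_cons, ih, qMono_cons, List.length_cons]
    simp
    ring

/-- The Lorentz product as a bilinear map. -/
def minkL : Mink →L[ℝ] Mink →L[ℝ] ℝ :=
  ∑ ν, (EuclideanSpace.proj ν : Mink →L[ℝ] ℝ).smulRight
    (eta ν • (EuclideanSpace.proj ν : Mink →L[ℝ] ℝ))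

lemma minkL_apply (x y : Mink) : minkL x y = mink x y := by
  simp only [minkL, mink, sum_apply]
  refine Finset.sum_congr rfl fun ν _ => ?_
  simp
  ring

lemma mink_comm (x y : Mink) : mink x y = mink y x := by
  simp only [mink, mul_comm]

/-- The integral of `q^l e^{i s ζ q}` over momentum space. -/
def osc (s : ℝ) (l : List (Fin 4)) (M : Measure Mink) (ζ : Mink) : ℂ :=
  ∫ q, Complex.exp ((s * mink ζ q : ℝ) * Complex.I) * (qMono l q : ℂ) ∂M

/-- All moments of the measure are finite. -/
def HasMoments (M : Measure Mink) : Prop := ∀ n : ℕ, Integrable (fun q => ‖q‖ ^ n) M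

lemma HasMoments.integrable_qMono {M : Measure Mink} (hM : HasMoments M) (l : List (Fin 4)) :
    Integrable (fun q => (qMono l q : ℂ)) M := by
  refine (hM l.length).mono' (by fun_prop) (Eventually.of_forall fun q => ?_)
  rw [Complex.norm_real]
  exact abs_qMono_le l q

lemma HasMoments.integrable_norm_pow_qMono {M : Measure Mink} (hM : HasMoments M) (n : ℕ)
    (l : List (Fin 4)) : Integrable (fun q => ‖q‖ ^ n * ‖(qMono l q : ℂ)‖) M := by
  refine (hM (n + l.length)).mono' (by fun_prop) (Eventually.of_forall fun q => ?_)
  rw [norm_mul, norm_pow, norm_norm, norm_norm, Complex.norm_real, pow_add]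
  exact mul_le_mul_of_nonneg_left (abs_qMono_le l q) (by positivity)

-- In this form smoothness follows from the finite moments by the general theory of Fourier
-- integrals. The factor in the bilinear form converts between `e^{isζq}` and the convention
-- `e^{-2πi(·)}`.
open scoped FourierTransform in
lemma osc_eq_fourierIntegral (s : ℝ) (l : List (Fin 4)) (M : Measure Mink) :
    osc s l M = VectorFourier.fourierIntegral 𝐞 M
      ((-(s / (2 * Real.pi))) • minkL).toLinearMap₁₂ (fun q => (qMono l q : ℂ)) := by
  ext ζ
  simp only [osc, VectorFourier.fourierIntegral]
  refine integral_congr_ae (Eventually.of_forall fun q => ?_)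
  simp only [Circle.smul_def, Real.fourierChar_apply, smul_eq_mul]
  congr 4
  change s * mink ζ q = 2 * Real.pi * (-((-(s / (2 * Real.pi))) • minkL q ζ))
  rw [minkL_apply, mink_comm q, smul_eq_mul]
  field_simp

lemma contDiff_osc {M : Measure Mink} (hM : HasMoments M) (s : ℝ) (l : List (Fin 4)) :
    ContDiff ℝ (⊤ : ℕ∞) (osc s l M) := by
  rw [osc_eq_fourierIntegral]
  exact VectorFourier.contDiff_fourierIntegral _ fun n _ => hM.integrable_norm_pow_qMono n l

/-- Two factors `eta ν` arise, one from differentiating the Lorentz product and one from raising the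
index. They cancel, so each derivative brings down `s i` times the contravariant component `q^ν`. -/
lemma dUp_osc {M : Measure Mink} (hM : HasMoments M) (s : ℝ) (l : List (Fin 4)) (ν : Fin 4) :
    dUp ν (osc s l M) = fun ζ => (s * Complex.I) * osc s (ν :: l) M ζ := by
  ext ζ
  let F : ℝ → Mink → ℂ := fun t q =>
    Complex.exp ((s * mink (ζ + t • e ν) q : ℝ) * Complex.I) * (qMono l q : ℂ)
  let F' : ℝ → Mink → ℂ := fun t q => (s * (eta ν * q ν) * Complex.I) * F t q
  have hmink : ∀ x, Continuous fun q => mink x q := fun x =>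
    continuous_mink.comp (by fun_prop : Continuous fun q : Mink => (x, q))
  have hFc : ∀ t, Continuous (F t) := fun t => by
    have := hmink (ζ + t • e ν)
    simp only [F]; fun_prop
  have hFn : ∀ t q, ‖F t q‖ ≤ ‖q‖ ^ l.length := fun t q => by
    simp only [F, norm_mul, Complex.norm_exp_ofReal_mul_I, one_mul, Complex.norm_real]
    exact abs_qMono_le l q
  have hη : |eta ν| = 1 := by unfold eta; split_ifs <;> simp
  have hF'n : ∀ t q, ‖F' t q‖ ≤ |s| * ‖q‖ ^ (l.length + 1) := fun t q => by
    simp only [F', norm_mul, Complex.norm_I, Complex.norm_real, Real.norm_eq_abs, hη, one_mul,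
      mul_one]
    rw [pow_succ', mul_assoc]
    have := PiLp.norm_apply_le q ν
    exact mul_le_mul_of_nonneg_left (mul_le_mul (by simpa using this) (hFn t q) (norm_nonneg _)
      (norm_nonneg _)) (abs_nonneg s)
  have h1 := (hasDerivAt_integral_of_dominated_loc_of_deriv_le (μ := M) (F := F) (F' := F')
    (x₀ := (0 : ℝ)) (s := Set.univ) (bound := fun q => |s| * ‖q‖ ^ (l.length + 1)) univ_mem
    (Eventually.of_forall fun t => (hFc t).aestronglyMeasurable)
    ((hM l.length).mono' (hFc 0).aestronglyMeasurable (Eventually.of_forall (hFn 0)))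
    (by have := hFc 0
        exact Continuous.aestronglyMeasurable (by simp only [F']; fun_prop))
    (Eventually.of_forall fun q t _ => hF'n t q) ((hM _).const_mul _)
    (Eventually.of_forall fun q t _ => by
      have h2 : HasDerivAt (fun t : ℝ => s * mink (ζ + t • e ν) q) (s * (eta ν * q ν)) t := by
        simp only [mink_add_smul, mink_e]
        simpa using (((hasDerivAt_id t).mul_const (eta ν * q ν)).const_add (mink ζ q)).const_mul s
      have h3 := ((h2.ofReal_comp.mul_const Complex.I).cexp).mul_const (qMono l q : ℂ)
      refine h3.congr_deriv ?_
      simp only [F', F]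
      push_cast
      ring)).2
  have h4 : HasDerivAt (fun t : ℝ => ζ + t • e ν) (e ν) 0 := by
    simpa using ((hasDerivAt_id (0 : ℝ)).smul_const (e ν)).const_add ζ
  have hD : HasFDerivAt (osc s l M) (fderiv ℝ (osc s l M) (ζ + (0 : ℝ) • e ν))
      (ζ + (0 : ℝ) • e ν) := ((contDiff_osc hM s l).differentiable (by simp) _).hasFDerivAt
  have h5 : HasDerivAt (fun t : ℝ => osc s l M (ζ + t • e ν))
      (fderiv ℝ (osc s l M) (ζ + (0 : ℝ) • e ν) (e ν)) 0 := by
    have := HasFDerivAt.comp_hasDerivAt (l := osc s l M) (f := fun t : ℝ => ζ + t • e ν)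
      (0 : ℝ) hD h4
    exact this
  replace h5 := h5.unique h1
  simp only [zero_smul, add_zero] at h5
  rw [dUp, dLow, h5, osc, ← integral_const_mul, ← integral_const_mul]
  refine integral_congr_ae (Eventually.of_forall fun q => ?_)
  have h8 : (eta ν : ℂ) * eta ν = 1 := by exact_mod_cast eta_mul_eta ν
  simp only [F', F, zero_smul, add_zero, qMono_cons]
  push_cast
  linear_combination (s * Complex.I * (q ν) * qMono l q *
    Complex.exp ((s * mink ζ q : ℂ) * Complex.I)) * h8

lemma dUp_add {F G : Mink → ℂ} (hF : Differentiable ℝ F) (hG : Differentiable ℝ G) (ν : Fin 4) :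
    dUp ν (fun x => F x + G x) = fun x => dUp ν F x + dUp ν G x := by
  ext x
  simp only [dUp, dLow]
  rw [fderiv_fun_add (hF x) (hG x)]
  simp [mul_add]

lemma dUp_const_mul {F : Mink → ℂ} (hF : Differentiable ℝ F) (c : ℂ) (ν : Fin 4) :
    dUp ν (fun x => c * F x) = fun x => c * dUp ν F x := by
  ext x
  simp only [dUp, dLow]
  rw [((hF x).hasFDerivAt.const_mul c).fderiv]
  simp
  ring

/-- All derivatives of the positive and negative frequency parts of an oscillatory integral. -/
lemma dUpList_osc {M : Measure Mink} (hM : HasMoments M) (s : ℝ) (c : ℂ) (l : List (Fin 4)) :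
    dUpList l (fun ζ => c * (osc s [] M ζ + osc (-s) [] M ζ)) = fun ζ =>
      c * ((s * Complex.I) ^ l.length * osc s l M ζ
        + (-s * Complex.I) ^ l.length * osc (-s) l M ζ) := by
  have hd : ∀ s l, Differentiable ℝ (osc s l M) := fun s l =>
    (contDiff_osc hM s l).differentiable (by simp)
  induction l with
  | nil => simp [dUpList]
  | cons ν l ih =>
    rw [dUpList, ih, dUp_const_mul
        (Differentiable.fun_add ((hd _ _).const_mul _) ((hd _ _).const_mul _)),
      dUp_add ((hd _ _).const_mul _) ((hd _ _).const_mul _), dUp_const_mul (hd _ _),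
      dUp_const_mul (hd _ _), dUp_osc hM, dUp_osc hM]
    ext ζ
    rw [List.length_cons]
    push_cast
    ring

/-! ### The thermal momentum distribution -/

/-- The point of the forward light cone with spatial momentum `p`. -/
def nullMom (p : E3) : Mink := ‖p‖ • e 0 + spEmb p

@[fun_prop]
lemma continuous_nullMom : Continuous nullMom := by unfold nullMom; fun_prop

@[simp] lemma nullMom_zero : nullMom 0 = 0 := by simp [nullMom]

lemma nullMom_smul {r : ℝ} (hr : 0 ≤ r) (ω : Sph) : nullMom (r • (ω : E3)) = r • nullVec ω := by
  simp [nullMom, nullVec, norm_smul, abs_of_nonneg hr]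

lemma fourMom_norm (p : E3) : fourMom ‖p‖ p = nullMom p := fourMom_eq _ _

lemma fourMom_neg_norm (p : E3) : fourMom (-‖p‖) p = -nullMom (-p) := by
  simp [fourMom_eq, nullMom, add_comm]

lemma mink_neg_right (x y : Mink) : mink x (-y) = -mink x y := by
  rw [mink_eq, mink_eq]; simp; ring

lemma mink_smul_right (x y : Mink) (r : ℝ) : mink x (r • y) = r * mink x y := by
  rw [mink_eq, mink_eq]; simp [inner_smul_right]; ring

lemma norm_le_norm_nullMom (p : E3) : ‖p‖ ≤ ‖nullMom p‖ := by
  have := PiLp.norm_apply_le (nullMom p) 0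
  simpa [nullMom] using this

lemma norm_spEmb (p : E3) : ‖spEmb p‖ = ‖p‖ := by
  rw [EuclideanSpace.norm_eq, EuclideanSpace.norm_eq]
  simp [Fin.sum_univ_three, Fin.sum_univ_four]

lemma norm_nullMom_le (p : E3) : ‖nullMom p‖ ≤ 2 * ‖p‖ := by
  refine (norm_add_le _ _).trans ?_
  rw [norm_spEmb, norm_smul, norm_norm]
  simp [e]
  linarith

/-- By homogeneity it suffices to consider the null vectors `(1, ω)`, where a positive continuous
function on a compact set is bounded below. Uniformity in `β` gives exponential decay of the Bose
factor uniformly on `B`. -/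
lemma exists_mink_nullMom_bound {B : Set Cone} (hB : IsCompact B) :
    ∃ c : ℝ, 0 < c ∧ ∀ β ∈ B, ∀ p : E3, c * ‖p‖ ≤ mink β.1 (nullMom p) := by
  obtain ⟨c, _, hc, h⟩ := exists_mink_nullVec_bounds (hB.image continuous_subtype_val)
    (by rintro _ ⟨β, -, rfl⟩; exact β.2)
  refine ⟨c, hc, fun β hβ p => ?_⟩
  rcases eq_or_ne p 0 with rfl | hp
  · rw [nullMom_zero, mink_eq]; simp
  · have hp' : 0 < ‖p‖ := norm_pos_iff.2 hp
    have h1 := (h β.1 ⟨β, hβ, rfl⟩ ⟨‖p‖⁻¹ • p, by simp [norm_smul, hp'.ne']⟩).1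
    have h2 := nullMom_smul hp'.le ⟨‖p‖⁻¹ • p, by simp [norm_smul, hp'.ne']⟩
    simp only [smul_smul, mul_inv_cancel₀ hp'.ne', one_smul] at h2
    rw [h2, mink_smul_right, mul_comm]
    exact mul_le_mul_of_nonneg_left h1 hp'.le

lemma mink_nullMom_pos (β : Cone) {p : E3} (hp : p ≠ 0) : 0 < mink β.1 (nullMom p) := by
  obtain ⟨c, hc, h⟩ := exists_mink_nullMom_bound (isCompact_singleton (x := β))
  have := norm_pos_iff.2 hp
  exact lt_of_lt_of_le (by positivity) (h β rfl p)

/-- The Bose factor `1 / (e^{βp} - 1)` on the forward light cone. -/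
def bose (β : Cone) (p : E3) : ℝ := (Real.exp (mink β.1 (nullMom p)) - 1)⁻¹

/-- The density of the thermal two-point function with respect to `d³𝐩`. -/
def thermDensity (z : Cone × E3) : ℝ := bose z.1 z.2 / ‖z.2‖

lemma measurable_thermDensity : Measurable thermDensity := by
  have : Continuous fun z : Cone × E3 => mink z.1.1 (nullMom z.2) :=
    continuous_mink.comp (by fun_prop : Continuous fun z : Cone × E3 => (z.1.1, nullMom z.2))
  have := this.measurable
  unfold thermDensity bose
  fun_prop

lemma bose_nonneg (β : Cone) (p : E3) : 0 ≤ bose β p := by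
  rcases eq_or_ne p 0 with rfl | hp
  · rw [bose, nullMom_zero, mink_eq]; simp
  · exact inv_nonneg.2 (sub_nonneg.2 (Real.one_le_exp (mink_nullMom_pos β hp).le))

lemma thermDensity_nonneg (z : Cone × E3) : 0 ≤ thermDensity z :=
  div_nonneg (bose_nonneg _ _) (norm_nonneg _)

/-- With `E = e^{x/2} ≥ 1 + x/2` one has `(x/2) E ≤ (E - 1) E ≤ E² - 1`. The bound has both the
`1/x` singularity at the origin and exponential decay at infinity. -/
lemma inv_exp_sub_one_le {x : ℝ} (hx : 0 < x) :
    (Real.exp x - 1)⁻¹ ≤ 2 * x⁻¹ * Real.exp (-(x / 2)) := by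
  have h1 := Real.add_one_le_exp (x / 2)
  have h2 : Real.exp x = Real.exp (x / 2) * Real.exp (x / 2) := by rw [← Real.exp_add]; ring_nf
  have h3 : 0 < x / 2 * Real.exp (x / 2) := by positivity
  have h4 : x / 2 * Real.exp (x / 2) ≤ Real.exp x - 1 := by rw [h2]; nlinarith
  refine (inv_anti₀ h3 h4).trans (le_of_eq ?_)
  rw [Real.exp_neg]
  field_simp

lemma bose_le {c : ℝ} (hc : 0 < c) {β : Cone} (h : ∀ p : E3, c * ‖p‖ ≤ mink β.1 (nullMom p))
    (p : E3) : bose β p ≤ 2 * (c * ‖p‖)⁻¹ * Real.exp (-(c * ‖p‖ / 2)) := by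
  rcases eq_or_ne p 0 with rfl | hp
  · rw [bose, nullMom_zero, mink_eq]; simp
  · have h1 : 0 < c * ‖p‖ := mul_pos hc (norm_pos_iff.2 hp)
    have h2 : 0 < Real.exp (c * ‖p‖) - 1 := by
      have := Real.add_one_lt_exp h1.ne'; linarith
    refine le_trans (inv_anti₀ h2 ?_) (inv_exp_sub_one_le h1)
    have := Real.exp_le_exp.2 (h p)
    linarith

/-- The singularity `‖p‖⁻²`, produced by the Bose factor together with the invariant measure `d³𝐩 /
‖p‖`, is cancelled by the volume element `r²` of three dimensions. -/
lemma integrable_pow_exp_norm (n : ℕ) {c : ℝ} (hc : 0 < c) :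
    Integrable (fun p : E3 => ‖p‖ ^ n * (‖p‖⁻¹ ^ 2 * Real.exp (-(c * ‖p‖)))) := by
  rw [integrable_fun_norm_addHaar (volume : Measure E3)
    (f := fun r => r ^ n * (r⁻¹ ^ 2 * Real.exp (-(c * r))))]
  have h1 := integrableOn_rpow_mul_exp_neg_mul_rpow (p := 1) (s := n) (b := c)
    (lt_of_lt_of_le (by norm_num) (Nat.cast_nonneg n)) one_pos hc
  refine h1.congr_fun (fun r hr => ?_) measurableSet_Ioi
  have hr' : r ≠ 0 := ne_of_gt hr
  simp only [finrank_euclideanSpace, Fintype.card_fin, Real.rpow_one, Real.rpow_natCast,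
    smul_eq_mul]
  field_simp

/-- The bound on the Bose factor is uniform in `β ∈ B`, so a dominating function of the momentum
alone is available and the mixture `ρ`, being a probability measure, adds nothing. -/
lemma integrable_thermDensity {ρ : Measure Cone} [IsProbabilityMeasure ρ] {B : Set Cone}
    (hB : IsCompact B) (hρ : ρ Bᶜ = 0) (n : ℕ) :
    Integrable (fun z => ‖z.2‖ ^ n * thermDensity z) (ρ.prod volume) := by
  obtain ⟨c, hc, h⟩ := exists_mink_nullMom_bound hB
  have h1 := ((integrable_pow_exp_norm n (half_pos hc)).const_mul (2 * c⁻¹)).comp_snd ρ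
  refine h1.mono' ?_ ?_
  · have := measurable_thermDensity
    exact Measurable.aestronglyMeasurable (by fun_prop)
  · have hBae : ∀ᵐ β ∂ρ, β ∈ B := measure_eq_zero_iff_ae_notMem.1 hρ |>.mono fun β hβ => by
      simpa using hβ
    have : ∀ᵐ z ∂(ρ.prod (volume : Measure E3)), z.1 ∈ B :=
      (Measure.quasiMeasurePreserving_fst (μ := ρ) (ν := (volume : Measure E3))).ae hBae
    filter_upwards [this] with z hz
    rw [Real.norm_of_nonneg (mul_nonneg (by positivity) (thermDensity_nonneg z)), mul_comm (2 * c⁻¹),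
      mul_assoc]
    refine mul_le_mul_of_nonneg_left ?_ (by positivity)
    rw [thermDensity, div_eq_mul_inv]
    refine (mul_le_mul_of_nonneg_right (bose_le hc (h z.1 hz) z.2) (by positivity)).trans
      (le_of_eq ?_)
    rw [mul_inv, mul_div_right_comm]
    ring

/-- The momentum distribution of a mixture of equilibrium states, as a measure supported on the
forward light cone. -/
def thermMeas (ρ : Measure Cone) : Measure Mink :=
  ((ρ.prod volume).withDensity fun z => ENNReal.ofReal (thermDensity z)).map fun z => nullMom z.2

lemma integrable_thermMeas_iff (ρ : Measure Cone) [IsProbabilityMeasure ρ] {F : Type*}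
    [NormedAddCommGroup F] [NormedSpace ℝ F] {g : Mink → F} (hg : StronglyMeasurable g) :
    Integrable g (thermMeas ρ) ↔
      Integrable (fun z => thermDensity z • g (nullMom z.2)) (ρ.prod volume) := by
  have hm : Measurable fun z : Cone × E3 => nullMom z.2 :=
    (by fun_prop : Continuous fun z : Cone × E3 => nullMom z.2).measurable
  rw [thermMeas, integrable_map_measure hg.aestronglyMeasurable hm.aemeasurable,
    integrable_withDensity_iff_integrable_smul' measurable_thermDensity.ennreal_ofReal (by simp)]
  simp only [ENNReal.toReal_ofReal (thermDensity_nonneg _), Function.comp]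

lemma integral_thermMeas (ρ : Measure Cone) [IsProbabilityMeasure ρ] {F : Type*}
    [NormedAddCommGroup F] [NormedSpace ℝ F] {g : Mink → F} (hg : StronglyMeasurable g) :
    ∫ q, g q ∂thermMeas ρ = ∫ z, thermDensity z • g (nullMom z.2) ∂(ρ.prod volume) := by
  have hm : Measurable fun z : Cone × E3 => nullMom z.2 :=
    (by fun_prop : Continuous fun z : Cone × E3 => nullMom z.2).measurable
  rw [thermMeas, integral_map hm.aemeasurable hg.aestronglyMeasurable,
    integral_withDensity_eq_integral_toReal_smul measurable_thermDensity.ennreal_ofReal (by simp)]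
  simp only [ENNReal.toReal_ofReal (thermDensity_nonneg _)]

lemma hasMoments_thermMeas {ρ : Measure Cone} [IsProbabilityMeasure ρ] {B : Set Cone}
    (hB : IsCompact B) (hρ : ρ Bᶜ = 0) : HasMoments (thermMeas ρ) := fun n => by
  rw [integrable_thermMeas_iff ρ (by fun_prop : Continuous fun q : Mink => ‖q‖ ^ n).stronglyMeasurable]
  refine ((integrable_thermDensity hB hρ n).const_mul (2 ^ n)).mono' ?_ ?_
  · have := measurable_thermDensity
    exact Measurable.aestronglyMeasurable (by fun_prop)
  · refine Eventually.of_forall fun z => ?_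
    rw [smul_eq_mul, Real.norm_of_nonneg (mul_nonneg (thermDensity_nonneg z) (by positivity)),
      ← mul_assoc, ← mul_pow, mul_comm]
    exact mul_le_mul_of_nonneg_right (pow_le_pow_left₀ (norm_nonneg _) (norm_nullMom_le _) n)
      (thermDensity_nonneg z)

/-! ### Two-point functions of the equilibrium states -/

lemma lorentzFourier_eq_fourier (f : Test) (q : Mink) :
    lorentzFourier f q = (FourierTransform.fourier (f : Mink → ℂ) : Mink → ℂ)
      (WithLp.toLp 2 fun ν => eta ν * q ν / (2 * Real.pi)) := by
  rw [Real.fourier_eq']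
  refine integral_congr_ae (Eventually.of_forall fun x => ?_)
  simp only [smul_eq_mul]
  congr 2
  have : (-2 * Real.pi * inner ℝ x (WithLp.toLp 2 fun ν => eta ν * q ν / (2 * Real.pi)) : ℝ) =
      -mink x q := by
    simp only [PiLp.inner_apply, mink, Finset.mul_sum, ← Finset.sum_neg_distrib]
    refine Finset.sum_congr rfl fun ν _ => ?_
    simp
    field_simp
  rw [this]
  push_cast
  ring

/-- Up to signs of coordinates and a factor `2π` this is the Euclidean Fourier transform of a test
function, so it is a Schwartz function; continuity and decay follow. -/
lemma lorentzFourier_eq_schwartz (f : Test) : ∃ S : SchwartzMap Mink ℂ, ∀ q,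
    lorentzFourier f q = S (WithLp.toLp 2 fun ν => eta ν * q ν / (2 * Real.pi)) := by
  refine ⟨FourierTransform.fourier (f.hasCompactSupport.toSchwartzMap f.contDiff), fun q => ?_⟩
  rw [lorentzFourier_eq_fourier, SchwartzMap.fourier_coe]
  rfl

@[fun_prop]
lemma continuous_lorentzFourier (f : Test) : Continuous (lorentzFourier f) := by
  obtain ⟨S, hS⟩ := lorentzFourier_eq_schwartz f
  rw [show lorentzFourier f = _ from funext hS]
  have := S.continuous
  fun_prop

lemma exists_lorentzFourier_decay (f : Test) (k : ℕ) :
    ∃ C : ℝ, 0 ≤ C ∧ ∀ q, ‖q‖ ^ k * ‖lorentzFourier f q‖ ≤ C := by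
  obtain ⟨S, hS⟩ := lorentzFourier_eq_schwartz f
  obtain ⟨C, hC⟩ := S.decay k 0
  have hC' := hC.2
  refine ⟨(2 * Real.pi) ^ k * C, by have := hC.1; positivity, fun q => ?_⟩
  have h1 := hC' (WithLp.toLp 2 fun ν => eta ν * q ν / (2 * Real.pi))
  rw [norm_iteratedFDeriv_zero] at h1
  have h2 : ‖(WithLp.toLp 2 fun ν => eta ν * q ν / (2 * Real.pi) : Mink)‖ =
      ‖q‖ / (2 * Real.pi) := by
    have hη : ∀ ν, |eta ν| = 1 := fun ν => by unfold eta; split_ifs <;> simp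
    have e1 : (WithLp.toLp 2 fun ν => eta ν * q ν / (2 * Real.pi) : Mink) =
        (2 * Real.pi)⁻¹ • (WithLp.toLp 2 fun ν => eta ν * q ν : Mink) := by
      ext ν; simp; ring
    have e2 : ‖(WithLp.toLp 2 fun ν => eta ν * q ν : Mink)‖ = ‖q‖ := by
      rw [EuclideanSpace.norm_eq, EuclideanSpace.norm_eq]
      simp [hη]
    rw [e1, norm_smul, e2, Real.norm_of_nonneg (by positivity)]
    ring
  rw [h2, div_pow, ← hS] at h1
  have h3 : 0 < (2 * Real.pi) ^ k := by positivity
  calc _ = (2 * Real.pi) ^ k * (‖q‖ ^ k / (2 * Real.pi) ^ k * ‖lorentzFourier f q‖) := by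
        field_simp
    _ ≤ _ := mul_le_mul_of_nonneg_left h1 h3.le

@[fun_prop]
lemma continuous_smear (f g : Test) : Continuous (smear f g) := by unfold smear; fun_prop

lemma exists_smear_bound (f g : Test) : ∃ C : ℝ, 0 ≤ C ∧ ∀ q, ‖smear f g q‖ ≤ C ∧
    ‖q‖ ^ 4 * ‖smear f g q‖ ≤ C := by
  obtain ⟨C1, h1, h1'⟩ := exists_lorentzFourier_decay f 0
  obtain ⟨C2, h2, h2'⟩ := exists_lorentzFourier_decay f 4
  obtain ⟨C3, h3, h3'⟩ := exists_lorentzFourier_decay g 0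
  simp only [pow_zero, one_mul] at h1' h3'
  refine ⟨max (C1 * C3) (C2 * C3), le_max_of_le_left (by positivity), fun q => ⟨?_, ?_⟩⟩
  · rw [smear, norm_mul]
    exact le_max_of_le_left (mul_le_mul (h1' q) (h3' _) (norm_nonneg _) h1)
  · rw [smear, norm_mul, ← mul_assoc]
    exact le_max_of_le_right (mul_le_mul (h2' q) (h3' _) (norm_nonneg _) h2)

lemma integrable_smear_light_cone (f g : Test) :
    Integrable fun p : E3 => smear f g (nullMom p) / ((2 * ‖p‖ : ℝ) : ℂ) := by
  obtain ⟨C, hC, h⟩ := exists_smear_bound f g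
  -- Near the origin `r² / r` is harmless, and at infinity a decay of order four leaves `r⁻³`.
  have h1 : Integrable fun p : E3 => ‖p‖⁻¹ * (1 + ‖p‖ ^ 4)⁻¹ := by
    rw [integrable_fun_norm_addHaar (volume : Measure E3) (f := fun r => r⁻¹ * (1 + r ^ 4)⁻¹)]
    refine Integrable.mono' (integrable_inv_one_add_sq.const_mul 2).integrableOn
      (Measurable.aestronglyMeasurable (by fun_prop)) ?_
    refine (ae_restrict_iff' measurableSet_Ioi).2 (Eventually.of_forall fun r (hr : 0 < r) => ?_)
    simp only [finrank_euclideanSpace, Fintype.card_fin, smul_eq_mul]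
    have : r ^ (3 - 1) * (r⁻¹ * (1 + r ^ 4)⁻¹) = r / (1 + r ^ 4) := by
      norm_num
      field_simp
    rw [Real.norm_of_nonneg (by positivity), this, show 2 * (1 + r ^ 2)⁻¹ = 2 / (1 + r ^ 2) from rfl,
      div_le_div_iff₀ (by positivity) (by positivity)]
    nlinarith [sq_nonneg (r - 1), sq_nonneg (r ^ 2 - r), sq_nonneg (r^2 - 1)]
  refine (h1.const_mul (2 * C)).mono' ?_ (Eventually.of_forall fun p => ?_)
  · have h2 : Continuous fun p : E3 => smear f g (nullMom p) := by fun_prop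
    have := h2.measurable
    exact Measurable.aestronglyMeasurable (by fun_prop)
  · rw [norm_div, Complex.norm_real, Real.norm_of_nonneg (by positivity)]
    rcases eq_or_ne p 0 with rfl | hp
    · simp
    have hp' := norm_pos_iff.2 hp
    have h4 : (1 + ‖p‖ ^ 4) * ‖smear f g (nullMom p)‖ ≤ 2 * C := by
      have h5 := h (nullMom p)
      have h6 := mul_le_mul_of_nonneg_right
        (pow_le_pow_left₀ (norm_nonneg p) (norm_le_norm_nullMom p) 4)
        (norm_nonneg (smear f g (nullMom p)))
      linarith [h5.1, h5.2]
    rw [div_le_iff₀ (by positivity)]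
    have e1 : 2 * C * (‖p‖⁻¹ * (1 + ‖p‖ ^ 4)⁻¹) * (2 * ‖p‖) = 2 * (2 * C) / (1 + ‖p‖ ^ 4) := by
      field_simp
    rw [e1, le_div_iff₀ (by positivity)]
    nlinarith [norm_nonneg (smear f g (nullMom p))]

lemma integrable_thermDensity_mul {ρ : Measure Cone} [IsProbabilityMeasure ρ] {B : Set Cone}
    (hB : IsCompact B) (hρ : ρ Bᶜ = 0) {G : Mink → ℂ} (hG : Continuous G) {C : ℝ}
    (hC : ∀ q, ‖G q‖ ≤ C) :
    Integrable (fun z : Cone × E3 => (thermDensity z : ℂ) * G (nullMom z.2)) (ρ.prod volume) := by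
  refine ((integrable_thermDensity hB hρ 0).const_mul C).mono' ?_ (Eventually.of_forall fun z => ?_)
  · have := measurable_thermDensity
    have h2 : Continuous fun z : Cone × E3 => G (nullMom z.2) := by fun_prop
    have := h2.measurable
    exact Measurable.aestronglyMeasurable (by fun_prop)
  · rw [norm_mul, Complex.norm_real, Real.norm_of_nonneg (thermDensity_nonneg z), pow_zero, one_mul,
      mul_comm]
    exact mul_le_mul_of_nonneg_right (hC _) (thermDensity_nonneg z)

/-- The normalization `(2π)⁻³` of the two-point functions. -/
def kap : ℂ := ((2 * Real.pi : ℝ) : ℂ)⁻¹ ^ 3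

lemma kap_ne_zero : kap ≠ 0 := by
  have : (2 * Real.pi : ℝ) ≠ 0 := by positivity
  exact pow_ne_zero _ (inv_ne_zero (by exact_mod_cast this))

lemma integrable_thermDensity_mul_single (β : Cone) {G : Mink → ℂ} (hG : Continuous G) {C : ℝ}
    (hC : ∀ q, ‖G q‖ ≤ C) :
    Integrable fun p : E3 => (thermDensity (β, p) : ℂ) * G (nullMom p) := by
  have h := integrable_thermDensity_mul (ρ := Measure.dirac β) (isCompact_singleton (x := β))
    (by simp) hG hC
  rw [Measure.dirac_prod] at h
  exact (integrable_map_measure h.aestronglyMeasurable (by fun_prop)).1 h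

/-- The two-point function of an equilibrium state, relative to that of the vacuum. -/
lemma kmsForm_eq (β : Cone) (f g : Test) :
    kmsForm β f g = vacuumForm f g + kap / 2 * ∫ p : E3, (thermDensity (β, p) : ℂ) *
      (smear f g (nullMom p) + smear f g (-nullMom p)) := by
  obtain ⟨C, hC, h⟩ := exists_smear_bound f g
  have i1 := integrable_smear_light_cone f g
  have i2 := (integrable_thermDensity_mul_single β (continuous_smear f g) fun q => (h q).1).const_mul
    ((1 : ℂ) / 2)
  have i3 := (integrable_thermDensity_mul_single β (G := fun q => smear f g (-q)) (by fun_prop)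
    fun q => (h (-q)).1).const_mul ((1 : ℂ) / 2)
  have hvac : vacuumForm f g = kap * ∫ p : E3, smear f g (nullMom p) / ((2 * ‖p‖ : ℝ) : ℂ) := by
    rw [vacuumForm, lightConeIntegral, kap]
    congr 1
    refine integral_congr_ae (Eventually.of_forall fun p => ?_)
    rcases eq_or_ne p 0 with rfl | hp
    · simp
    have hp' := norm_pos_iff.2 hp
    have e1 : 0 < nullMom p 0 := fourMom_norm p ▸ hp'
    have e2 : fourMom (-‖p‖) p 0 = -‖p‖ := rfl
    have e3 : ¬ 0 < -‖p‖ := by linarith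
    simp only [e1, e2, e3, if_true, if_false, sub_zero, fourMom_norm]
  -- For `x > 0` one has `1/(1 - e^{-x}) = 1 + 1/(e^x - 1)` and `1/(1 - e^x) = -1/(e^x - 1)`. The
  -- positive sheet of the cone thus contributes the vacuum part and a Bose part; on the negative
  -- sheet the minus sign is absorbed by `ε(p₀)` and only a Bose part remains. The point of the
  -- negative sheet above `p` is `-nullMom (-p)`.
  have hkms : kmsForm β f g = kap * ∫ p : E3, (smear f g (nullMom p) / ((2 * ‖p‖ : ℝ) : ℂ) +
      1 / 2 * ((thermDensity (β, p) : ℂ) * smear f g (nullMom p)) +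
      1 / 2 * ((thermDensity (β, -p) : ℂ) * smear f g (-nullMom (-p)))) := by
    rw [kmsForm, lightConeIntegral, kap]
    congr 1
    refine integral_congr_ae (Eventually.of_forall fun p => ?_)
    rcases eq_or_ne p 0 with rfl | hp
    · simp [thermDensity]
    have hp' : (‖p‖ : ℂ) ≠ 0 := by exact_mod_cast (norm_pos_iff.2 hp).ne'
    have h1 := mink_nullMom_pos β hp
    have h2 := mink_nullMom_pos β (neg_ne_zero.2 hp)
    have e1 : (1 - Real.exp (-mink β.1 (nullMom p)))⁻¹ = 1 + bose β p := by
      rw [bose, Real.exp_neg]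
      have h3 := Real.add_one_lt_exp h1.ne'
      have h4 : Real.exp (mink β.1 (nullMom p)) - 1 ≠ 0 := by linarith
      have h5 : Real.exp (mink β.1 (nullMom p)) ≠ 0 := by positivity
      field_simp
      ring
    have e2 : (1 - Real.exp (-mink β.1 (-nullMom (-p))))⁻¹ = - bose β (-p) := by
      rw [bose, mink_neg_right, neg_neg, ← inv_neg, neg_sub]
    simp only [fourMom_norm, fourMom_neg_norm, ← Complex.ofReal_inv, e1, e2, thermDensity, norm_neg]
    push_cast
    field_simp
    ring
  have hflip : ∫ p : E3, (1 : ℂ) / 2 * ((thermDensity (β, -p) : ℂ) * smear f g (-nullMom (-p))) =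
      ∫ p : E3, (1 : ℂ) / 2 * ((thermDensity (β, p) : ℂ) * smear f g (-nullMom p)) :=
    integral_neg_eq_self (fun p : E3 =>
      (1 : ℂ) / 2 * ((thermDensity (β, p) : ℂ) * smear f g (-nullMom p))) volume
  have i3' := i3.comp_neg
  have i12 : Integrable fun p : E3 => smear f g (nullMom p) / ((2 * ‖p‖ : ℝ) : ℂ) +
      1 / 2 * ((thermDensity (β, p) : ℂ) * smear f g (nullMom p)) := i1.add i2
  rw [hkms, integral_add i12 i3', integral_add i1 i2, hflip, hvac, mul_add, mul_add,
    add_assoc, ← mul_add, ← integral_add i2 i3, div_mul_eq_mul_div, mul_div_assoc,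
    ← integral_div]
  congr 3
  ext p
  ring

lemma kms_nil (β : Cone) : kms β [] = 1 := by simp [kms, wick]

lemma kms_singleton (β : Cone) (f : Test) : kms β [f] = 0 := by simp [kms, wick]

lemma kms_pair (β : Cone) (f g : Test) : kms β [f, g] = kmsForm β f g := by simp [kms, wick]

lemma integrable_smear_thermMeas {ρ : Measure Cone} [IsProbabilityMeasure ρ] {B : Set Cone}
    (hB : IsCompact B) (hρ : ρ Bᶜ = 0) {G : Mink → ℂ} (hG : Continuous G) {C : ℝ}
    (hC : ∀ q, ‖G q‖ ≤ C) :
    ∫ β, (∫ p : E3, (thermDensity (β, p) : ℂ) * G (nullMom p)) ∂ρ = ∫ q, G q ∂thermMeas ρ := by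
  rw [integral_thermMeas ρ hG.stronglyMeasurable, integral_prod]
  · rfl
  · exact integrable_thermDensity_mul hB hρ hG hC

/-- The two-point function of a mixture of equilibrium states, relative to that of the vacuum. -/
lemma integral_kmsForm {ρ : Measure Cone} [IsProbabilityMeasure ρ] {B : Set Cone}
    (hB : IsCompact B) (hρ : ρ Bᶜ = 0) (f g : Test) :
    ∫ β, kmsForm β f g ∂ρ = vacuumForm f g +
      kap / 2 * ∫ q, (smear f g q + smear f g (-q)) ∂thermMeas ρ := by
  obtain ⟨C, hC, h⟩ := exists_smear_bound f g
  have hG : Continuous fun q => smear f g q + smear f g (-q) := by fun_prop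
  have hb : ∀ q, ‖smear f g q + smear f g (-q)‖ ≤ C + C := fun q =>
    (norm_add_le _ _).trans (add_le_add (h q).1 (h (-q)).1)
  simp only [kmsForm_eq]
  rw [integral_add (integrable_const _)
    ((integrable_thermDensity_mul hB hρ hG hb).integral_prod_left.const_mul _), integral_const_mul,
    integrable_smear_thermMeas hB hρ hG hb]
  simp

/-- The normal ordered two-point function of a mixture of equilibrium states. -/
def thermKernel (ρ : Measure Cone) (z : Mink × Mink) : ℂ :=
  kap / 2 * (osc 1 [] (thermMeas ρ) (z.1 - z.2) + osc (-1) [] (thermMeas ρ) (z.1 - z.2))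

lemma smear_eq_integral (f g : Test) (q : Mink) :
    smear f g q = ∫ z : Mink × Mink, f z.1 * g z.2 *
      Complex.exp (((-1 : ℝ) * mink (z.1 - z.2) q : ℝ) * Complex.I) := by
  rw [smear, lorentzFourier, lorentzFourier, ← integral_prod_mul]
  refine integral_congr_ae (Eventually.of_forall fun z => ?_)
  have h1 : mink (z.1 - z.2) q = mink z.1 q - mink z.2 q := by
    rw [mink_eq, mink_eq, mink_eq, map_sub, inner_sub_left]
    simp
    ring
  have h2 : Complex.exp (((-1 : ℝ) * mink (z.1 - z.2) q : ℝ) * Complex.I) =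
      Complex.exp (-(Complex.I * (mink z.1 q : ℂ))) *
        Complex.exp (-(Complex.I * (mink z.2 (-q) : ℂ))) := by
    rw [← Complex.exp_add, h1, mink_neg_right]
    congr 1
    push_cast
    ring
  simp only [h2]
  ring

lemma integral_smear_osc {M : Measure Mink} [IsFiniteMeasure M] (f g : Test) (s : ℝ) :
    ∫ q, (∫ z : Mink × Mink, f z.1 * g z.2 *
      Complex.exp ((s * mink (z.1 - z.2) q : ℝ) * Complex.I)) ∂M =
      ∫ z : Mink × Mink, f z.1 * g z.2 * osc s [] M (z.1 - z.2) := by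
  have hfg : Integrable fun z : Mink × Mink => f z.1 * g z.2 :=
    (f.continuous.integrable_of_hasCompactSupport f.hasCompactSupport).mul_prod
      (g.continuous.integrable_of_hasCompactSupport g.hasCompactSupport)
  rw [integral_integral_swap]
  · simp only [osc, qMono_nil, Complex.ofReal_one, mul_one, integral_const_mul]
  · refine (hfg.comp_snd M).mono ?_ (Eventually.of_forall fun x => ?_)
    · have := f.continuous
      have := g.continuous
      have h1 : Continuous fun x : Mink × (Mink × Mink) => mink (x.2.1 - x.2.2) x.1 :=
        continuous_mink.comp (by fun_prop : Continuous fun x : Mink × (Mink × Mink) =>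
          (x.2.1 - x.2.2, x.1))
      exact Continuous.aestronglyMeasurable (by simp only [Function.uncurry_def]; fun_prop)
    · simp only [Function.uncurry_def, norm_mul, Complex.norm_exp_ofReal_mul_I, mul_one, le_refl]

lemma HasMoments.isFiniteMeasure {M : Measure Mink} (hM : HasMoments M) : IsFiniteMeasure M := by
  have := hM 0
  simp only [pow_zero] at this
  exact (integrable_const_iff_isFiniteMeasure one_ne_zero).1 this

lemma integrable_mul_osc {M : Measure Mink} (hM : HasMoments M) (f g : Test) (s : ℝ) :
    Integrable fun z : Mink × Mink => f z.1 * g z.2 * osc s [] M (z.1 - z.2) := by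
  have h1 := (contDiff_osc hM s []).continuous
  have := f.continuous
  have := g.continuous
  refine Continuous.integrable_of_hasCompactSupport (by fun_prop) ?_
  refine HasCompactSupport.intro (f.hasCompactSupport.isCompact.prod g.hasCompactSupport.isCompact)
    fun z hz => ?_
  rw [Set.mem_prod, not_and_or] at hz
  rcases hz with hz | hz
  · simp [image_eq_zero_of_notMem_tsupport hz]
  · simp [image_eq_zero_of_notMem_tsupport hz]

/-- The kernel of the normal ordered two-point function. -/
lemma integral_kmsForm_eq_kernel {ρ : Measure Cone} [IsProbabilityMeasure ρ] {B : Set Cone}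
    (hB : IsCompact B) (hρ : ρ Bᶜ = 0) (f g : Test) :
    ∫ β, kmsForm β f g ∂ρ - vacuumForm f g =
      ∫ z : Mink × Mink, f z.1 * g z.2 * thermKernel ρ z := by
  have hM := hasMoments_thermMeas hB hρ
  have := hM.isFiniteMeasure
  obtain ⟨C, hC, h⟩ := exists_smear_bound f g
  have i1 : Integrable (fun q => smear f g q) (thermMeas ρ) :=
    Integrable.of_bound (by fun_prop) C (Eventually.of_forall fun q => (h q).1)
  have i2 : Integrable (fun q => smear f g (-q)) (thermMeas ρ) :=
    Integrable.of_bound (Continuous.aestronglyMeasurable (by fun_prop)) C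
      (Eventually.of_forall fun q => (h (-q)).1)
  have e1 : ∀ q, smear f g (-q) = ∫ z : Mink × Mink, f z.1 * g z.2 *
      Complex.exp (((1 : ℝ) * mink (z.1 - z.2) q : ℝ) * Complex.I) := fun q => by
    rw [smear_eq_integral]
    simp only [mink_neg_right]
    congr! 6
    ring
  rw [integral_kmsForm hB hρ, add_sub_cancel_left, integral_add i1 i2]
  simp only [e1]
  simp only [smear_eq_integral]
  rw [integral_smear_osc, integral_smear_osc, ← integral_add (integrable_mul_osc hM f g _)
    (integrable_mul_osc hM f g _), ← integral_const_mul]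
  refine integral_congr_ae (Eventually.of_forall fun z => ?_)
  simp only [thermKernel]
  ring

/-! ### Local observables in the equilibrium states -/

/-- The Bose integrals `∫ r^(m+1) / (e^r - 1) dr`. -/
def boseIntegral (m : ℕ) : ℝ := ∫ r in Set.Ioi (0 : ℝ), r ^ (m + 1) * (Real.exp r - 1)⁻¹

/-- Positivity matters because these integrals are divided by when a given `coneFn` is realised as a
thermal function. -/
lemma boseIntegral_pos (m : ℕ) : 0 < boseIntegral m := by
  have hpos : ∀ r ∈ Set.Ioi (0 : ℝ), 0 < r ^ (m + 1) * (Real.exp r - 1)⁻¹ := fun r hr => by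
    have hr' : 0 < r := hr
    have := Real.add_one_lt_exp hr'.ne'
    have h2 : 0 < Real.exp r - 1 := by linarith
    positivity
  have h0 : 0 ≤ᵐ[volume.restrict (Set.Ioi (0 : ℝ))]
      fun r : ℝ => r ^ (m + 1) * (Real.exp r - 1)⁻¹ :=
    (ae_restrict_iff' measurableSet_Ioi).2 (Eventually.of_forall fun r hr => (hpos r hr).le)
  have hint : IntegrableOn (fun r : ℝ => r ^ (m + 1) * (Real.exp r - 1)⁻¹) (Set.Ioi 0) := by
    have h1 := integrableOn_rpow_mul_exp_neg_mul_rpow (p := 1) (s := m) (b := 1 / 2)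
      (lt_of_lt_of_le (by norm_num) (Nat.cast_nonneg m)) one_pos (by norm_num)
    refine (h1.const_mul 2).mono' (Measurable.aestronglyMeasurable (by fun_prop)) ?_
    refine (ae_restrict_iff' measurableSet_Ioi).2 (Eventually.of_forall fun r (hr : 0 < r) => ?_)
    rw [Real.norm_of_nonneg (hpos r hr).le]
    refine (mul_le_mul_of_nonneg_left (inv_exp_sub_one_le hr) (by positivity)).trans (le_of_eq ?_)
    rw [Real.rpow_one, Real.rpow_natCast, pow_succ, show -(1 / 2) * r = -(r / 2) by ring]
    field_simp
  rw [boseIntegral, setIntegral_pos_iff_support_of_nonneg_ae h0 hint]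
  have : Set.Ioi (0 : ℝ) ⊆ Function.support (fun r : ℝ => r ^ (m + 1) * (Real.exp r - 1)⁻¹) ∩
      Set.Ioi 0 := fun r hr => ⟨(hpos r hr).ne', hr⟩
  exact lt_of_lt_of_le (by simp) (measure_mono this)

/-- The substitution `r ↦ r / z` extracts all dependence on `z`; with `z = βn` this is the origin of
the inverse powers in `coneFn`. -/
lemma integral_bose_ray (m : ℕ) {z : ℝ} (hz : 0 < z) :
    ∫ r in Set.Ioi (0 : ℝ), r ^ (m + 1) * (Real.exp (r * z) - 1)⁻¹ =
      boseIntegral m * z⁻¹ ^ (m + 2) := by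
  have h := integral_comp_mul_left_Ioi (fun r : ℝ => r ^ (m + 1) * (Real.exp r - 1)⁻¹) 0 hz
  rw [mul_zero] at h
  change _ = z⁻¹ • boseIntegral m at h
  have h2 : ∀ r : ℝ, r ^ (m + 1) * (Real.exp (r * z) - 1)⁻¹ =
      z⁻¹ ^ (m + 1) * ((z * r) ^ (m + 1) * (Real.exp (z * r) - 1)⁻¹) := fun r => by
    rw [mul_comm r z, mul_pow, ← mul_assoc, ← mul_assoc, ← mul_pow, inv_mul_cancel₀ hz.ne', one_pow,
      one_mul]
  simp only [h2]
  rw [integral_const_mul, h, smul_eq_mul]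
  ring

lemma mink_nullMom_self (p : E3) : mink (nullMom p) (nullMom p) = 0 := by
  rw [mink_eq]
  simp [nullMom, sq]

lemma integral_thermMeas_dirac (β : Cone) {g : Mink → ℂ} (hg : StronglyMeasurable g) :
    ∫ q, g q ∂thermMeas (Measure.dirac β) = ∫ p : E3, thermDensity (β, p) • g (nullMom p) := by
  have h2 : Measurable fun z : Cone × E3 => nullMom z.2 :=
    (by fun_prop : Continuous fun z : Cone × E3 => nullMom z.2).measurable
  have h1 : StronglyMeasurable fun z : Cone × E3 => thermDensity z • g (nullMom z.2) :=
    measurable_thermDensity.stronglyMeasurable.smul (hg.comp_measurable h2)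
  rw [integral_thermMeas _ hg, Measure.dirac_prod, integral_map (by fun_prop)
    h1.aestronglyMeasurable]

lemma integrable_thermMeas_dirac (β : Cone) {g : Mink → ℂ} (hg : StronglyMeasurable g)
    (h : Integrable g (thermMeas (Measure.dirac β))) :
    Integrable fun p : E3 => thermDensity (β, p) • g (nullMom p) := by
  rw [integrable_thermMeas_iff _ hg, Measure.dirac_prod] at h
  exact (integrable_map_measure h.aestronglyMeasurable (by fun_prop)).1 h

lemma hasMoments_thermMeas_dirac (β : Cone) : HasMoments (thermMeas (Measure.dirac β)) :=
  hasMoments_thermMeas (isCompact_singleton (x := β)) (by simp)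

/-- Polar coordinates `q = r n`: the monomial gives `r ^ m`, the volume element `r ^ 2` and the
density `1 / r`, so the radial integral is a Bose integral with power `m + 1`. -/
lemma integral_qMono_thermMeas_dirac (β : Cone) (l : List (Fin 4)) :
    ∫ q, (qMono l q : ℂ) ∂thermMeas (Measure.dirac β) = boseIntegral l.length * coneFn l β.1 := by
  have hc : StronglyMeasurable fun q => (qMono l q : ℂ) :=
    (by fun_prop : Continuous fun q => (qMono l q : ℂ)).stronglyMeasurable
  rw [integral_thermMeas_dirac β hc, integral_polar (integrable_thermMeas_dirac β hc
    ((hasMoments_thermMeas_dirac β).integrable_qMono l)), coneFn, ← integral_const_mul]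
  refine integral_congr_ae (Eventually.of_forall fun ω => ?_)
  have h1 : ∀ r ∈ Set.Ioi (0 : ℝ), ((r ^ 2 : ℝ) : ℂ) * (thermDensity (β, r • (ω : E3)) •
      (qMono l (nullMom (r • (ω : E3))) : ℂ)) = ((r ^ (l.length + 1) *
        (Real.exp (r * mink β.1 (nullVec ω)) - 1)⁻¹ : ℝ) : ℂ) * (nullMono l ω : ℂ) := by
    intro r (hr : 0 < r)
    have h2 : ‖r • (ω : E3)‖ = r := by
      rw [norm_smul, norm_eq_of_mem_sphere, mul_one, Real.norm_of_nonneg hr.le]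
    simp only [thermDensity, bose, h2, nullMom_smul hr.le, qMono_smul, mink_smul_right]
    rw [show nullMono l ω = qMono l (nullVec ω) from rfl, Complex.real_smul]
    push_cast
    have : (r : ℂ) ≠ 0 := by exact_mod_cast hr.ne'
    field_simp
    ring
  simp only
  rw [setIntegral_congr_fun measurableSet_Ioi h1, integral_mul_const, integral_complex_ofReal,
    integral_bose_ray _ (mink_nullVec_pos β.2 ω)]
  push_cast
  ring

/-- The numerical factor in the expectation values of the balanced derivatives. -/
def thermCoef (m : ℕ) : ℂ := kap / 2 * ((2 * Complex.I) ^ m + (-2 * Complex.I) ^ m)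

/-- The expectation value of `θ^l` in a mixture of equilibrium states. -/
def thermVal (ρ : Measure Cone) (l : List (Fin 4)) : ℂ :=
  thermCoef l.length * ∫ q, (qMono l q : ℂ) ∂thermMeas ρ

/-- The positive and negative frequency parts contribute `(2i)^m` and `(-2i)^m`, which agree for
even `m` and cancel for odd `m`. -/
lemma thermCoef_ne_zero {m : ℕ} (hm : Even m) : thermCoef m ≠ 0 := by
  rw [thermCoef, neg_mul, hm.neg_pow, ← two_mul]
  have := kap_ne_zero
  simp [this, Complex.I_ne_zero]

lemma thermVal_dirac (β : Cone) (l : List (Fin 4)) :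
    thermVal (Measure.dirac β) l = thermCoef l.length * boseIntegral l.length * coneFn l β.1 := by
  rw [thermVal, integral_qMono_thermMeas_dirac, mul_assoc]

section Mixtures

variable {ρ : Measure Cone} [IsProbabilityMeasure ρ] {B : Set Cone}

lemma integrable_thermVal_dirac (hB : IsCompact B) (hρ : ρ Bᶜ = 0) (l : List (Fin 4)) :
    Integrable (fun β => thermVal (Measure.dirac β) l) ρ := by
  have hc : StronglyMeasurable fun q => (qMono l q : ℂ) :=
    (by fun_prop : Continuous fun q => (qMono l q : ℂ)).stronglyMeasurable
  simp only [thermVal, integral_thermMeas_dirac _ hc]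
  exact ((integrable_thermMeas_iff ρ hc).1 ((hasMoments_thermMeas hB hρ).integrable_qMono l)
    ).integral_prod_left.const_mul _

lemma integral_thermVal_dirac (hB : IsCompact B) (hρ : ρ Bᶜ = 0) (l : List (Fin 4)) :
    ∫ β, thermVal (Measure.dirac β) l ∂ρ = thermVal ρ l := by
  have hc : StronglyMeasurable fun q => (qMono l q : ℂ) :=
    (by fun_prop : Continuous fun q => (qMono l q : ℂ)).stronglyMeasurable
  simp only [thermVal, integral_thermMeas_dirac _ hc]
  rw [integral_const_mul, integral_thermMeas ρ hc, integral_prod]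
  exact (integrable_thermMeas_iff ρ hc).1 ((hasMoments_thermMeas hB hρ).integrable_qMono l)

/-- The momenta of the massless field are light-like. -/
lemma sum_eta_thermVal (hB : IsCompact B) (hρ : ρ Bᶜ = 0) (l : List (Fin 4)) :
    ∑ ν, (eta ν : ℂ) * thermVal ρ (ν :: ν :: l) = 0 := by
  have hM := hasMoments_thermMeas hB hρ
  have h1 : ∀ q, ∑ ν, (eta ν : ℂ) * (qMono (ν :: ν :: l) q : ℂ) =
      ((mink q q * qMono l q : ℝ) : ℂ) := fun q => by
    rw [mink, Finset.sum_mul]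
    push_cast [qMono_cons]
    exact Finset.sum_congr rfl fun ν _ => by ring
  have h2 : ∫ q, ((mink q q * qMono l q : ℝ) : ℂ) ∂thermMeas ρ = 0 := by
    have : Continuous fun q => mink q q :=
      continuous_mink.comp (by fun_prop : Continuous fun q : Mink => (q, q))
    rw [integral_thermMeas ρ (by fun_prop : Continuous fun q =>
      ((mink q q * qMono l q : ℝ) : ℂ)).stronglyMeasurable]
    simp [mink_nullMom_self]
  simp only [← h1] at h2
  rw [integral_finsetSum _ fun ν _ => (hM.integrable_qMono _).const_mul _] at h2
  simp only [thermVal, List.length_cons]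
  rw [← mul_zero (thermCoef (l.length + 1 + 1)), ← h2, Finset.mul_sum]
  refine Finset.sum_congr rfl fun ν _ => ?_
  rw [integral_const_mul]
  ring

end Mixtures

/-- The expectation values of the local observables in a mixture of equilibrium states. -/
def thermExp (ρ : Measure Cone) : LocalField → Mink → ℂ
  | .one, _ => 1
  | .field, _ => 0
  | .theta l, _ => thermVal ρ l

/-- The kernel depends on the difference `(x + ζ) - (x - ζ) = 2ζ` only; hence the frequencies `±2`
and the independence of `x`. -/
lemma balanced_thermKernel {ρ : Measure Cone} (hM : HasMoments (thermMeas ρ)) (l : List (Fin 4))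
    (x ζ : Mink) : balanced (thermKernel ρ) l x ζ =
      kap / 2 * (((2 : ℝ) * Complex.I) ^ l.length * osc 2 l (thermMeas ρ) ζ +
        (-(2 : ℝ) * Complex.I) ^ l.length * osc (-2) l (thermMeas ρ) ζ) := by
  have h1 : (fun ζ' => thermKernel ρ (x + ζ', x - ζ')) = fun ζ' =>
      kap / 2 * (osc 2 [] (thermMeas ρ) ζ' + osc (-2) [] (thermMeas ρ) ζ') := by
    ext ζ'
    have h2 : x + ζ' - (x - ζ') = (2 : ℝ) • ζ' := by rw [two_smul]; abel
    have h3 : ∀ q, mink ((2 : ℝ) • ζ') q = 2 * mink ζ' q := fun q => by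
      rw [mink_comm, mink_smul_right, mink_comm]
    simp only [thermKernel, h2, osc, h3]
    norm_num
  rw [balanced, h1, dUpList_osc hM]

/-- The kernel of a mixture is smooth everywhere and translation invariant. So the limit is the
value at `ζ = 0`, and since nothing depends on `x`, the limit in the sense of distributions is the
same statement times a constant. -/
lemma hasLocalExpectations_mixture {ρ : Measure Cone} [IsProbabilityMeasure ρ] {B : Set Cone}
    (hB : IsCompact B) (hρ : ρ Bᶜ = 0) {w : NPoint} (hw : ∀ l, w l = ∫ β, kms β l ∂ρ)
    (O : Opens Mink) : HasLocalExpectations w O (thermExp ρ) := by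
  have hM := hasMoments_thermMeas hB hρ
  refine ⟨fun x _ => by simp [thermExp, hw, kms_nil], continuousOn_const, fun f _ => ?_,
    fun l => ?_, Set.univ, thermKernel ρ, isOpen_univ, fun _ _ => trivial, ⟨?_, fun f g _ => ?_⟩,
    fun l => ?_⟩
  · simp [thermExp, hw, kms_singleton]
  · exact locallyIntegrableOn_const _
  · have h1 := contDiff_osc hM 1 []
    have h2 := contDiff_osc hM (-1) []
    unfold thermKernel
    exact ContDiff.contDiffOn (by fun_prop)
  · simp only [hw, kms_pair]
    exact integral_kmsForm_eq_kernel hB hρ f g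
  · have h1 := (contDiff_osc hM 2 l).continuous
    have h2 := (contDiff_osc hM (-2) l).continuous
    have h0 : ∀ s, osc s l (thermMeas ρ) 0 = ∫ q, (qMono l q : ℂ) ∂thermMeas ρ := fun s => by
      have : ∀ q, mink 0 q = 0 := fun q => by rw [mink]; simp
      simp [osc, this]
    have h3 : Tendsto (fun ζ => kap / 2 * (((2 : ℝ) * Complex.I) ^ l.length *
        osc 2 l (thermMeas ρ) ζ + (-(2 : ℝ) * Complex.I) ^ l.length * osc (-2) l (thermMeas ρ) ζ))
        (𝓝[spacelike] 0) (𝓝 (thermVal ρ l)) := by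
      refine tendsto_nhdsWithin_of_tendsto_nhds ?_
      have h4 : Continuous fun ζ => kap / 2 * (((2 : ℝ) * Complex.I) ^ l.length *
        osc 2 l (thermMeas ρ) ζ + (-(2 : ℝ) * Complex.I) ^ l.length *
          osc (-2) l (thermMeas ρ) ζ) := by fun_prop
      convert h4.tendsto 0 using 2
      rw [h0, h0, thermVal, thermCoef]
      push_cast
      ring
    simp only [balanced_thermKernel hM, integral_mul_const, thermExp]
    exact ⟨fun x _ => h3, fun h => h3.const_mul _⟩

lemma kms_eq_integral_dirac (β : Cone) (l : List Test) :
    kms β l = ∫ β', kms β' l ∂Measure.dirac β := by simp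

/-! ### Uniqueness of the local expectation values -/

/-- If `F` deviates from `F a` by at most half of `‖F a‖` on the support of the weight, its weighted
mean deviates from `F a` by no more than that, and can vanish only if `F a` does. -/
lemma eq_zero_of_integral_bump {α : Type*} [TopologicalSpace α] [MeasurableSpace α]
    [OpensMeasurableSpace α] {μ : Measure α} [IsFiniteMeasureOnCompacts μ] [μ.IsOpenPosMeasure]
    {φ : α → ℝ} (hφ : Continuous φ) (hφc : HasCompactSupport φ) (hφ0 : ∀ z, 0 ≤ φ z) {a : α}
    (ha : φ a ≠ 0) {F : α → ℂ} (hF : ContinuousOn F (tsupport φ))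
    (h : ∀ z ∈ tsupport φ, ‖F a - F z‖ ≤ ‖F a‖ / 2) (h0 : ∫ z, (φ z : ℂ) * F z ∂μ = 0) :
    F a = 0 := by
  have i1 : Integrable φ μ := hφ.integrable_of_hasCompactSupport hφc
  have i2 : Integrable (fun z => (φ z : ℂ) * F z) μ := by
    rw [← integrableOn_iff_integrable_of_support_subset (s := tsupport φ)]
    · exact ContinuousOn.integrableOn_compact' hφc (isClosed_tsupport φ).measurableSet
        ((by fun_prop : Continuous fun z => (φ z : ℂ)).continuousOn.mul hF)
    · intro z hz
      by_contra hz'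
      simp [image_eq_zero_of_notMem_tsupport hz'] at hz
  have hpos : 0 < ∫ z, φ z ∂μ := hφ.integral_pos_of_hasCompactSupport_nonneg_nonzero hφc hφ0 ha
  have e1 : (∫ z, φ z ∂μ : ℝ) * F a = ∫ z, (φ z : ℂ) * (F a - F z) ∂μ := by
    simp only [mul_sub]
    have i3 : Integrable (fun z => (φ z : ℂ) * F a) μ := i1.ofReal.mul_const _
    rw [integral_sub i3 i2, h0, sub_zero, integral_mul_const,
      integral_complex_ofReal]
  have e2 : ‖∫ z, (φ z : ℂ) * (F a - F z) ∂μ‖ ≤ ∫ z, φ z * (‖F a‖ / 2) ∂μ := by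
    refine norm_integral_le_of_norm_le (i1.mul_const _) (Eventually.of_forall fun z => ?_)
    rw [norm_mul, Complex.norm_real, Real.norm_of_nonneg (hφ0 z)]
    by_cases hz : z ∈ tsupport φ
    · exact mul_le_mul_of_nonneg_left (h z hz) (hφ0 z)
    · simp [image_eq_zero_of_notMem_tsupport hz]
  rw [← e1, norm_mul, Complex.norm_real, Real.norm_of_nonneg hpos.le, integral_mul_const] at e2
  have e3 := le_of_mul_le_mul_left e2 hpos
  exact norm_eq_zero.1 (by linarith [norm_nonneg (F a)])

lemma exists_bump {a : Mink} {V : Set Mink} (hV : V ∈ 𝓝 a) :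
    ∃ (φ : Mink → ℝ) (f : Test), (∀ x, f x = φ x) ∧ Continuous φ ∧ HasCompactSupport φ ∧
      (∀ x, 0 ≤ φ x) ∧ φ a = 1 ∧ tsupport φ ⊆ V ∧ tsupport f ⊆ V := by
  obtain ⟨r, hr, hrV⟩ := Metric.nhds_basis_closedBall.mem_iff.1 hV
  let φ : ContDiffBump a := ⟨r / 2, r, by positivity, by linarith⟩
  have h2 : HasCompactSupport fun x => (φ x : ℂ) := φ.hasCompactSupport.comp_left Complex.ofReal_zero
  have hsub : tsupport (fun x => (φ x : ℂ)) ⊆ tsupport φ := tsupport_comp_subset Complex.ofReal_zero _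
  have hφ : tsupport φ ⊆ V := by rw [φ.tsupport_eq]; exact hrV
  exact ⟨φ, ⟨fun x => (φ x : ℂ), Complex.ofRealCLM.contDiff.comp φ.contDiff, h2, fun _ _ => trivial⟩,
    fun x => rfl, φ.continuous, φ.hasCompactSupport, fun x => φ.nonneg,
    φ.one_of_mem_closedBall (Metric.mem_closedBall_self (by positivity)), hφ, hsub.trans hφ⟩

lemma eq_zero_of_integral_test {U : Set Mink} (hU : IsOpen U) {F : Mink → ℂ}
    (hF : ContinuousOn F U)
    (h : ∀ f : Test, tsupport f ⊆ U → ∫ x, F x * f x = 0) {a : Mink} (ha : a ∈ U) : F a = 0 := by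
  by_contra hne
  have h1 : ∀ᶠ x in 𝓝 a, x ∈ U ∧ ‖F a - F x‖ ≤ ‖F a‖ / 2 := by
    refine (hU.eventually_mem ha).and ?_
    have h2 := (hF.continuousAt (hU.mem_nhds ha))
      (Metric.closedBall_mem_nhds (F a) (half_pos (norm_pos_iff.2 hne)))
    filter_upwards [h2] with x (hx : dist (F x) (F a) ≤ ‖F a‖ / 2)
    rw [← dist_eq_norm, dist_comm]
    exact hx
  obtain ⟨φ, f, hf, hφ, hφc, hφ0, hφa, hφV, hfV⟩ := exists_bump h1
  refine hne (eq_zero_of_integral_bump (μ := volume) hφ hφc hφ0 (by simp [hφa] : φ a ≠ 0)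
    (hF.mono fun x hx => (hφV hx).1) (fun z hz => (hφV hz).2) ?_)
  rw [← h f fun x hx => (hfV hx).1]
  simp only [hf, mul_comm]

/-- Products of two bumps concentrate near any given pair of points, so no density of tensor
products is needed. -/
lemma eq_zero_of_integral_tensor {U : Set (Mink × Mink)} (hU : IsOpen U) {F : Mink × Mink → ℂ}
    (hF : ContinuousOn F U)
    (h : ∀ f g : Test, tsupport f ×ˢ tsupport g ⊆ U → ∫ z : Mink × Mink, f z.1 * g z.2 * F z = 0)
    {a : Mink × Mink} (ha : a ∈ U) : F a = 0 := by
  by_contra hne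
  have h1 : ∀ᶠ z in 𝓝 a, z ∈ U ∧ ‖F a - F z‖ ≤ ‖F a‖ / 2 := by
    refine (hU.eventually_mem ha).and ?_
    have h2 := (hF.continuousAt (hU.mem_nhds ha))
      (Metric.closedBall_mem_nhds (F a) (half_pos (norm_pos_iff.2 hne)))
    filter_upwards [h2] with x (hx : dist (F x) (F a) ≤ ‖F a‖ / 2)
    rw [← dist_eq_norm, dist_comm]
    exact hx
  obtain ⟨V₁, hV₁, V₂, hV₂, hV⟩ := mem_nhds_prod_iff.1 h1
  obtain ⟨φ, f, hf, hφ, hφc, hφ0, hφa, hφV, hfV⟩ := exists_bump hV₁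
  obtain ⟨χ, g, hg, hχ, hχc, hχ0, hχa, hχV, hgV⟩ := exists_bump hV₂
  have hsub : tsupport (fun z : Mink × Mink => φ z.1 * χ z.2) ⊆ tsupport φ ×ˢ tsupport χ := by
    refine closure_minimal (fun z hz => ?_) ((isClosed_tsupport φ).prod (isClosed_tsupport χ))
    rw [Function.mem_support, mul_ne_zero_iff] at hz
    exact ⟨subset_tsupport φ hz.1, subset_tsupport χ hz.2⟩
  have hsub' := hsub.trans (Set.prod_mono hφV hχV)
  refine hne (eq_zero_of_integral_bump (μ := volume) (φ := fun z => φ z.1 * χ z.2) (by fun_prop)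
    ((hφc.isCompact.prod hχc.isCompact).of_isClosed_subset (isClosed_tsupport _) hsub)
    (fun z => mul_nonneg (hφ0 _) (hχ0 _)) (by simp [hφa, hχa])
    (hF.mono fun x hx => (hV (hsub' hx)).1) (fun z hz => (hV (hsub' hz)).2) ?_)
  rw [← h f g fun x hx => (hV (Set.prod_mono hfV hgV hx)).1]
  simp [hf, hg]

lemma isOpen_spacelike : IsOpen spacelike := by
  have : Continuous fun ζ => mink ζ ζ :=
    continuous_mink.comp (by fun_prop : Continuous fun ζ : Mink => (ζ, ζ))
  exact isOpen_lt this continuous_const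

lemma isOpen_spacelikePairs : IsOpen spacelikePairs :=
  isOpen_spacelike.preimage (by fun_prop : Continuous fun z : Mink × Mink => z.1 - z.2)

lemma mem_spacelikePairs_iff (x ζ : Mink) :
    (x + ζ, x - ζ) ∈ spacelikePairs ↔ ζ ∈ spacelike := by
  have h1 : x + ζ - (x - ζ) = (2 : ℝ) • ζ := by rw [two_smul]; abel
  simp only [spacelikePairs, spacelike, Set.mem_ofPred_eq, h1, mink_smul_right]
  rw [mink_comm, mink_smul_right]
  constructor <;> intro h <;> linarith

/-- The origin is the limit of the space-like vectors `t e₁`, `t > 0`; without this, limits along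
space-like `ζ` would not be unique. -/
instance : (𝓝[spacelike] (0 : Mink)).NeBot := by
  rw [← mem_closure_iff_nhdsWithin_neBot]
  have h1 : Tendsto (fun t : ℝ => t • e 1) (𝓝[>] 0) (𝓝 0) := by
    have : Continuous fun t : ℝ => t • e 1 := by fun_prop
    simpa using (this.tendsto 0).mono_left nhdsWithin_le_nhds
  refine mem_closure_of_tendsto h1 ?_
  filter_upwards [self_mem_nhdsWithin] with t (ht : 0 < t)
  simp only [spacelike, Set.mem_ofPred_eq, mink_smul_right]
  rw [mink_comm, mink_smul_right]
  have : mink (e 1) (e 1) = -1 := by rw [mink_e]; simp [e, eta]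
  rw [this]
  nlinarith

lemma dUpList_congr {F G : Mink → ℂ} {x : Mink} (h : F =ᶠ[𝓝 x] G) (l : List (Fin 4)) :
    dUpList l F =ᶠ[𝓝 x] dUpList l G := by
  induction l with
  | nil => exact h
  | cons ν l ih =>
    filter_upwards [ih.eventuallyEq_nhds] with y hy
    simp only [dUpList, dUp, dLow, hy.fderiv_eq]

lemma balanced_congr {K₁ K₂ : Mink × Mink → ℂ} {U : Set (Mink × Mink)} (hU : IsOpen U)
    (h : ∀ z ∈ U, K₁ z = K₂ z) (l : List (Fin 4)) {x ζ : Mink} (hz : (x + ζ, x - ζ) ∈ U) :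
    balanced K₁ l x ζ = balanced K₂ l x ζ := by
  have h1 : Continuous fun ζ' : Mink => (x + ζ', x - ζ') := by fun_prop
  refine (dUpList_congr ?_ l).eq_of_nhds
  filter_upwards [(hU.preimage h1).mem_nhds hz] with ζ' hζ' using h _ hζ'

lemma eventually_mem_pair {N : Set (Mink × Mink)} (hN : IsOpen N) {x : Mink} (hx : (x, x) ∈ N) :
    ∀ᶠ ζ in 𝓝[spacelike] 0, (x + ζ, x - ζ) ∈ N ∩ spacelikePairs := by
  have h1 : Continuous fun ζ' : Mink => (x + ζ', x - ζ') := by fun_prop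
  have h2 : ∀ᶠ ζ in 𝓝 (0 : Mink), (x + ζ, x - ζ) ∈ N :=
    (hN.preimage h1).mem_nhds (by simpa using hx)
  filter_upwards [nhdsWithin_le_nhds h2, self_mem_nhdsWithin] with ζ h3 h4
  exact ⟨h3, (mem_spacelikePairs_iff x ζ).2 h4⟩

lemma tensor_integrable {K : Mink × Mink → ℂ} {U : Set (Mink × Mink)} (hK : ContinuousOn K U)
    (f g : Test) (hfg : tsupport f ×ˢ tsupport g ⊆ U) :
    Integrable fun z : Mink × Mink => f z.1 * g z.2 * K z := by
  rw [← integrableOn_iff_integrable_of_support_subset (s := tsupport f ×ˢ tsupport g)]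
  · have hc := f.hasCompactSupport.isCompact.prod g.hasCompactSupport.isCompact
    have := f.continuous
    have := g.continuous
    exact ContinuousOn.integrableOn_compact' hc hc.measurableSet
      ((by fun_prop : Continuous fun z : Mink × Mink => f z.1 * g z.2).continuousOn.mul
        (hK.mono hfg))
  · intro z hz
    simp only [Function.mem_support, mul_ne_zero_iff] at hz
    exact ⟨subset_tsupport _ hz.1.1, subset_tsupport _ hz.1.2⟩

/-- Two admissible kernels agree where both represent the same distribution, namely at space-like
pairs in `N₁ ∩ N₂`. This set is open and contains `(x + ζ, x - ζ)` for all small space-like `ζ`, so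
the derivatives agree there as well. Consequently `localExp` does not depend on the choice in its
definition. -/
lemma HasLocalExpectations.unique {w : NPoint} {O : Opens Mink} {E₁ E₂ : LocalField → Mink → ℂ}
    (h₁ : HasLocalExpectations w O E₁) (h₂ : HasLocalExpectations w O E₂) (ψ : LocalField)
    {x : Mink} (hx : x ∈ O) : E₁ ψ x = E₂ ψ x := by
  cases ψ with
  | one => rw [h₁.one x hx, h₂.one x hx]
  | field =>
    refine sub_eq_zero.1 (eq_zero_of_integral_test O.isOpen
      (h₁.field_continuous.sub h₂.field_continuous) (fun f hf => ?_) hx)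
    have hi : ∀ E, HasLocalExpectations w O E → Integrable fun x => E .field x * f x := fun E hE => by
      rw [← integrableOn_iff_integrable_of_support_subset (s := tsupport f)]
      · exact ContinuousOn.integrableOn_compact' f.hasCompactSupport
          (isClosed_tsupport f).measurableSet
          ((hE.field_continuous.mono hf).mul f.continuous.continuousOn)
      · exact fun z hz => subset_tsupport _ (right_ne_zero_of_mul hz)
    simp only [Pi.sub_apply, sub_mul]
    rw [integral_sub (hi _ h₁) (hi _ h₂), ← h₁.field_represents f hf, ← h₂.field_represents f hf,
      sub_self]
  | theta l =>
    obtain ⟨N₁, K₁, hN₁, hO₁, hK₁, hl₁⟩ := h₁.theta_limit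
    obtain ⟨N₂, K₂, hN₂, hO₂, hK₂, hl₂⟩ := h₂.theta_limit
    have hU : IsOpen ((N₁ ∩ N₂) ∩ spacelikePairs) := (hN₁.inter hN₂).inter isOpen_spacelikePairs
    have hs₁ : (N₁ ∩ N₂) ∩ spacelikePairs ⊆ N₁ ∩ spacelikePairs := fun z hz => ⟨hz.1.1, hz.2⟩
    have hs₂ : (N₁ ∩ N₂) ∩ spacelikePairs ⊆ N₂ ∩ spacelikePairs := fun z hz => ⟨hz.1.2, hz.2⟩
    have hc₁ := hK₁.smooth.continuousOn.mono hs₁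
    have hc₂ := hK₂.smooth.continuousOn.mono hs₂
    have heq : ∀ z ∈ (N₁ ∩ N₂) ∩ spacelikePairs, K₁ z = K₂ z := fun z hz => by
      refine sub_eq_zero.1 (eq_zero_of_integral_tensor hU (hc₁.sub hc₂) (fun f g hfg => ?_) hz)
      simp only [Pi.sub_apply, mul_sub]
      rw [integral_sub (tensor_integrable hc₁ f g hfg) (tensor_integrable hc₂ f g hfg),
        ← hK₁.represents f g (hfg.trans hs₁), ← hK₂.represents f g (hfg.trans hs₂), sub_self]
    refine tendsto_nhds_unique ((hl₁ l).1 x hx) (((hl₂ l).1 x hx).congr' ?_)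
    filter_upwards [eventually_mem_pair (hN₁.inter hN₂) (⟨hO₁ x hx, hO₂ x hx⟩ : (x, x) ∈ N₁ ∩ N₂)]
      with ζ hζ
    exact (balanced_congr hU heq l hζ).symm

lemma HasLocalExpectations.localExp_eq {w : NPoint} {O : Opens Mink} {E : LocalField → Mink → ℂ}
    (h : HasLocalExpectations w O E) (ψ : LocalField) {x : Mink} (hx : x ∈ O) :
    localExp w O ψ x = E ψ x := by
  have h' : ∃ E, HasLocalExpectations w O E := ⟨E, h⟩
  rw [localExp, dif_pos h']
  exact h'.choose_spec.unique h ψ hx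

lemma hasLocalExpectations_localExp {w : NPoint} {O : Opens Mink}
    (h : ∃ E, HasLocalExpectations w O E) : HasLocalExpectations w O (localExp w O) := by
  have h1 : localExp w O = h.choose := by
    ext ψ x
    rw [localExp, dif_pos h]
  exact h1 ▸ h.choose_spec

lemma thermalFn_eq (ψ : LocalField) (β : Cone) :
    thermalFn ψ β = thermExp (Measure.dirac β) ψ 0 :=
  (hasLocalExpectations_mixture (isCompact_singleton (x := β)) (by simp)
    (kms_eq_integral_dirac β) ⊤).localExp_eq ψ trivial

lemma integrable_thermalFn {ρ : Measure Cone} [IsProbabilityMeasure ρ] {B : Set Cone}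
    (hB : IsCompact B) (hρ : ρ Bᶜ = 0) (ψ : LocalField) : Integrable (thermalFn ψ) ρ := by
  rw [show thermalFn ψ = _ from funext (thermalFn_eq ψ)]
  cases ψ with
  | one => exact integrable_const _
  | field => exact integrable_zero _ _ _
  | theta l => exact integrable_thermVal_dirac hB hρ l

lemma integral_thermalFn {ρ : Measure Cone} [IsProbabilityMeasure ρ] {B : Set Cone}
    (hB : IsCompact B) (hρ : ρ Bᶜ = 0) (ψ : LocalField) (x : Mink) :
    ∫ β, thermalFn ψ β ∂ρ = thermExp ρ ψ x := by
  rw [show thermalFn ψ = _ from funext (thermalFn_eq ψ)]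
  cases ψ with
  | one => simp [thermExp]
  | field => simp [thermExp]
  | theta l => exact integral_thermVal_dirac hB hρ l

/-- Local observables have the same expectation values in a thermal state as in some mixture of
equilibrium states; on compact sets, the temperature supports are contained in a compact set. -/
lemma IsThermal.exists_mixture {w : NPoint} {O : Opens Mink} (h : IsThermal w O) {C : Set Mink}
    (hC : IsCompact C) (hCO : C ⊆ O) : ∃ B : Set Cone, IsCompact B ∧ ∀ x ∈ C,
      ∃ ρ : Measure Cone, IsProbabilityMeasure ρ ∧ ρ Bᶜ = 0 ∧
        ∀ ψ, localExp w O ψ x = thermExp ρ ψ x := by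
  obtain ⟨r, hr, -, hr'⟩ := h.reference
  obtain ⟨B, hB, hBr⟩ := hr C hC hCO
  refine ⟨B, hB, fun x hx => ?_⟩
  obtain ⟨ρ, hρ, hρB, hw⟩ := hBr x hx
  refine ⟨ρ, hρ, hρB, fun ψ => ?_⟩
  rw [hr' x (hCO hx) ψ]
  exact (hasLocalExpectations_mixture hB hρB hw ⊤).localExp_eq ψ trivial

open scoped ContDiff

/-! ### Directional derivatives and integration by parts -/

lemma integrable_mul_of_tsupport {V : Type*} [NormedAddCommGroup V] [MeasurableSpace V]
    [BorelSpace V] {μ : Measure V} [IsFiniteMeasureOnCompacts μ] {Φ G : V → ℂ} {U : Set V} (hΦ : Continuous Φ)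
    (hc : HasCompactSupport Φ) (hs : tsupport Φ ⊆ U) (hG : ContinuousOn G U) :
    Integrable (fun z => Φ z * G z) μ := by
  rw [← integrableOn_iff_integrable_of_support_subset (s := tsupport Φ)]
  · exact ContinuousOn.integrableOn_compact' hc (isClosed_tsupport _).measurableSet
      (hΦ.continuousOn.mul (hG.mono hs))
  · exact fun z hz => subset_tsupport _ (left_ne_zero_of_mul hz)

section DirectionalDerivative

variable {V : Type*} [NormedAddCommGroup V] [NormedSpace ℝ V]

/-- The derivative of `G` in the direction `v`. -/
def dDir (v : V) (G : V → ℂ) : V → ℂ := fun z => fderiv ℝ G z v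

lemma contDiffOn_dDir {G : V → ℂ} {U : Set V} (hU : IsOpen U) (hG : ContDiffOn ℝ ∞ G U) (v : V) :
    ContDiffOn ℝ ∞ (dDir v G) U :=
  (hG.fderiv_of_isOpen hU (m := ∞) (by simp)).clm_apply contDiffOn_const

lemma dDir_congr {G₁ G₂ : V → ℂ} {U : Set V} (hU : IsOpen U) (h : ∀ z ∈ U, G₁ z = G₂ z) (v : V) :
    ∀ z ∈ U, dDir v G₁ z = dDir v G₂ z := fun z hz => by
  have : G₁ =ᶠ[𝓝 z] G₂ := Filter.mem_of_superset (hU.mem_nhds hz) h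
  simp only [dDir, this.fderiv_eq]

lemma dDir_const_mul {G : V → ℂ} {z : V} (hG : DifferentiableAt ℝ G z) (c : ℂ) (v : V) :
    dDir v (fun y => c * G y) z = c * dDir v G z := by
  simp only [dDir]
  rw [fderiv_const_mul hG]
  simp

lemma dDir_sum {ι : Type*} [Fintype ι] {G : ι → V → ℂ} {z : V}
    (hG : ∀ i, DifferentiableAt ℝ (G i) z) (v : V) :
    dDir v (fun y => ∑ i, G i y) z = ∑ i, dDir v (G i) z := by
  simp only [dDir]
  rw [fderiv_fun_sum fun i _ => hG i]
  simp

lemma dDir_dDir {G : V → ℂ} {U : Set V} (hU : IsOpen U) (hG : ContDiffOn ℝ ∞ G U) (u v : V) {z : V}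
    (hz : z ∈ U) : dDir u (dDir v G) z = fderiv ℝ (fderiv ℝ G) z u v :=
  (fderiv_fderiv_apply ((hG.contDiffAt (hU.mem_nhds hz)).of_le two_le_top) u v).symm

lemma dDir_comm {G : V → ℂ} {U : Set V} (hU : IsOpen U) (hG : ContDiffOn ℝ ∞ G U) (u v : V) {z : V}
    (hz : z ∈ U) : dDir u (dDir v G) z = dDir v (dDir u G) z := by
  rw [dDir_dDir hU hG u v hz, dDir_dDir hU hG v u hz]
  exact ((hG.contDiffAt (hU.mem_nhds hz)).isSymmSndFDerivAt (by simpa using two_le_top)).eq u v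

/-- Derivatives of solutions of an equation of second order with constant coefficients are again
solutions. -/
lemma sum_dDir_dDir_dDir_eq_zero {ι : Type*} [Fintype ι] {G : V → ℂ} {U : Set V} (hU : IsOpen U)
    (hG : ContDiffOn ℝ ∞ G U) (c : ι → ℂ) (v : ι → V)
    (h : ∀ z ∈ U, ∑ i, c i * dDir (v i) (dDir (v i) G) z = 0) (u : V) :
    ∀ z ∈ U, ∑ i, c i * dDir (v i) (dDir (v i) (dDir u G)) z = 0 := by
  intro z hz
  have hd : ∀ i, DifferentiableAt ℝ (dDir (v i) (dDir (v i) G)) z := fun i =>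
    ((contDiffOn_dDir hU (contDiffOn_dDir hU hG _) _).contDiffAt (hU.mem_nhds hz)).differentiableAt (by simp)
  have h1 := dDir_congr hU h u z hz
  rw [dDir_sum fun i => (hd i).const_mul _] at h1
  rw [show dDir u (fun _ : V => (0 : ℂ)) z = 0 by simp [dDir]] at h1
  rw [← h1]
  refine Finset.sum_congr rfl fun i _ => ?_
  rw [dDir_const_mul (hd i), dDir_comm hU (contDiffOn_dDir hU hG _) u (v i) hz]
  congr 1
  exact dDir_congr hU (fun y hy => dDir_comm hU hG (v i) u hy) (v i) z hz

lemma tsupport_dDir_subset (v : V) (Φ : V → ℂ) : tsupport (dDir v Φ) ⊆ tsupport Φ :=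
  tsupport_fderiv_apply_subset ℝ v

variable [MeasurableSpace V] [BorelSpace V] [FiniteDimensional ℝ V] {μ : Measure V}
  [μ.IsAddHaarMeasure]

/-- Integration by parts against a function of compact support. -/
lemma integral_dDir_mul {Φ G : V → ℂ} {U : Set V} (hU : IsOpen U) (hΦ : ContDiff ℝ ∞ Φ)
    (hc : HasCompactSupport Φ) (hs : tsupport Φ ⊆ U) (hG : ContDiffOn ℝ ∞ G U) (v : V) :
    ∫ z, dDir v Φ z * G z ∂μ = -∫ z, Φ z * dDir v G z ∂μ := by
  have hd : ContDiff ℝ ∞ (dDir v Φ) := contDiffOn_univ.1 (contDiffOn_dDir isOpen_univ hΦ.contDiffOn v)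
  have hdc : HasCompactSupport (dDir v Φ) :=
    hc.of_isClosed_subset (isClosed_tsupport _) (tsupport_dDir_subset v Φ)
  have i1 := integrable_mul_of_tsupport (μ := μ) hΦ.continuous hc hs (contDiffOn_dDir hU hG v).continuousOn
  have i2 := integrable_mul_of_tsupport (μ := μ) hd.continuous hdc
    ((tsupport_dDir_subset v Φ).trans hs) hG.continuousOn
  have i3 := integrable_mul_of_tsupport (μ := μ) hΦ.continuous hc hs hG.continuousOn
  have h := integral_mul_fderiv_eq_neg_fderiv_mul_of_integrable (μ := μ) (f := G) (g := Φ) (v := v)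
    (i1.congr (Eventually.of_forall fun z => mul_comm _ _))
    (i2.congr (Eventually.of_forall fun z => mul_comm _ _))
    (i3.congr (Eventually.of_forall fun z => mul_comm _ _))
    (fun x hx => (hG.contDiffAt (hU.mem_nhds (hs hx))).differentiableAt (by simp))
    (fun x _ => hΦ.contDiffAt.differentiableAt (by simp))
  simp only [dDir, mul_comm _ (G _), mul_comm (Φ _)]
  exact h

lemma integral_dDir_dDir_mul {Φ G : V → ℂ} {U : Set V} (hU : IsOpen U) (hΦ : ContDiff ℝ ∞ Φ)
    (hc : HasCompactSupport Φ) (hs : tsupport Φ ⊆ U) (hG : ContDiffOn ℝ ∞ G U) (v : V) :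
    ∫ z, dDir v (dDir v Φ) z * G z ∂μ = ∫ z, Φ z * dDir v (dDir v G) z ∂μ := by
  have hd : ContDiff ℝ ∞ (dDir v Φ) := contDiffOn_univ.1 (contDiffOn_dDir isOpen_univ hΦ.contDiffOn v)
  have hdc : HasCompactSupport (dDir v Φ) :=
    hc.of_isClosed_subset (isClosed_tsupport _) (tsupport_dDir_subset v Φ)
  rw [integral_dDir_mul hU hd hdc ((tsupport_dDir_subset v Φ).trans hs) hG,
    integral_dDir_mul hU hΦ hc hs (contDiffOn_dDir hU hG v), neg_neg]

end DirectionalDerivative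

instance : (volume : Measure (Mink × Mink)).IsAddHaarMeasure :=
  Measure.prod.instIsAddHaarMeasure (volume : Measure Mink) (volume : Measure Mink)

lemma lineDeriv_test_apply {O : Opens Mink} (f : 𝓓(O, ℂ)) (v x : Mink) :
    (∂_{v} f) x = dDir v f x :=
  rfl

lemma boxTest_apply {O : Opens Mink} (f : 𝓓(O, ℂ)) (x : Mink) :
    boxTest f x = ∑ ν, (eta ν : ℂ) * dDir (e ν) (dDir (e ν) f) x := by
  simp only [boxTest, FunLike.coe_sum, Finset.sum_apply, FunLike.coe_smul, Pi.smul_apply,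
    smul_eq_mul]
  rfl

/-! ### The wave equation for the two-point function -/

/-- Two integrations by parts move the wave operator to the exponential, an eigenfunction with
eigenvalue `-q²`. On the light cone this is zero, so the vacuum two-point function solves the wave
equation in each argument. -/
lemma lorentzFourier_boxTest (f : Test) (q : Mink) :
    lorentzFourier (boxTest f) q = -(mink q q : ℂ) * lorentzFourier f q := by
  have h0 : (fun x : Mink => Complex.exp (-(Complex.I * (mink x q : ℂ)))) =
      fun x => Complex.exp (-(Complex.I * (minkL q x : ℂ))) := by
    simp only [minkL_apply, mink_comm q]
  have h1 : ∀ (ν : Fin 4) (x : Mink),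
      HasFDerivAt (fun x : Mink => Complex.exp (-(Complex.I * (mink x q : ℂ))))
      (Complex.exp (-(Complex.I * (mink x q : ℂ))) •
        (-(Complex.I • (Complex.ofRealCLM.comp (minkL q))))) x := fun ν x => by
    rw [h0, mink_comm x, ← minkL_apply]
    exact (((Complex.ofRealCLM.comp (minkL q)).hasFDerivAt.const_mul Complex.I).neg).cexp
  have h2 : ∀ ν, dDir (e ν) (fun x : Mink => Complex.exp (-(Complex.I * (mink x q : ℂ)))) =
      fun x => -(Complex.I * (eta ν * q ν)) * Complex.exp (-(Complex.I * (mink x q : ℂ))) :=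
    fun ν => funext fun x => by
      rw [dDir, (h1 ν x).fderiv]
      simp [minkL_apply, mink_comm q, mink_e]
      ring
  have hc : ContDiff ℝ ∞ fun x : Mink => Complex.exp (-(Complex.I * (mink x q : ℂ))) := by
    rw [h0]
    exact ((contDiff_const.mul (Complex.ofRealCLM.contDiff.comp (minkL q).contDiff)).neg).cexp
  have h3 : ∀ ν, dDir (e ν) (dDir (e ν) fun x : Mink =>
      Complex.exp (-(Complex.I * (mink x q : ℂ)))) = fun x =>
        -(q ν * q ν : ℂ) * Complex.exp (-(Complex.I * (mink x q : ℂ))) := fun ν => funext fun x => by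
    rw [h2, dDir_const_mul (hc.contDiffAt.differentiableAt (by simp)), h2]
    have h4 : (eta ν : ℂ) * eta ν = 1 := by exact_mod_cast eta_mul_eta ν
    linear_combination (Complex.I ^ 2 * (q ν * q ν) * Complex.exp (-(Complex.I * (mink x q : ℂ)))) * h4
      + (q ν * q ν) * Complex.exp (-(Complex.I * (mink x q : ℂ))) * Complex.I_sq
  have hd : ∀ ν x, (∂_{e ν} (∂_{e ν} f)) x = dDir (e ν) (dDir (e ν) f) x := fun ν x => rfl
  have hi : ∀ ν, Integrable fun x => dDir (e ν) (dDir (e ν) f) x *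
      Complex.exp (-(Complex.I * (mink x q : ℂ))) := fun ν =>
    integrable_mul_of_tsupport (U := Set.univ) (∂_{e ν} (∂_{e ν} f)).continuous
      (∂_{e ν} (∂_{e ν} f)).hasCompactSupport (Set.subset_univ _) hc.continuous.continuousOn
  have he : ∀ x, Complex.exp (-(Complex.I * (mink x q : ℂ))) * boxTest f x =
      ∑ ν, (eta ν : ℂ) * (dDir (e ν) (dDir (e ν) f) x *
        Complex.exp (-(Complex.I * (mink x q : ℂ)))) := fun x => by
    rw [boxTest_apply, Finset.mul_sum]
    exact Finset.sum_congr rfl fun ν _ => by ring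
  rw [lorentzFourier, lorentzFourier]
  simp only [he]
  rw [integral_finsetSum _ fun ν _ => (hi ν).const_mul _]
  simp only [integral_const_mul]
  have h5 : ∀ ν, ∫ x, dDir (e ν) (dDir (e ν) f) x * Complex.exp (-(Complex.I * (mink x q : ℂ))) =
      -(q ν * q ν : ℂ) * ∫ x, f x * Complex.exp (-(Complex.I * (mink x q : ℂ))) := fun ν => by
    rw [integral_dDir_dDir_mul isOpen_univ f.contDiff f.hasCompactSupport (Set.subset_univ _)
      hc.contDiffOn, h3, ← integral_const_mul]
    refine integral_congr_ae (Eventually.of_forall fun x => ?_)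
    simp only
    ring
  simp only [h5]
  rw [mink.eq_1 q q]
  push_cast
  rw [← Finset.sum_neg_distrib, Finset.sum_mul]
  refine Finset.sum_congr rfl fun ν _ => ?_
  simp only [mul_comm (f _)]
  ring

lemma field_boxTest (f : Test) : field (boxTest f) = 0 := by
  rw [field, RingQuot.mkAlgHom_rel ℂ (FieldRel.wave f), map_zero]

lemma vacuumForm_eq_zero {f g : Test} (h : ∀ q, mink q q = 0 → smear f g q = 0) :
    vacuumForm f g = 0 := by
  have h1 : ∀ p : E3, mink (-nullMom p) (-nullMom p) = 0 := fun p => by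
    rw [mink_neg_right, mink_comm, mink_neg_right, mink_nullMom_self]; simp
  have h2 : ∀ p : E3, smear f g (fourMom ‖p‖ p) = 0 := fun p => by
    rw [fourMom_norm]; exact h _ (mink_nullMom_self p)
  have h3 : ∀ p : E3, smear f g (fourMom (-‖p‖) p) = 0 := fun p => by
    rw [fourMom_neg_norm]; exact h _ (h1 _)
  simp [vacuumForm, lightConeIntegral, h2, h3]

lemma vacuumForm_boxTest_left (f g : Test) : vacuumForm (boxTest f) g = 0 :=
  vacuumForm_eq_zero fun q hq => by rw [smear, lorentzFourier_boxTest, hq]; simp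

lemma vacuumForm_boxTest_right (f g : Test) : vacuumForm f (boxTest g) = 0 :=
  vacuumForm_eq_zero fun q hq => by
    rw [smear, lorentzFourier_boxTest, mink_neg_right, mink_comm, mink_neg_right, hq]; simp

lemma dDir_smul {V : Type*} [NormedAddCommGroup V] [NormedSpace ℝ V] (c : ℝ) (v : V) (G : V → ℂ)
    (z : V) : dDir (c • v) G z = c * dDir v G z := by
  simp [dDir]

lemma lineDeriv_test_coe {O : Opens Mink} (f : 𝓓(O, ℂ)) (v : Mink) : 
    ((∂_{v} f : 𝓓(O, ℂ)) : Mink → ℂ) = dDir v f :=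
  rfl

lemma tsupport_boxTest_subset (f : Test) : tsupport (boxTest f) ⊆ tsupport f := by
  refine closure_minimal (fun x hx => ?_) (isClosed_tsupport _)
  by_contra h
  refine hx ?_
  rw [boxTest_apply]
  refine Finset.sum_eq_zero fun ν _ => ?_
  rw [image_eq_zero_of_notMem_tsupport (f := dDir (e ν) (dDir (e ν) f)) fun h' =>
    h (tsupport_dDir_subset _ _ (tsupport_dDir_subset _ _ h')), mul_zero]

lemma contDiff_tensor (f g : Test) : ContDiff ℝ ∞ fun z : Mink × Mink => f z.1 * g z.2 :=
  (f.contDiff.comp contDiff_fst).mul (g.contDiff.comp contDiff_snd)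

lemma tsupport_tensor_subset (f g : Test) :
    tsupport (fun z : Mink × Mink => f z.1 * g z.2) ⊆ tsupport f ×ˢ tsupport g := by
  refine closure_minimal (fun z hz => ?_) ((isClosed_tsupport f).prod (isClosed_tsupport g))
  rw [Function.mem_support, mul_ne_zero_iff] at hz
  exact ⟨subset_tsupport f hz.1, subset_tsupport g hz.2⟩

lemma hasCompactSupport_tensor (f g : Test) :
    HasCompactSupport fun z : Mink × Mink => f z.1 * g z.2 :=
  (f.hasCompactSupport.isCompact.prod g.hasCompactSupport.isCompact).of_isClosed_subset
    (isClosed_tsupport _) (tsupport_tensor_subset f g)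

lemma dDir_tensor (f g : Test) (u v : Mink) : dDir (u, v) (fun z : Mink × Mink => f z.1 * g z.2) =
    fun z => (∂_{u} f) z.1 * g z.2 + f z.1 * (∂_{v} g) z.2 := by
  ext z
  have hf := (f.contDiff.differentiable (by simp) z.1).hasFDerivAt.comp z hasFDerivAt_fst
  have hg := (g.contDiff.differentiable (by simp) z.2).hasFDerivAt.comp z hasFDerivAt_snd
  have h : HasFDerivAt (fun z : Mink × Mink => f z.1 * g z.2) _ z := hf.mul hg
  rw [dDir, h.fderiv, lineDeriv_test_apply, lineDeriv_test_apply]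
  simp [dDir]
  ring

/-- Integration by parts passes the equation from test functions to the kernel, where it holds
pointwise by smoothness. The directions `v` are left free so that both arguments of the kernel are
covered. -/
lemma sum_dDir_kernel_eq_zero {U : Set (Mink × Mink)} (hU : IsOpen U) {K : Mink × Mink → ℂ}
    (hK : ContDiffOn ℝ ∞ K U) (v : Fin 4 → Mink × Mink)
    (h : ∀ f g : Test, tsupport f ×ˢ tsupport g ⊆ U → ∫ z : Mink × Mink, (∑ ν, (eta ν : ℂ) *
      dDir (v ν) (dDir (v ν) fun z => f z.1 * g z.2) z) * K z = 0) :
    ∀ z ∈ U, ∑ ν, (eta ν : ℂ) * dDir (v ν) (dDir (v ν) K) z = 0 := by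
  have hc : ∀ ν, ContDiffOn ℝ ∞ (dDir (v ν) (dDir (v ν) K)) U := fun ν =>
    contDiffOn_dDir hU (contDiffOn_dDir hU hK _) _
  intro z hz
  refine eq_zero_of_integral_tensor hU (F := fun z => ∑ ν, (eta ν : ℂ) * dDir (v ν) (dDir (v ν) K) z)
    (continuousOn_finsetSum _ fun ν _ => continuousOn_const.mul (hc ν).continuousOn)
    (fun f g hfg => ?_) hz
  have hs := (tsupport_tensor_subset f g).trans hfg
  have hd := fun ν => contDiffOn_univ.1 (contDiffOn_dDir isOpen_univ
    (contDiffOn_dDir isOpen_univ (contDiff_tensor f g).contDiffOn (v ν)) (v ν))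
  have hs2 := fun ν => (tsupport_dDir_subset (v ν) _).trans
    (tsupport_dDir_subset (v ν) fun z : Mink × Mink => f z.1 * g z.2)
  have i1 : ∀ ν, Integrable fun z : Mink × Mink =>
      dDir (v ν) (dDir (v ν) fun z => f z.1 * g z.2) z * K z := fun ν =>
    integrable_mul_of_tsupport (hd ν).continuous
      ((hasCompactSupport_tensor f g).of_isClosed_subset (isClosed_tsupport _) (hs2 ν))
      ((hs2 ν).trans hs) hK.continuousOn
  have i2 : ∀ ν, Integrable fun z : Mink × Mink => f z.1 * g z.2 * dDir (v ν) (dDir (v ν) K) z :=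
    fun ν => integrable_mul_of_tsupport (contDiff_tensor f g).continuous
      (hasCompactSupport_tensor f g) hs (hc ν).continuousOn
  have h1 := h f g hfg
  simp only [Finset.sum_mul, mul_assoc (eta _ : ℂ)] at h1
  rw [integral_finsetSum _ fun ν _ => (i1 ν).const_mul _] at h1
  simp only [Finset.mul_sum, mul_left_comm _ (eta _ : ℂ)]
  rw [integral_finsetSum _ fun ν _ => (i2 ν).const_mul _, ← h1]
  refine Finset.sum_congr rfl fun ν _ => ?_
  rw [integral_const_mul, integral_const_mul,
    integral_dDir_dDir_mul hU (contDiff_tensor f g) (hasCompactSupport_tensor f g) hs hK]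

section FieldEquations

variable {Ω : FieldAlgebra →ₗ[ℂ] ℂ} {N : Set (Mink × Mink)} {K : Mink × Mink → ℂ}

lemma nPoint_pair (Ω : FieldAlgebra →ₗ[ℂ] ℂ) (f g : Test) :
    nPoint Ω [f, g] = Ω (field f * field g) := by
  simp [nPoint, monomial]

/-- Both terms vanish when `f` is replaced by `boxTest f`: the first since `φ₀(□f) = 0` in the
algebra, the second since the vacuum form is carried by the light cone. Supports do not grow under
the wave operator, so the kernel still represents the difference. -/
lemma IsNormalOrdered.wave_left (hN : IsOpen N) (h : IsNormalOrdered (nPoint Ω) N K) :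
    ∀ z ∈ N ∩ spacelikePairs, ∑ ν, (eta ν : ℂ) * dDir (e ν, 0) (dDir (e ν, 0) K) z = 0 := by
  refine sum_dDir_kernel_eq_zero (hN.inter isOpen_spacelikePairs) h.smooth _ fun f g hfg => ?_
  have h1 := h.represents (boxTest f) g
    ((Set.prod_mono (tsupport_boxTest_subset f) subset_rfl).trans hfg)
  rw [nPoint_pair, field_boxTest, zero_mul, map_zero, vacuumForm_boxTest_left, sub_zero] at h1
  rw [h1]
  refine integral_congr_ae (Eventually.of_forall fun z => ?_)
  have h0 : ∀ v : Mink, (∂_{(0 : Mink)} g) v = 0 := fun v => by simp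
  simp only [dDir_tensor, h0, mul_zero, add_zero, boxTest_apply, Finset.sum_mul]
  refine Finset.sum_congr rfl fun ν _ => ?_
  rw [lineDeriv_test_coe, lineDeriv_test_coe]
  ring

lemma IsNormalOrdered.wave_right (hN : IsOpen N) (h : IsNormalOrdered (nPoint Ω) N K) :
    ∀ z ∈ N ∩ spacelikePairs, ∑ ν, (eta ν : ℂ) * dDir (0, e ν) (dDir (0, e ν) K) z = 0 := by
  refine sum_dDir_kernel_eq_zero (hN.inter isOpen_spacelikePairs) h.smooth _ fun f g hfg => ?_
  have h1 := h.represents f (boxTest g)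
    ((Set.prod_mono subset_rfl (tsupport_boxTest_subset g)).trans hfg)
  rw [nPoint_pair, field_boxTest, mul_zero, map_zero, vacuumForm_boxTest_right, sub_zero] at h1
  rw [h1]
  refine integral_congr_ae (Eventually.of_forall fun z => ?_)
  have h0 : ∀ v : Mink, (∂_{(0 : Mink)} f) v = 0 := fun v => by simp
  simp only [dDir_tensor, h0, zero_mul, zero_add, boxTest_apply, Finset.mul_sum, Finset.sum_mul]
  refine Finset.sum_congr rfl fun ν _ => ?_
  rw [lineDeriv_test_coe, lineDeriv_test_coe]
  ring

end FieldEquations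

/-! ### Balanced derivatives -/

/-- The balanced derivatives of the kernel, in terms of the coordinates of both points. -/
def balDeriv (K : Mink × Mink → ℂ) : List (Fin 4) → Mink × Mink → ℂ
  | [] => K
  | ν :: l => dDir (eta ν • (e ν, -e ν)) (balDeriv K l)

section Balanced

variable {K : Mink × Mink → ℂ} {U : Set (Mink × Mink)}

lemma contDiffOn_balDeriv (hU : IsOpen U) (hK : ContDiffOn ℝ ∞ K U) (l : List (Fin 4)) :
    ContDiffOn ℝ ∞ (balDeriv K l) U := by
  induction l with
  | nil => exact hK
  | cons ν l ih => exact contDiffOn_dDir hU ih _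

lemma balanced_eq (hU : IsOpen U) (hK : ContDiffOn ℝ ∞ K U) (l : List (Fin 4)) (x : Mink) {ζ : Mink}
    (hz : (x + ζ, x - ζ) ∈ U) : balanced K l x ζ = balDeriv K l (x + ζ, x - ζ) := by
  have hc : Continuous fun ζ' : Mink => (x + ζ', x - ζ') := by fun_prop
  induction l generalizing ζ with
  | nil => rfl
  | cons ν l ih =>
    have h1 : dUpList l (fun ζ' => K (x + ζ', x - ζ')) =ᶠ[𝓝 ζ]
        balDeriv K l ∘ fun ζ' => (x + ζ', x - ζ') := by
      filter_upwards [(hU.preimage hc).mem_nhds hz] with ζ' hζ' using ih hζ'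
    have h2 : HasFDerivAt (fun ζ' : Mink => (x + ζ', x - ζ'))
        ((ContinuousLinearMap.id ℝ Mink).prod (-ContinuousLinearMap.id ℝ Mink)) ζ :=
      ((hasFDerivAt_id ζ).const_add x).prodMk ((hasFDerivAt_id ζ).const_sub x)
    have h3 := (((contDiffOn_balDeriv hU hK l).contDiffAt (hU.mem_nhds hz)).differentiableAt
      (by simp)).hasFDerivAt.comp ζ h2
    rw [balanced, dUpList, dUp, dLow, h1.fderiv_eq, h3.fderiv, balDeriv, dDir_smul]
    simp [dDir]

lemma balDeriv_wave (hU : IsOpen U) (hK : ContDiffOn ℝ ∞ K U) (v : Fin 4 → Mink × Mink)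
    (h : ∀ z ∈ U, ∑ ν, (eta ν : ℂ) * dDir (v ν) (dDir (v ν) K) z = 0) (l : List (Fin 4)) :
    ∀ z ∈ U, ∑ ν, (eta ν : ℂ) * dDir (v ν) (dDir (v ν) (balDeriv K l)) z = 0 := by
  induction l with
  | nil => exact h
  | cons ν l ih =>
    exact sum_dDir_dDir_dDir_eq_zero hU (contDiffOn_balDeriv hU hK l) _ v ih _

/-- This is `(∂₁ + ∂₂) · (∂₁ - ∂₂) = □₁ - □₂`, applied to a balanced derivative, which solves both
wave equations because they have constant coefficients. The mixed terms cancel by symmetry of the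
second derivative. -/
lemma sum_dDir_balDeriv_cons (hU : IsOpen U) (hK : ContDiffOn ℝ ∞ K U)
  (h₁ : ∀ z ∈ U, ∑ ν, (eta ν : ℂ) * dDir (e ν, 0) (dDir (e ν, 0) K) z = 0)
  (h₂ : ∀ z ∈ U, ∑ ν, (eta ν : ℂ) * dDir (0, e ν) (dDir (0, e ν) K) z = 0)
  (l : List (Fin 4)) :
    ∀ z ∈ U, ∑ ν, dDir (e ν, e ν) (balDeriv K (ν :: l)) z = 0 := by
  intro z hz
  have hG := contDiffOn_balDeriv hU hK l
  have e1 := balDeriv_wave hU hK _ h₁ l z hz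
  have e2 := balDeriv_wave hU hK _ h₂ l z hz
  rw [← sub_eq_zero.2 (e1.trans e2.symm), ← Finset.sum_sub_distrib]
  refine Finset.sum_congr rfl fun ν _ => ?_
  have e3 : (e ν, e ν) = (e ν, (0 : Mink)) + ((0 : Mink), e ν) := by simp
  have e4 : (e ν, -e ν) = (e ν, (0 : Mink)) - ((0 : Mink), e ν) := by simp
  have e5 := dDir_comm hU hG (e ν, 0) (0, e ν) hz
  rw [balDeriv]
  rw [dDir_dDir hU hG _ _ hz] at e5 ⊢
  rw [dDir_dDir hU hG _ _ hz] at e5 ⊢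
  rw [dDir_dDir hU hG _ _ hz, e3, e4]
  simp only [map_add, map_sub, map_smul, add_apply, Complex.real_smul]
  linear_combination (-(eta ν : ℂ)) * e5

/-- This is `(∂₁ + ∂₂)² + (∂₁ - ∂₂)² = 2 (□₁ + □₂)`, whose right-hand side annihilates the balanced
derivatives. -/
lemma sum_dDir_dDir_balDeriv (hU : IsOpen U) (hK : ContDiffOn ℝ ∞ K U)
  (h₁ : ∀ z ∈ U, ∑ ν, (eta ν : ℂ) * dDir (e ν, 0) (dDir (e ν, 0) K) z = 0)
  (h₂ : ∀ z ∈ U, ∑ ν, (eta ν : ℂ) * dDir (0, e ν) (dDir (0, e ν) K) z = 0)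
  (l : List (Fin 4)) : ∀ z ∈ U,
    ∑ ν, (eta ν : ℂ) * dDir (e ν, e ν) (dDir (e ν, e ν) (balDeriv K l)) z =
      -∑ ν, (eta ν : ℂ) * balDeriv K (ν :: ν :: l) z := by
  intro z hz
  have hG := contDiffOn_balDeriv hU hK l
  have e1 := balDeriv_wave hU hK _ h₁ l z hz
  have e2 := balDeriv_wave hU hK _ h₂ l z hz
  rw [eq_neg_iff_add_eq_zero, ← Finset.sum_add_distrib,
    show (0 : ℂ) = 2 * (∑ ν, (eta ν : ℂ) * dDir (e ν, 0) (dDir (e ν, 0) (balDeriv K l)) z) +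
      2 * ∑ ν, (eta ν : ℂ) * dDir (0, e ν) (dDir (0, e ν) (balDeriv K l)) z by rw [e1, e2]; simp,
    Finset.mul_sum, Finset.mul_sum, ← Finset.sum_add_distrib]
  refine Finset.sum_congr rfl fun ν _ => ?_
  have e3 : (e ν, e ν) = (e ν, (0 : Mink)) + ((0 : Mink), e ν) := by simp
  have e4 : (e ν, -e ν) = (e ν, (0 : Mink)) - ((0 : Mink), e ν) := by simp
  have e6 : (eta ν : ℂ) * eta ν = 1 := by exact_mod_cast eta_mul_eta ν
  rw [balDeriv, balDeriv]
  simp only [dDir_dDir hU hG _ _ hz, e3, e4]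
  simp only [map_add, map_sub, map_smul, add_apply, sub_apply,
    smul_apply, Complex.real_smul]
  generalize fderiv ℝ (fderiv ℝ (balDeriv K l)) z = D
  linear_combination (eta ν : ℂ) * (D (e ν, 0) (e ν, 0) - D (e ν, 0) (0, e ν) - D (0, e ν) (e ν, 0)
    + D (0, e ν) (0, e ν)) * e6

end Balanced

/-! ### Field equations for the balanced derivatives -/

lemma eventually_forall_mem_pair {N : Set (Mink × Mink)} (hN : IsOpen N) {C : Set Mink}
    (hC : IsCompact C) (h : ∀ x ∈ C, (x, x) ∈ N) :
    ∀ᶠ ζ in 𝓝[spacelike] 0, ∀ x ∈ C, (x + ζ, x - ζ) ∈ N ∩ spacelikePairs := by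
  have h1 : ∀ᶠ ζ in 𝓝 (0 : Mink), ∀ x ∈ C, (x + ζ, x - ζ) ∈ N := by
    refine hC.eventually_forall_of_forall_eventually fun x hx => ?_
    have hc : Continuous fun z : Mink × Mink => (z.2 + z.1, z.2 - z.1) := by fun_prop
    exact (hN.preimage hc).mem_nhds (by simpa using h x hx)
  filter_upwards [nhdsWithin_le_nhds h1, self_mem_nhdsWithin] with ζ h3 h4 x hx
  exact ⟨h3 x hx, (mem_spacelikePairs_iff x ζ).2 h4⟩

lemma contDiffOn_slice {G : Mink × Mink → ℂ} {U : Set (Mink × Mink)} (hG : ContDiffOn ℝ ∞ G U)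
    (ζ : Mink) : ContDiffOn ℝ ∞ (fun x => G (x + ζ, x - ζ)) {x | (x + ζ, x - ζ) ∈ U} := by
  have h : ContDiff ℝ ∞ fun x : Mink => (x + ζ, x - ζ) := by fun_prop
  exact hG.comp h.contDiffOn fun x hx => hx

lemma dDir_slice {G : Mink × Mink → ℂ} {U : Set (Mink × Mink)} (hU : IsOpen U)
    (hG : ContDiffOn ℝ ∞ G U) (v : Mink) {x ζ : Mink} (hx : (x + ζ, x - ζ) ∈ U) :
    dDir v (fun x => G (x + ζ, x - ζ)) x = dDir (v, v) G (x + ζ, x - ζ) := by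
  have h2 : HasFDerivAt (fun x : Mink => (x + ζ, x - ζ))
      ((ContinuousLinearMap.id ℝ Mink).prod (ContinuousLinearMap.id ℝ Mink)) x :=
    ((hasFDerivAt_id x).add_const ζ).prodMk ((hasFDerivAt_id x).sub_const ζ)
  have h3 : HasFDerivAt (fun x => G (x + ζ, x - ζ)) _ x :=
    ((hG.contDiffAt (hU.mem_nhds hx)).differentiableAt (by simp)).hasFDerivAt.comp x h2
  rw [dDir, h3.fderiv]
  simp [dDir]

section Slices

variable {Ω : FieldAlgebra →ₗ[ℂ] ℂ} {N : Set (Mink × Mink)} {K : Mink × Mink → ℂ} {O : Opens Mink}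

/-- Only points of the support of `h` count, and there the shifted pair lies in the open set on
which `K` is smooth. -/
lemma integral_test_mul_balanced (hN : IsOpen N) (hK : ContDiffOn ℝ ∞ K (N ∩ spacelikePairs))
    (h : 𝓓(O, ℂ)) {C : Set Mink} {ζ : Mink} (hh : tsupport h ⊆ C)
    (hC : ∀ x ∈ C, (x + ζ, x - ζ) ∈ N ∩ spacelikePairs) (l : List (Fin 4)) :
    ∫ x, h x * balanced K l x ζ = ∫ x, h x * balDeriv K l (x + ζ, x - ζ) := by
  refine integral_congr_ae (Eventually.of_forall fun x => ?_)
  by_cases hx : x ∈ tsupport h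
  · simp only [balanced_eq (hN.inter isOpen_spacelikePairs) hK l x (hC x (hh hx))]
  · simp [image_eq_zero_of_notMem_tsupport hx]

lemma sum_integral_lineDeriv_balanced (hN : IsOpen N) (hK : IsNormalOrdered (nPoint Ω) N K)
    (h : 𝓓(O, ℂ)) {ζ : Mink} (hζ : ∀ x ∈ tsupport h, (x + ζ, x - ζ) ∈ N ∩ spacelikePairs)
    (l : List (Fin 4)) :
    ∑ ν, ∫ x, (∂_{e ν} h) x * balanced K (ν :: l) x ζ = 0 := by
  have hU := hN.inter isOpen_spacelikePairs
  have hc : Continuous fun x : Mink => (x + ζ, x - ζ) := by fun_prop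
  have hV := hU.preimage hc
  have hB := contDiffOn_balDeriv hU hK.smooth
  have i1 : ∀ ν, Integrable fun x => h x * dDir (e ν)
      (fun x => balDeriv K (ν :: l) (x + ζ, x - ζ)) x := fun ν =>
    integrable_mul_of_tsupport h.continuous h.hasCompactSupport hζ
      (contDiffOn_dDir hV (contDiffOn_slice (hB (ν :: l)) ζ) (e ν)).continuousOn
  have h1 : ∀ ν, ∫ x, (∂_{e ν} h) x * balanced K (ν :: l) x ζ =
      -∫ x, h x * dDir (e ν) (fun x => balDeriv K (ν :: l) (x + ζ, x - ζ)) x := fun ν => by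
    rw [integral_test_mul_balanced hN hK.smooth (∂_{e ν} h) (tsupport_dDir_subset (e ν) h) hζ]
    exact integral_dDir_mul hV h.contDiff h.hasCompactSupport hζ
      (contDiffOn_slice (hB (ν :: l)) ζ) (e ν)
  simp only [h1]
  rw [Finset.sum_neg_distrib, ← integral_finsetSum _ fun ν _ => i1 ν, neg_eq_zero]
  refine integral_eq_zero_of_ae (Eventually.of_forall fun x => ?_)
  by_cases hx : x ∈ tsupport h
  · simp only [dDir_slice hU (hB _) _ (hζ x hx)]
    rw [← Finset.mul_sum, sum_dDir_balDeriv_cons hU hK.smooth (hK.wave_left hN)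
      (hK.wave_right hN) l _ (hζ x hx)]
    simp
  · simp [image_eq_zero_of_notMem_tsupport hx]

lemma integral_boxTest_balanced (hN : IsOpen N) (hK : IsNormalOrdered (nPoint Ω) N K)
    (h : 𝓓(O, ℂ)) {ζ : Mink} (hζ : ∀ x ∈ tsupport h, (x + ζ, x - ζ) ∈ N ∩ spacelikePairs)
    (l : List (Fin 4)) :
    ∑ ν, (eta ν : ℂ) * ∫ x, (∂_{e ν} (∂_{e ν} h)) x * balanced K l x ζ =
      -∑ ν, (eta ν : ℂ) * ∫ x, h x * balanced K (ν :: ν :: l) x ζ := by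
  have hU := hN.inter isOpen_spacelikePairs
  have hc : Continuous fun x : Mink => (x + ζ, x - ζ) := by fun_prop
  have hV := hU.preimage hc
  have hB := contDiffOn_balDeriv hU hK.smooth
  have hS := contDiffOn_slice (hB l) ζ
  have i1 : ∀ ν, Integrable fun x => h x * dDir (e ν) (dDir (e ν)
      fun x => balDeriv K l (x + ζ, x - ζ)) x := fun ν =>
    integrable_mul_of_tsupport h.continuous h.hasCompactSupport hζ
      (contDiffOn_dDir hV (contDiffOn_dDir hV hS (e ν)) (e ν)).continuousOn
  have i2 : ∀ ν, Integrable fun x => h x * balDeriv K (ν :: ν :: l) (x + ζ, x - ζ) := fun ν =>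
    integrable_mul_of_tsupport h.continuous h.hasCompactSupport hζ
      (contDiffOn_slice (hB (ν :: ν :: l)) ζ).continuousOn
  have h1 : ∀ ν, ∫ x, (∂_{e ν} (∂_{e ν} h)) x * balanced K l x ζ =
      ∫ x, h x * dDir (e ν) (dDir (e ν) fun x => balDeriv K l (x + ζ, x - ζ)) x := fun ν => by
    rw [integral_test_mul_balanced hN hK.smooth (∂_{e ν} (∂_{e ν} h))
      ((tsupport_dDir_subset (e ν) _).trans (tsupport_dDir_subset (e ν) h)) hζ]
    exact integral_dDir_dDir_mul hV h.contDiff h.hasCompactSupport hζ hS (e ν)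
  simp only [h1, integral_test_mul_balanced hN hK.smooth h subset_rfl hζ, ← integral_const_mul]
  rw [← integral_finsetSum _ fun ν _ => (i1 ν).const_mul _,
    ← integral_finsetSum _ fun ν _ => (i2 ν).const_mul _, ← integral_neg]
  refine integral_congr_ae (Eventually.of_forall fun x => ?_)
  by_cases hx : x ∈ tsupport h
  · have h2 : ∀ ν, dDir (e ν) (dDir (e ν) fun x => balDeriv K l (x + ζ, x - ζ)) x =
        dDir (e ν, e ν) (dDir (e ν, e ν) (balDeriv K l)) (x + ζ, x - ζ) := fun ν => by
      rw [← dDir_slice hU (contDiffOn_dDir hU (hB l) _) _ (hζ x hx)]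
      exact dDir_congr hV (fun y hy => dDir_slice hU (hB l) _ hy) _ x (hζ x hx)
    have h3 := sum_dDir_dDir_balDeriv hU hK.smooth (hK.wave_left hN)
      (hK.wave_right hN) l _ (hζ x hx)
    simp only [h2, mul_left_comm _ (h x), ← Finset.mul_sum]
    rw [h3]
    ring
  · simp [image_eq_zero_of_notMem_tsupport hx]

end Slices

lemma integrable_test_mul {O : Opens Mink} (h : 𝓓(O, ℂ)) {F : Mink → ℂ}
    (hF : LocallyIntegrableOn F O) : Integrable fun x => h x * F x := by
  rw [← integrableOn_iff_integrable_of_support_subset (s := tsupport h)]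
  · exact (hF.integrableOn_compact_subset h.tsupport_subset h.hasCompactSupport).continuousOn_mul
      h.continuous.continuousOn h.hasCompactSupport
  · exact fun z hz => subset_tsupport _ (left_ne_zero_of_mul hz)

section Limits

variable {Ω : FieldAlgebra →ₗ[ℂ] ℂ} {O : Opens Mink} {E : LocalField → Mink → ℂ}

/-- The balanced derivatives of the normal ordered square are conserved. -/
lemma HasLocalExpectations.conservation (hE : HasLocalExpectations (nPoint Ω) O E)
    (l : List (Fin 4)) (h : 𝓓(O, ℂ)) :
    ∑ ν, ∫ x, (∂_{e ν} h) x * E (.theta (ν :: l)) x = 0 := by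
  obtain ⟨N, K, hN, hO, hK, hlim⟩ := hE.theta_limit
  have h1 : Tendsto (fun ζ => ∑ ν, ∫ x, (∂_{e ν} h) x * balanced K (ν :: l) x ζ) (𝓝[spacelike] 0)
      (𝓝 (∑ ν, ∫ x, (∂_{e ν} h) x * E (.theta (ν :: l)) x)) :=
    tendsto_finsetSum _ fun ν _ => (hlim (ν :: l)).2 (∂_{e ν} h)
  refine tendsto_nhds_unique h1 (tendsto_const_nhds.congr' ?_)
  filter_upwards [eventually_forall_mem_pair hN h.hasCompactSupport
    fun x hx => hO x (h.tsupport_subset hx)] with ζ hζ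
  exact (sum_integral_lineDeriv_balanced hN hK h hζ l).symm

lemma HasLocalExpectations.integral_box (hE : HasLocalExpectations (nPoint Ω) O E)
    (l : List (Fin 4)) (h : 𝓓(O, ℂ)) :
    ∫ x, boxTest h x * E (.theta l) x =
      -∑ ν, (eta ν : ℂ) * ∫ x, h x * E (.theta (ν :: ν :: l)) x := by
  obtain ⟨N, K, hN, hO, hK, hlim⟩ := hE.theta_limit
  have h1 : Tendsto (fun ζ => ∑ ν, (eta ν : ℂ) * ∫ x, (∂_{e ν} (∂_{e ν} h)) x * balanced K l x ζ)
      (𝓝[spacelike] 0)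
      (𝓝 (∑ ν, (eta ν : ℂ) * ∫ x, (∂_{e ν} (∂_{e ν} h)) x * E (.theta l) x)) :=
    tendsto_finsetSum _ fun ν _ => ((hlim l).2 (∂_{e ν} (∂_{e ν} h))).const_mul _
  have h2 : Tendsto (fun ζ => -∑ ν, (eta ν : ℂ) * ∫ x, h x * balanced K (ν :: ν :: l) x ζ)
      (𝓝[spacelike] 0)
      (𝓝 (-∑ ν, (eta ν : ℂ) * ∫ x, h x * E (.theta (ν :: ν :: l)) x)) :=
    (tendsto_finsetSum _ fun ν _ => ((hlim (ν :: ν :: l)).2 h).const_mul _).neg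
  rw [← tendsto_nhds_unique h1 (h2.congr' ?_)]
  · simp only [← integral_const_mul]
    rw [← integral_finsetSum _ fun ν _ =>
      (integrable_test_mul (∂_{e ν} (∂_{e ν} h)) (hE.theta_integrable l)).const_mul _]
    refine integral_congr_ae (Eventually.of_forall fun x => ?_)
    simp only [boxTest_apply, Finset.sum_mul, mul_assoc]
    rfl
  · filter_upwards [eventually_forall_mem_pair hN h.hasCompactSupport
      fun x hx => hO x (h.tsupport_subset hx)] with ζ hζ
    exact (integral_boxTest_balanced hN hK h hζ l).symm

/-- In thermal states, the balanced derivatives of the normal ordered square satisfy the wave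
equation. -/
lemma IsThermal.integral_box_theta (hO : IsThermal (nPoint Ω) O) (l : List (Fin 4)) (h : 𝓓(O, ℂ)) :
    ∫ x, boxTest h x * localExp (nPoint Ω) O (.theta l) x = 0 := by
  have hE := hasLocalExpectations_localExp hO.domain
  rw [hE.integral_box, neg_eq_zero]
  simp only [← integral_const_mul]
  rw [← integral_finsetSum _ fun ν _ => (integrable_test_mul h (hE.theta_integrable _)).const_mul _]
  refine integral_eq_zero_of_ae (Eventually.of_forall fun x => ?_)
  -- After `integral_box` there remains the trace of `θ^{ν ν l}`. At each single point it can be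
  -- evaluated in a mixture of equilibrium states, where it vanishes since the momenta are
  -- light-like. Conservation, in contrast, needs no thermality.
  by_cases hx : x ∈ tsupport h
  · obtain ⟨B, hB, hBx⟩ := hO.exists_mixture (isCompact_singleton (x := x))
      (Set.singleton_subset_iff.2 (h.tsupport_subset hx))
    obtain ⟨ρ, hρ, hρB, hex⟩ := hBx x rfl
    simp only [hex, thermExp, mul_left_comm _ (h x), ← Finset.mul_sum, sum_eta_thermVal hB hρB,
      mul_zero, Pi.zero_apply]
  · simp [image_eq_zero_of_notMem_tsupport hx]

end Limits

/-! ### Lifted expectation values -/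

/-- The factor relating the thermal function of `θ^l` to `coneFn l`. -/
def thetaCoef (l : List (Fin 4)) : ℂ := thermCoef l.length * boseIntegral l.length

lemma thetaCoef_ne_zero {l : List (Fin 4)} (hl : Even l.length) : thetaCoef l ≠ 0 :=
  mul_ne_zero (thermCoef_ne_zero hl) (by exact_mod_cast (boseIntegral_pos _).ne')

lemma thermalFn_theta (l : List (Fin 4)) (β : Cone) :
    thermalFn (.theta l) β = thetaCoef l * coneFn l β.1 := by
  rw [thermalFn_eq, thermExp, thermVal_dirac, thetaCoef]

/-- The linear combination of the `θ^(g l)` with thermal function `∑ b_l coneFn (g l)`. -/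
def thetaComb (g : EvenList → List (Fin 4)) (b : EvenList →₀ ℂ) : LocalField →₀ ℂ :=
  b.sum fun l a => Finsupp.single (.theta (g l)) (a / thetaCoef (g l))

lemma thetaComb_sum (g : EvenList → List (Fin 4)) (b : EvenList →₀ ℂ) (T : LocalField → ℂ) :
    ((thetaComb g b).sum fun ψ a => a * T ψ) =
      b.sum fun l a => a / thetaCoef (g l) * T (.theta (g l)) := by
  rw [thetaComb, Finsupp.sum_sum_index (by simp) (by intros; ring)]
  exact Finsupp.sum_congr fun l _ => by rw [Finsupp.sum_single_index (by simp)]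

lemma thetaComb_sum_thermalFn {g : EvenList → List (Fin 4)} (hg : ∀ l, Even (g l).length)
    (b : EvenList →₀ ℂ) (β : Cone) :
    ((thetaComb g b).sum fun ψ a => a * thermalFn ψ β) = b.sum fun l a => a * coneFn (g l) β.1 := by
  rw [thetaComb_sum]
  refine Finsupp.sum_congr fun l _ => ?_
  rw [thermalFn_theta]
  have := thetaCoef_ne_zero (hg l)
  field_simp

section Admissible

variable {Ξ : Mink → ℂ}

lemma IsAdmissible.exists_thetaComb (hΞ : IsAdmissible Ξ) {B : Set Cone} (hB : IsCompact B) {ε : ℝ}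
    (hε : 0 < ε) : ∃ b : EvenList →₀ ℂ, ∀ β ∈ B,
      ‖Ξ β.1 - (thetaComb Subtype.val b).sum fun ψ a => a * thermalFn ψ β‖ < ε := by
  obtain ⟨b, hb⟩ := exists_coneFn_approx hΞ (hB.image continuous_subtype_val)
    (by rintro _ ⟨β, -, rfl⟩; exact β.2) hε
  refine ⟨b, fun β hβ => ?_⟩
  rw [thetaComb_sum_thermalFn fun l => l.2]
  exact hb β.1 (Set.mem_image_of_mem _ hβ)

lemma IsAdmissible.exists_gradient_thetaComb (hΞ : IsAdmissible Ξ) {B : Set Cone}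
    (hB : IsCompact B) {ε : ℝ} (hε : 0 < ε) : ∃ b : EvenList →₀ ℂ, ∀ ν, ∀ β ∈ B,
      ‖dUp ν Ξ β.1 - (thetaComb (fun l => ν :: 0 :: l.1) b).sum fun ψ a => a * thermalFn ψ β‖ < ε := by
  obtain ⟨b, hb⟩ := exists_coneFn_gradient_approx hΞ (hB.image continuous_subtype_val)
    (by rintro _ ⟨β, -, rfl⟩; exact β.2) hε
  refine ⟨b, fun ν β hβ => ?_⟩
  rw [thetaComb_sum_thermalFn (g := fun l => ν :: 0 :: l.1) fun l => l.2.add even_two]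
  exact hb ν β.1 (Set.mem_image_of_mem _ hβ)

lemma IsAdmissible.continuousOn_dUp (hΞ : IsAdmissible Ξ) (ν : Fin 4) :
    ContinuousOn (dUp ν Ξ) forwardCone :=
  continuousOn_const.mul ((hΞ.smooth.continuousOn_fderiv_of_isOpen isOpen_forwardCone
    (by simp)).clm_apply continuousOn_const)

end Admissible

/-- The thermal functions of local observables approximate `F`, uniformly on compact sets. -/
def IsThermalLimit (F : Mink → ℂ) : Prop :=
  ∀ B : Set Cone, IsCompact B → ∀ ε : ℝ, 0 < ε → ∃ c : LocalField →₀ ℂ,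
    ∀ β ∈ B, ‖F β.1 - c.sum fun ψ a => a * thermalFn ψ β‖ < ε

/-- On compact sets, uniform approximations of `F` by thermal functions of local observables yield
uniform approximations of `u` by the expectation values of these observables. -/
def IsLift (w : NPoint) (O : Opens Mink) (F u : Mink → ℂ) : Prop :=
  ∀ C : Set Mink, IsCompact C → C ⊆ O → ∃ B : Set Cone, IsCompact B ∧
    ∀ (c : LocalField →₀ ℂ) (δ : ℝ), (∀ β ∈ B, ‖F β.1 - c.sum fun ψ a => a * thermalFn ψ β‖ ≤ δ) →
      ∀ x ∈ C, ‖u x - c.sum fun ψ a => a * localExp w O ψ x‖ ≤ δ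

section Lift

variable {w : NPoint} {O : Opens Mink} {F : Mink → ℂ}

/-- Local expectation values in a mixture are averages of thermal functions, and averaging over a
probability measure carried by `B` does not increase a uniform error on `B`. -/
lemma norm_integral_sub_le {ρ : Measure Cone} [IsProbabilityMeasure ρ] {B : Set Cone}
    (hB : IsCompact B) (hρ : ρ Bᶜ = 0) (hF : ContinuousOn F forwardCone) (c : LocalField →₀ ℂ)
    {δ : ℝ} (h : ∀ β ∈ B, ‖F β.1 - c.sum fun ψ a => a * thermalFn ψ β‖ ≤ δ) (x : Mink) :
    ‖∫ β, F β.1 ∂ρ - c.sum fun ψ a => a * thermExp ρ ψ x‖ ≤ δ := by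
  have hae : ∀ᵐ β ∂ρ, β ∈ B := mem_ae_iff.2 hρ
  have hc : Continuous fun β : Cone => F β.1 := continuousOn_iff_continuous_domRestrict.1 hF
  obtain ⟨M, hM⟩ := hB.exists_bound_of_continuousOn hc.continuousOn
  have i1 : Integrable (fun β : Cone => F β.1) ρ :=
    Integrable.of_bound hc.aestronglyMeasurable M (hae.mono hM)
  have i2 : ∀ ψ, Integrable (fun β => c ψ * thermalFn ψ β) ρ := fun ψ =>
    (integrable_thermalFn hB hρ ψ).const_mul _
  have e1 : ∫ β, F β.1 ∂ρ - (c.sum fun ψ a => a * thermExp ρ ψ x) =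
      ∫ β, (F β.1 - c.sum fun ψ a => a * thermalFn ψ β) ∂ρ := by
    simp only [Finsupp.sum]
    rw [integral_sub i1 (integrable_finsetSum _ fun ψ _ => i2 ψ),
      integral_finsetSum _ fun ψ _ => i2 ψ]
    simp only [integral_const_mul, integral_thermalFn hB hρ _ x]
  rw [e1]
  simpa using norm_integral_le_of_norm_le_const (hae.mono h)

/-- The lift is `∫ F dρ_x` with `ρ_x` chosen point by point, without uniform control of its support.
On a compact `C` the estimate is made with another representing measure `ρ'`, carried by the common
set `B`; it remains to see that both measures give the same integral. -/
lemma IsThermal.exists_isLift (hO : IsThermal w O) (hF : ContinuousOn F forwardCone)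
    (hA : IsThermalLimit F) : ∃ u, IsLift w O F u := by
  have h1 : ∀ x : Mink, ∃ ρ : Measure Cone, x ∈ O → ∃ B : Set Cone, IsCompact B ∧
      IsProbabilityMeasure ρ ∧ ρ Bᶜ = 0 ∧ ∀ ψ, localExp w O ψ x = thermExp ρ ψ x := fun x => by
    by_cases hx : x ∈ O
    · obtain ⟨B, hB, hBx⟩ := hO.exists_mixture (isCompact_singleton (x := x))
        (Set.singleton_subset_iff.2 hx)
      obtain ⟨ρ, h⟩ := hBx x rfl
      exact ⟨ρ, fun _ => ⟨B, hB, h⟩⟩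
    · exact ⟨0, fun h => (hx h).elim⟩
  choose ρ hρ using h1
  refine ⟨fun x => ∫ β, F β.1 ∂ρ x, fun C hC hCO => ?_⟩
  obtain ⟨B, hB, hBC⟩ := hO.exists_mixture hC hCO
  refine ⟨B, hB, fun c δ hδ x hx => ?_⟩
  obtain ⟨ρ', hρ', hB', hex'⟩ := hBC x hx
  obtain ⟨D, hD, hρ1, hρD, hex⟩ := hρ x (hCO hx)
  have h2 := norm_integral_sub_le hB hB' hF c hδ x
  -- Both measures give every local observable the value it has in the state. Approximating `F` by
  -- thermal functions on the union of the two supports puts both integrals within `ε / 2` of one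
  -- such value.
  have h3 : ∫ β, F β.1 ∂ρ x = ∫ β, F β.1 ∂ρ' := by
    refine eq_of_forall_dist_le fun ε hε => ?_
    obtain ⟨d, hd⟩ := hA (B ∪ D) (hB.union hD) (ε / 2) (half_pos hε)
    have e1 := norm_integral_sub_le hB hB' hF d (fun β hβ => (hd β (Or.inl hβ)).le) x
    have e2 := norm_integral_sub_le hD hρD hF d (fun β hβ => (hd β (Or.inr hβ)).le) x
    simp only [← hex', ← hex] at e1 e2
    rw [← dist_eq_norm] at e1 e2
    linarith [dist_triangle_right (∫ β, F β.1 ∂ρ x) (∫ β, F β.1 ∂ρ')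
      (d.sum fun ψ a => a * localExp w O ψ x)]
  simp only [h3, hex']
  exact h2

lemma IsLift.isLiftedExpectation {u : Mink → ℂ} (hu : IsLift w O F u) (hA : IsThermalLimit F)
    {x : Mink} (hx : x ∈ O) : IsLiftedExpectation w O x F (u x) := by
  refine ⟨hA, fun ε hε => ?_⟩
  obtain ⟨B, hB, h⟩ := hu {x} isCompact_singleton (Set.singleton_subset_iff.2 hx)
  exact ⟨B, hB, ε / 2, half_pos hε, fun c hc =>
    (h c (ε / 2) (fun β hβ => (hc β hβ).le) x rfl).trans_lt (half_lt_self hε)⟩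

lemma IsThermal.locallyIntegrableOn_localExp (hO : IsThermal w O) (ψ : LocalField) :
    LocallyIntegrableOn (localExp w O ψ) O := by
  have hE := hasLocalExpectations_localExp hO.domain
  cases ψ with
  | one =>
    exact (continuousOn_const.congr hE.one).locallyIntegrableOn O.isOpen.measurableSet
  | field => exact hE.field_continuous.locallyIntegrableOn O.isOpen.measurableSet
  | theta l => exact hE.theta_integrable l

lemma IsThermal.integrableOn_comb (hO : IsThermal w O) (c : LocalField →₀ ℂ) {C : Set Mink}
    (hC : IsCompact C) (hCO : C ⊆ O) :
    IntegrableOn (fun x => c.sum fun ψ a => a * localExp w O ψ x) C :=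
  integrable_finsetSum _ fun ψ _ =>
    ((hO.locallyIntegrableOn_localExp ψ).integrableOn_compact_subset hCO hC).const_mul _

/-- On a compact set the lift is a uniform limit of combinations of locally integrable expectation
values. This yields measurability without any choice of measures depending measurably on `x`; the
approximant with error at most `1` provides the dominating function. -/
lemma IsLift.locallyIntegrableOn {u : Mink → ℂ} (hu : IsLift w O F u) (hO : IsThermal w O)
    (hA : IsThermalLimit F) : LocallyIntegrableOn u O := by
  rw [locallyIntegrableOn_iff O.isOpen.isLocallyClosed]
  intro C hCO hC
  obtain ⟨B, hB, h⟩ := hu C hC hCO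
  choose c hc using fun n : ℕ => hA B hB (1 / ((n : ℝ) + 1)) Nat.one_div_pos_of_nat
  have h1 := fun n => h (c n) _ fun β hβ => (hc n β hβ).le
  have hae : ∀ᵐ x ∂volume.restrict C, x ∈ C := ae_restrict_mem hC.measurableSet
  have hi := fun n => hO.integrableOn_comb (c n) hC hCO
  have hm : AEStronglyMeasurable u (volume.restrict C) := by
    refine aestronglyMeasurable_of_tendsto_ae atTop (fun n => (hi n).aestronglyMeasurable) ?_
    filter_upwards [hae] with x hx
    rw [tendsto_iff_norm_sub_tendsto_zero]
    refine squeeze_zero (fun n => norm_nonneg _) (fun n => ?_) tendsto_one_div_add_atTop_nhds_zero_nat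
    rw [norm_sub_rev]
    exact h1 n x hx
  have : IsFiniteMeasure (volume.restrict C) := ⟨by simpa using hC.measure_lt_top⟩
  refine ((hi 0).norm.add (integrable_const 1)).mono' hm ?_
  filter_upwards [hae] with x hx
  have h2 := h1 0 x hx
  have h3 := norm_sub_norm_le (u x) ((c 0).sum fun ψ a => a * localExp w O ψ x)
  simp only [CharP.cast_eq_zero, zero_add, div_one] at h2
  simp only [Pi.add_apply]
  linarith

lemma norm_integral_test_mul_sub_le (φ : 𝓓(O, ℂ)) {u T : Mink → ℂ} (hu : LocallyIntegrableOn u O)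
    (hT : LocallyIntegrableOn T O) {δ : ℝ} {C : Set Mink} (hC : tsupport φ ⊆ C)
    (h : ∀ x ∈ C, ‖u x - T x‖ ≤ δ) :
    ‖(∫ x, φ x * u x) - ∫ x, φ x * T x‖ ≤ (∫ x, ‖φ x‖) * δ := by
  have hφ : Integrable fun x => ‖φ x‖ :=
    (φ.continuous.integrable_of_hasCompactSupport φ.hasCompactSupport).norm
  rw [← integral_sub (integrable_test_mul φ hu) (integrable_test_mul φ hT), ← integral_mul_const]
  refine norm_integral_le_of_norm_le (hφ.mul_const _) (Eventually.of_forall fun x => ?_)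
  rw [← mul_sub, norm_mul]
  by_cases hx : x ∈ tsupport φ
  · exact mul_le_mul_of_nonneg_left (h x (hC hx)) (norm_nonneg _)
  · simp [image_eq_zero_of_notMem_tsupport hx]

lemma IsThermal.locallyIntegrableOn_comb (hO : IsThermal w O) (c : LocalField →₀ ℂ) :
    LocallyIntegrableOn (fun x => c.sum fun ψ a => a * localExp w O ψ x) O :=
  (locallyIntegrableOn_iff O.isOpen.isLocallyClosed).2 fun _ hCO hC => hO.integrableOn_comb c hC hCO

lemma IsThermal.integral_test_mul_thetaComb (hO : IsThermal w O) (φ : 𝓓(O, ℂ))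
    (g : EvenList → List (Fin 4)) (b : EvenList →₀ ℂ) :
    ∫ x, φ x * (thetaComb g b).sum (fun ψ a => a * localExp w O ψ x) =
      b.sum fun l a => a / thetaCoef (g l) * ∫ x, φ x * localExp w O (.theta (g l)) x := by
  simp only [thetaComb_sum]
  simp only [Finsupp.sum, Finset.mul_sum, mul_left_comm (φ _)]
  rw [integral_finsetSum _ fun l _ =>
    (integrable_test_mul φ (hO.locallyIntegrableOn_localExp _)).const_mul _]
  simp only [integral_const_mul]

lemma eq_zero_of_forall_norm_le {z : ℂ} {A : ℝ} (h : ∀ δ : ℝ, 0 < δ → ‖z‖ ≤ A * δ) : z = 0 := by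
  have h1 : Tendsto (fun δ : ℝ => A * δ) (𝓝[>] 0) (𝓝 0) := by
    have : Continuous fun δ : ℝ => A * δ := by fun_prop
    simpa using (this.tendsto 0).mono_left nhdsWithin_le_nhds
  exact norm_le_zero_iff.1 (ge_of_tendsto h1 (eventually_mem_nhdsWithin.mono h))

end Lift

section Equations

variable {Ω : FieldAlgebra →ₗ[ℂ] ℂ} {O : Opens Mink} {Ξ : Mink → ℂ}

lemma IsAdmissible.isThermalLimit (hΞ : IsAdmissible Ξ) : IsThermalLimit Ξ := fun _ hB _ hε =>
  let ⟨_, hb⟩ := hΞ.exists_thetaComb hB hε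
  ⟨_, hb⟩

lemma IsAdmissible.isThermalLimit_dUp (hΞ : IsAdmissible Ξ) (ν : Fin 4) :
    IsThermalLimit (dUp ν Ξ) := fun _ hB _ hε =>
  let ⟨_, hb⟩ := hΞ.exists_gradient_thetaComb hB hε
  ⟨_, hb ν⟩

/-- The approximants are combinations of the `θ^l`, each of which satisfies the wave equation in a
thermal state. So the integral is at most the approximation error times the `L¹` norm of `boxTest
h`. -/
lemma IsLift.integral_boxTest (hO : IsThermal (nPoint Ω) O) (hΞ : IsAdmissible Ξ) {u : Mink → ℂ}
    (hu : IsLift (nPoint Ω) O Ξ u) (h : 𝓓(O, ℂ)) : ∫ x, boxTest h x * u x = 0 := by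
  obtain ⟨B, hB, hBu⟩ := hu (tsupport (boxTest h)) (boxTest h).hasCompactSupport
    (boxTest h).tsupport_subset
  refine eq_zero_of_forall_norm_le (A := ∫ x, ‖boxTest h x‖) fun δ hδ => ?_
  obtain ⟨b, hb⟩ := hΞ.exists_thetaComb hB hδ
  have h1 := norm_integral_test_mul_sub_le (boxTest h) (hu.locallyIntegrableOn hO hΞ.isThermalLimit)
    (hO.locallyIntegrableOn_comb _) subset_rfl (hBu _ δ fun β hβ => (hb β hβ).le)
  rw [hO.integral_test_mul_thetaComb, Finsupp.sum, Finset.sum_eq_zero fun l _ => by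
    rw [hO.integral_box_theta, mul_zero]] at h1
  simpa using h1

lemma IsLift.sum_integral_lineDeriv (hO : IsThermal (nPoint Ω) O) (hΞ : IsAdmissible Ξ)
    {j : Fin 4 → Mink → ℂ} (hj : ∀ ν, IsLift (nPoint Ω) O (dUp ν Ξ) (j ν)) (h : 𝓓(O, ℂ)) :
    ∑ ν, ∫ x, (∂_{e ν} h) x * j ν x = 0 := by
  obtain ⟨φ, hφ⟩ : ∃ φ : Fin 4 → 𝓓(O, ℂ), ∀ ν, φ ν = ∂_{e ν} h := ⟨_, fun _ => rfl⟩
  have hs : ∀ ν, tsupport (φ ν) ⊆ tsupport h := fun ν => hφ ν ▸ tsupport_dDir_subset (e ν) h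
  have hcons : ∀ l, ∑ ν, ∫ x, φ ν x * localExp (nPoint Ω) O (.theta (ν :: l)) x = 0 := fun l => by
    simp only [hφ]
    exact (hasLocalExpectations_localExp hO.domain).conservation l h
  simp only [← hφ]
  choose B hB hBj using fun ν => hj ν (tsupport h) h.hasCompactSupport h.tsupport_subset
  refine eq_zero_of_forall_norm_le (A := ∑ ν, ∫ x, ‖φ ν x‖) fun δ hδ => ?_
  -- One set of coefficients serves all four components, on the union of the temperature supports
  -- belonging to them. With coefficients depending on `ν`, the sum over `ν` would not be a
  -- combination of conserved divergences.
  obtain ⟨b, hb⟩ := hΞ.exists_gradient_thetaComb (isCompact_iUnion hB) hδ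
  have h1 : ∀ ν, ‖(∫ x, φ ν x * j ν x) - b.sum fun l a => a / thetaCoef (ν :: 0 :: l.1) *
      ∫ x, φ ν x * localExp (nPoint Ω) O (.theta (ν :: 0 :: l.1)) x‖ ≤
        (∫ x, ‖φ ν x‖) * δ := fun ν => by
    rw [← hO.integral_test_mul_thetaComb (φ ν) (fun l => ν :: 0 :: l.1)]
    exact norm_integral_test_mul_sub_le (φ ν)
      ((hj ν).locallyIntegrableOn hO (hΞ.isThermalLimit_dUp ν)) (hO.locallyIntegrableOn_comb _)
      (hs ν)
      (hBj ν _ δ fun β hβ => (hb ν β (Set.mem_iUnion_of_mem ν hβ)).le)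
  have h2 : ∑ ν, (b.sum fun l a => a / thetaCoef (ν :: 0 :: l.1) *
      ∫ x, φ ν x * localExp (nPoint Ω) O (.theta (ν :: 0 :: l.1)) x) = 0 := by
    simp only [Finsupp.sum]
    rw [Finset.sum_comm]
    refine Finset.sum_eq_zero fun l _ => ?_
    -- The normalisation depends on the order of the multi-index only, not on `ν`, so it can be
    -- taken out of the sum over `ν`.
    simp only [thetaCoef, List.length_cons]
    rw [← Finset.mul_sum, hcons, mul_zero]
  calc ‖∑ ν, ∫ x, φ ν x * j ν x‖ = ‖∑ ν, ((∫ x, φ ν x * j ν x) - b.sum fun l a => a / thetaCoef (ν :: 0 :: l.1) *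
        ∫ x, φ ν x * localExp (nPoint Ω) O (.theta (ν :: 0 :: l.1)) x)‖ := by
        rw [Finset.sum_sub_distrib, h2, sub_zero]
    _ ≤ ∑ ν, (∫ x, ‖φ ν x‖) * δ := norm_sum_le_of_le _ fun ν _ => h1 ν
    _ = (∑ ν, ∫ x, ‖φ ν x‖) * δ := (Finset.sum_mul _ _ _).symm

end Equations

end
end LocalEq

theorem lemma4p1 (ω : FieldAlgebra →ₗ[ℂ] ℂ) (hω : IsState ω)
    (O : Opens Mink) (hO : IsThermal (nPoint ω) O)
    (Ξ : Mink → ℂ) (hΞ : IsAdmissible Ξ) :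
    ∃ (u : Mink → ℂ) (j : Fin 4 → Mink → ℂ),
      -- `u x` is `ω(Ξ)(x)` and `j ν x` is `ω(∂^ν Ξ)(x)`
      (∀ x ∈ O, IsLiftedExpectation (nPoint ω) O x Ξ (u x)) ∧
      (∀ ν, ∀ x ∈ O, IsLiftedExpectation (nPoint ω) O x (dUp ν Ξ) (j ν x)) ∧
      LocallyIntegrableOn u O ∧
      (∀ ν, LocallyIntegrableOn (j ν) O) ∧
      -- `∂_ν ω(∂^ν Ξ) = 0` on `O`, in the sense of distributions
      (∀ h : 𝓓(O, ℂ), ∫ x, ∑ ν, j ν x * (∂_{e ν} h) x = 0) ∧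
      -- `□ ω(Ξ) = 0` on `O`, in the sense of distributions
      (∀ h : 𝓓(O, ℂ), ∫ x, u x * (boxTest h) x = 0) := by
  obtain ⟨u, hu⟩ := hO.exists_isLift hΞ.smooth.continuousOn hΞ.isThermalLimit
  choose j hj using fun ν => hO.exists_isLift (hΞ.continuousOn_dUp ν) (hΞ.isThermalLimit_dUp ν)
  have hji := fun ν => (hj ν).locallyIntegrableOn hO (hΞ.isThermalLimit_dUp ν)
  refine ⟨u, j, fun x hx => hu.isLiftedExpectation hΞ.isThermalLimit hx,
    fun ν x hx => (hj ν).isLiftedExpectation (hΞ.isThermalLimit_dUp ν) hx,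
    hu.locallyIntegrableOn hO hΞ.isThermalLimit, hji, fun h => ?_, fun h => ?_⟩
  · simp only [mul_comm (j _ _)]
    rw [integral_finsetSum _ fun ν _ => integrable_test_mul (∂_{e ν} h) (hji ν)]
    exact IsLift.sum_integral_lineDeriv hO hΞ hj h
  · simp only [mul_comm (u _)]
    exact hu.integral_boxTest hO hΞ h
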